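/- Let $k$ be an algebraically closed field and let $X$ be a smooth variety over $k$ (integral, separated, of finite type; not necessarily projective). Let $D = D_1 + D_2$ be a (not necessarily reduced) normal crossing divisor on $X$, where $D_1, D_2$ are effective divisors, which may have common components; normal crossing means that every point of $X$ has an étale neighbourhood with local coordinates $z_1,\dots,z_n$ in which $D_{\mathrm{red}} = (z_1\cdots z_l)$ for some $0 \le l \le n$. For an effective divisor $E$ with support contained in that of $D$, let $\Omega^1_X(\log E)$ be the sheaf of one-forms with logarithmic poles along $E_{\mathrm{red}}$, that is, the sheaf of rational one-forms $\omega$ such that $\omega$ and $d\omega$ have at most simple poles along $E_{\mathrm{red}}$; where $E_{\mathrm{red}} = (z_1 \cdots z_l)$ in local coordinates as above, it is generated by $\frac{dz_1}{z_1},\dots,\frac{dz_l}{z_l},dz_{l+1},\dots,dz_n$. A vector bundle $\mathcal{E}$ on a proper scheme is ample if for every coherent sheaf $\mathcal{F}$ there is an integer $m_0 > 0$ such that $\mathcal{F}\otimes \mathrm{Sym}^m\mathcal{E}$ is generated by its global sections for all $m \ge m_0$. For an open subset $U \subseteq X$, a vector bundle $\mathcal{E}$ on $X$ is quasi-ample with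 respect to $U$ if for every complete nonsingular curve $C$ over $k$ and every non-constant $k$-morphism $\gamma : C \to X$ with $\gamma(C) \cap U \ne \emptyset$, the bundle $\gamma^*\mathcal{E}$ is ample on $C$. If $\Omega^1_X(\log D_2)$ is quasi-ample with respect to $X - D_2$, then $\Omega^1_X(\log D)$ is quasi-ample with respect to $X - D$. -/

import Mathlib

open CategoryTheory AlgebraicGeometry TopologicalSpace Opposite
open scoped KaehlerDifferential

universe u

noncomputable section

/-! ### Tensor products and symmetric powers of sheaves of modules -/

namespace SymmetricPower

section

variable {R S : Type u} [CommRing R] [CommRing S] (σ : R →+* S) (ι : Type u)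
  {M N : Type u} [AddCommGroup M] [Module R M] [AddCommGroup N] [Module S N]

/-- The map `M^{⊗ι} → Sym_S^ι N`, `⊗ mᵢ ↦ ∏ f mᵢ`, induced by a map `f : M → N` which is semilinear
along `σ : R → S`. -/
def liftₛₗ (f : M →ₛₗ[σ] N) :
    PiTensorProduct R (fun _ : ι => M) →ₛₗ[σ] SymmetricPower S ι N :=
  letI : Module R (SymmetricPower S ι N) := Module.compHom _ σ
  let φ : MultilinearMap R (fun _ : ι => M) (SymmetricPower S ι N) :=
    { toFun := fun m => SymmetricPower.tprod S (fun i => f (m i))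
      map_update_add' := by
        intro _ m i x y
        have h : ∀ z : M, (fun j => f (Function.update m i z j)) =
            Function.update (fun j => f (m j)) i (f z) := by
          intro z; funext j
          by_cases hj : j = i
          · subst hj; simp
          · simp [hj]
        rw [h, h, h, map_add, MultilinearMap.map_update_add]
      map_update_smul' := by
        intro _ m i c x
        have h : ∀ z : M, (fun j => f (Function.update m i z j)) =
            Function.update (fun j => f (m j)) i (f z) := by
          intro z; funext j
          by_cases hj : j = i
          · subst hj; simp
          · simp [hj]
        rw [h, h, map_smulₛₗ, MultilinearMap.map_update_smul]
        rfl }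
  { toFun := PiTensorProduct.lift φ
    map_add' := fun x y => map_add (PiTensorProduct.lift φ) x y
    map_smul' := fun r x => map_smul (PiTensorProduct.lift φ) r x }

theorem liftₛₗ_tprod (f : M →ₛₗ[σ] N) (m : ι → M) :
    liftₛₗ σ ι f (PiTensorProduct.tprod R m) = SymmetricPower.tprod S (fun i => f (m i)) := by
  let _ : Module R (SymmetricPower S ι N) := Module.compHom _ σ
  exact PiTensorProduct.lift.tprod (R := R) (s := fun _ : ι => M) (E := SymmetricPower S ι N) m

/-- The map `Sym_R^ι M → Sym_S^ι N`, `∏ mᵢ ↦ ∏ f mᵢ`, induced by a map `f : M → N` which is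
semilinear along `σ : R → S`. -/
def mapₛₗ (f : M →ₛₗ[σ] N) : SymmetricPower R ι M →ₛₗ[σ] SymmetricPower S ι N :=
  { AddCon.lift (addConGen (SymmetricPower.Rel R ι M)) (liftₛₗ σ ι f).toAddMonoidHom
      (by
        refine AddCon.addConGen_le.mpr ?_
        rintro _ _ ⟨e, m⟩
        refine (AddCon.ker_rel _).mpr ?_
        exact (liftₛₗ_tprod σ ι f m).trans
          ((SymmetricPower.tprod_equiv (R := S) e (fun i => f (m i))).symm.trans
            (liftₛₗ_tprod σ ι f (fun i => m (e i))).symm)) with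
    map_smul' := by
      intro r x
      induction x using AddCon.induction_on with
      | H x => exact map_smulₛₗ (liftₛₗ σ ι f) r x }

theorem mapₛₗ_tprod (f : M →ₛₗ[σ] N) (m : ι → M) :
    mapₛₗ σ ι f (SymmetricPower.tprod R m) = SymmetricPower.tprod S (fun i => f (m i)) :=
  liftₛₗ_tprod σ ι f m

theorem mapₛₗ_id (σ : R →+* R) (hσ : ∀ r, σ r = r) (f : M →ₛₗ[σ] M) (hf : ∀ m, f m = m)
    (x : SymmetricPower R ι M) : mapₛₗ σ ι f x = x := by
  have hx : x ∈ Submodule.span R (Set.range (SymmetricPower.tprod R (ι := ι) (M := M))) := by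
    rw [SymmetricPower.span_tprod_eq_top]; trivial
  induction hx using Submodule.span_induction with
  | mem x h => obtain ⟨m, rfl⟩ := h; rw [mapₛₗ_tprod]; simp only [hf]
  | zero => exact map_zero _
  | add x y _ _ hx hy => rw [map_add, hx, hy]
  | smul r x _ hx => rw [map_smulₛₗ, hx, hσ]

theorem mapₛₗ_comp {T P : Type u} [CommRing T] [AddCommGroup P] [Module T P]
    (τ : S →+* T) (ρ : R →+* T) (hρ : ∀ r, ρ r = τ (σ r)) (f : M →ₛₗ[σ] N) (g : N →ₛₗ[τ] P)
    (h : M →ₛₗ[ρ] P) (hh : ∀ m, h m = g (f m)) (x : SymmetricPower R ι M) :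
    mapₛₗ ρ ι h x = mapₛₗ τ ι g (mapₛₗ σ ι f x) := by
  have hx : x ∈ Submodule.span R (Set.range (SymmetricPower.tprod R (ι := ι) (M := M))) := by
    rw [SymmetricPower.span_tprod_eq_top]; trivial
  induction hx using Submodule.span_induction with
  | mem x hx => obtain ⟨m, rfl⟩ := hx; rw [mapₛₗ_tprod, mapₛₗ_tprod, mapₛₗ_tprod]; simp only [hh]
  | zero => rw [map_zero, map_zero, map_zero]
  | add x y _ _ hx hy => rw [map_add, map_add, map_add, hx, hy]
  | smul r x _ hx => rw [map_smulₛₗ, map_smulₛₗ, map_smulₛₗ, hx, hρ]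

end

end SymmetricPower

namespace PresheafOfModules

variable {C : Type*} [Category* C] {R : Cᵒᵖ ⥤ CommRingCat.{u}}
  (M : PresheafOfModules.{u} (R ⋙ forget₂ _ _))

/-- The restriction maps of a presheaf of modules over a presheaf of commutative rings, as
semilinear maps. -/
def symPowerResAux {U V : Cᵒᵖ} (f : U ⟶ V) :
    (M.obj U : ModuleCat.{u} (R.obj U)) →ₛₗ[(R.map f).hom] (M.obj V : ModuleCat.{u} (R.obj V)) :=
  M.restrictₛₗ f

/-- The `n`-th symmetric power of `M(U)` over `R(U)`. -/
def symPowerObj (n : ℕ) (U : Cᵒᵖ) : ModuleCat.{u} (R.obj U) :=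
  ModuleCat.of (R.obj U)
    (SymmetricPower (R.obj U) (ULift.{u} (Fin n)) (M.obj U : ModuleCat.{u} (R.obj U)))

/-- The restriction map `Symⁿ M(U) → Symⁿ M(V)`. -/
def symPowerRes (n : ℕ) {U V : Cᵒᵖ} (f : U ⟶ V) :
    symPowerObj M n U →ₛₗ[(R.map f).hom] symPowerObj M n V :=
  SymmetricPower.mapₛₗ (R.map f).hom (ULift.{u} (Fin n)) (symPowerResAux M f)

theorem symPowerRes_id (n : ℕ) (U : Cᵒᵖ) (x : symPowerObj M n U) :
    symPowerRes M n (𝟙 U) x = x := by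
  refine SymmetricPower.mapₛₗ_id _ _ (fun r => ?_) _ (fun m => ?_) x
  · rw [R.map_id]; rfl
  · change M.map (𝟙 U) m = m
    simp
    rfl

theorem symPowerRes_comp (n : ℕ) {U V W : Cᵒᵖ} (f : U ⟶ V) (g : V ⟶ W)
    (x : symPowerObj M n U) :
    symPowerRes M n (f ≫ g) x = symPowerRes M n g (symPowerRes M n f x) := by
  refine SymmetricPower.mapₛₗ_comp _ _ _ _ (fun r => ?_) (symPowerResAux M f)
    (symPowerResAux M g) _ (fun m => ?_) x
  · rw [R.map_comp]; rfl
  · change M.map (f ≫ g) m = M.map g (M.map f m)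
    simp
    rfl

/-- The presheaf `U ↦ Symⁿ M(U)`. -/
def symPower (n : ℕ) : PresheafOfModules.{u} (R ⋙ forget₂ _ _) where
  obj U := symPowerObj M n U
  map {U V} f := ModuleCat.semilinearMapAddEquiv (R.map f).hom (symPowerObj M n U)
    (symPowerObj M n V) (symPowerRes M n f)
  map_id U := ModuleCat.hom_ext (LinearMap.ext fun x => symPowerRes_id M n U x)
  map_comp f g := ModuleCat.hom_ext (LinearMap.ext fun x => symPowerRes_comp M n f g x)

end PresheafOfModules

namespace AlgebraicGeometry.Scheme.Modules

variable {X : Scheme.{u}}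

/-- The tensor product `F ⊗ G` of sheaves of modules: the sheaf associated with
`U ↦ F(U) ⊗ G(U)`. -/
def tensor (F G : X.Modules) : X.Modules :=
  (PresheafOfModules.sheafification (𝟙 X.ringCatSheaf.obj)).obj
    (PresheafOfModules.Monoidal.tensorObj (R := X.presheaf) F.val G.val)

/-- The symmetric power `Symⁿ E` of a sheaf of modules: the sheaf associated with
`U ↦ Symⁿ E(U)`. -/
def symPower (n : ℕ) (E : X.Modules) : X.Modules :=
  (PresheafOfModules.sheafification (𝟙 X.ringCatSheaf.obj)).obj
    (PresheafOfModules.symPower (R := X.presheaf) E.val n)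

/-- The sheaf `F` is generated by its global sections. -/
def IsGloballyGenerated (F : X.Modules) : Prop :=
  Nonempty (SheafOfModules.GeneratingSections (R := X.ringCatSheaf) F)

/-- Coherence, on a locally noetherian scheme: there a sheaf of modules is coherent if and only if
it is locally the cokernel of a morphism `𝒪^m ⟶ 𝒪^n`. -/
def IsCoherent (F : X.Modules) : Prop :=
  SheafOfModules.IsFinitePresentation (R := X.ringCatSheaf) F

/-- Ampleness of a vector bundle `E` on a proper scheme: for every coherent sheaf `F` there is
`m₀ > 0` such that `F ⊗ Symᵐ E` is globally generated for all `m ≥ m₀`. -/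
def IsAmple (E : X.Modules) : Prop :=
  ∀ F : X.Modules, F.IsCoherent → ∃ m₀ : ℕ, 0 < m₀ ∧ ∀ m : ℕ, m₀ ≤ m →
    (F.tensor (symPower m E)).IsGloballyGenerated

/-- Quasi-ampleness, with respect to an open subset `U`, of a vector bundle `E` on a scheme `X`
over a field `k`: the pullback of `E` under every non-constant `k`-morphism `γ : C ⟶ X` from a
complete nonsingular curve whose image meets `U` is ample. -/
def IsQuasiAmpleWrt (k : Type u) [Field k] [X.Over (Spec (.of k))] (E : X.Modules)
    (U : X.Opens) : Prop :=
  ∀ (C : Scheme.{u}) [C.Over (Spec (.of k))] [IsIntegral C] [IsProper (C ↘ Spec (.of k))]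
    [SmoothOfRelativeDimension 1 (C ↘ Spec (.of k))] (γ : C ⟶ X) [γ.IsOver (Spec (.of k))],
    (¬ ∃ x : X, ∀ c : C, γ c = x) → (∃ c : C, γ c ∈ U) →
      IsAmple ((Modules.pullback γ).obj E)

end AlgebraicGeometry.Scheme.Modules

/-! ### Differential forms over a local ring -/

namespace KaehlerDifferential

variable (k : Type u) [Field k] {A : Type u} [CommRing A] (K : Type u) [Field K]
  [Algebra A K] [Algebra k K]

variable (A) in
/-- The submodule of `Ω¹_{K/k}` generated over `A` by the differentials `da` of elements of `A`. If
`A` is the local ring of a smooth variety over `k` at a point `x` and `K` is the function field,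
then this is the stalk at `x` of the cotangent sheaf, as a lattice in the space of rational
one-forms. -/
def regularForms : Submodule A Ω[K⁄k] :=
  Submodule.span A (Set.range fun a : A => KaehlerDifferential.D k K (algebraMap A K a))

variable {K} in
/-- The wedge product of two one-forms, in the exterior algebra of `Ω¹_{K/k}`. -/
def wedge (α β : Ω[K⁄k]) : ExteriorAlgebra K Ω[K⁄k] :=
  ExteriorAlgebra.ι K α * ExteriorAlgebra.ι K β

variable (A) in
/-- The regular two-forms: the `A`-submodule of the exterior algebra of `Ω¹_{K/k}` generated by the
wedge products of regular one-forms. -/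
def regularTwoForms : Submodule A (ExteriorAlgebra K Ω[K⁄k]) :=
  Submodule.span A {τ | ∃ α ∈ regularForms k A K, ∃ β ∈ regularForms k A K, τ = wedge k α β}

/-- The one-forms with logarithmic poles along the reduced divisor with ideal `I ⊆ A`: the forms `ω`
such that `g ω` and `dg ∧ ω` are regular for all `g ∈ I`. As `d(g ω) = dg ∧ ω + g dω`, this says
that `ω` and `dω` have at most simple poles along the divisor. For a normal crossing divisor
`(z₁ ⋯ z_l)` in local coordinates `z₁, …, zₙ` these are the forms generated by
`dz₁/z₁, …, dz_l/z_l, dz_{l+1}, …, dzₙ`. -/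
def logForms (I : Ideal A) : Submodule A Ω[K⁄k] where
  carrier := {ω | ∀ g ∈ I, g • ω ∈ regularForms k A K ∧
    wedge k (KaehlerDifferential.D k K (algebraMap A K g)) ω ∈ regularTwoForms k A K}
  add_mem' := by
    intro ω η hω hη g hg
    refine ⟨?_, ?_⟩
    · rw [smul_add]; exact add_mem (hω g hg).1 (hη g hg).1
    · rw [wedge, map_add, mul_add]; exact add_mem (hω g hg).2 (hη g hg).2
  zero_mem' := by
    intro g hg
    refine ⟨?_, ?_⟩
    · rw [smul_zero]; exact zero_mem _
    · rw [wedge, map_zero, mul_zero]; exact zero_mem _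
  smul_mem' := by
    intro a ω hω g hg
    refine ⟨?_, ?_⟩
    · rw [smul_comm]; exact Submodule.smul_mem _ _ (hω g hg).1
    · rw [← algebraMap_smul K a ω, wedge, map_smul, mul_smul_comm, algebraMap_smul K a]
      exact Submodule.smul_mem _ _ (hω g hg).2

end KaehlerDifferential

namespace AlgebraicGeometry.Scheme

/-! ### Sheaves of lattices in a vector space over the function field -/

section Lattice

/-- A family of `𝒪_{X,x}`-submodules `L x`, one for every point `x ∈ X`, of a vector space `V` over
the function field of an integral scheme `X`. -/
structure LatticeFamily (X : Scheme.{u}) [IsIntegral X] (V : Type u) [AddCommGroup V]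
    [Module X.functionField V] where
  /-- the submodule at `x` -/
  lattice (x : X) : AddSubgroup V
  smul_mem (x : X) (a : X.presheaf.stalk x) {v : V} (hv : v ∈ lattice x) :
    algebraMap (X.presheaf.stalk x) X.functionField a • v ∈ lattice x

variable {X : Scheme.{u}} [IsIntegral X]

/-- The rational function defined by a section `f` of the structure sheaf near `x`. -/
def toRational {U : X.Opens} (x : U) (f : Γ(X, U)) : X.functionField :=
  algebraMap (X.presheaf.stalk x.1) X.functionField ((X.presheaf.germ U x.1 x.2).hom f)

theorem toRational_eq {U : X.Opens} (x y : U) (f : Γ(X, U)) : toRational x f = toRational y f := by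
  have h : ∀ z : U, toRational z f = (X.presheaf.germ U (genericPoint X)
      (((genericPoint_spec X).specializes trivial).mem_open U.2 z.2)).hom f := by
    intro z
    change (X.presheaf.germ U z z.2 ≫ X.presheaf.stalkSpecializes _).hom f = _
    rw [TopCat.Presheaf.germ_stalkSpecializes]
  rw [h x, h y]

theorem toRational_map {U W : X.Opens} (i : W ⟶ U) (x : W) (f : Γ(X, U)) :
    toRational x ((X.presheaf.map i.op).hom f) = toRational (i x) f := by
  change algebraMap (X.presheaf.stalk x.1) X.functionField
    ((X.presheaf.map i.op ≫ X.presheaf.germ W x x.2).hom f) = _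
  rw [TopCat.Presheaf.germ_res]
  rfl

variable {V : Type u} [AddCommGroup V] [Module X.functionField V] (L : LatticeFamily X V)

/-- The condition for a function `s : U → V` to be a section of the sheaf of lattices `L`: it is
constant, and its value lies in `L x` for all `x ∈ U`. So for `U` nonempty the sections over `U` are
the elements of `⋂ x ∈ U, L x`, and there is just one section over `∅`. -/
def latticePredicate : TopCat.LocalPredicate (X := TopCat.of X) (fun _ : X => V) where
  pred {U} s := (∀ x y : U, s x = s y) ∧ ∀ x : U, s x ∈ L.lattice x
  res i s h := ⟨fun x y => h.1 (i x) (i y), fun x => h.2 (i x)⟩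
  locality {U} s h := by
    refine ⟨fun x y => ?_, fun x => ?_⟩
    · obtain ⟨A, hxA, i, hA, -⟩ := h x
      obtain ⟨B, hyB, j, hB, -⟩ := h y
      obtain ⟨z, hzA, hzB⟩ :=
        nonempty_preirreducible_inter (X := X) A.isOpen B.isOpen ⟨x, hxA⟩ ⟨y, hyB⟩
      exact (hA ⟨x, hxA⟩ ⟨z, hzA⟩).trans (hB ⟨z, hzB⟩ ⟨y, hyB⟩)
    · obtain ⟨A, hxA, i, -, hA⟩ := h x
      exact hA ⟨x, hxA⟩

/-- The sections over `U` of the sheaf of lattices `L`. -/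
def latticeSections (U : X.Opensᵒᵖ) : AddSubgroup (U.unop → V) where
  carrier := {s | (latticePredicate L).pred s}
  add_mem' hs ht :=
    ⟨fun x y => congrArg₂ (· + ·) (hs.1 x y) (ht.1 x y), fun x => add_mem (hs.2 x) (ht.2 x)⟩
  zero_mem' := ⟨fun _ _ => rfl, fun x => zero_mem (L.lattice x)⟩
  neg_mem' hs := ⟨fun x y => congrArg (- ·) (hs.1 x y), fun x => neg_mem (hs.2 x)⟩

/-- The action of `f ∈ 𝒪(U)` on sections over `U` of a sheaf of lattices: multiplication with the
rational function defined by `f`. -/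
instance latticeModule (U : X.Opensᵒᵖ) : Module (X.presheaf.obj U) (latticeSections L U) where
  smul f s := ⟨fun x => toRational x f • s.1 x,
    fun x y => congrArg₂ (· • ·) (toRational_eq x y f) (s.2.1 x y),
    fun x => L.smul_mem x.1 _ (s.2.2 x)⟩
  one_smul s := Subtype.ext (funext fun x => by
    change toRational x 1 • s.1 x = s.1 x
    rw [toRational, map_one, map_one, one_smul])
  mul_smul f g s := Subtype.ext (funext fun x => by
    change toRational x (f * g) • s.1 x = toRational x f • toRational x g • s.1 x
    rw [toRational, map_mul, map_mul, mul_smul]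
    rfl)
  smul_zero f := Subtype.ext (funext fun x => smul_zero _)
  smul_add f s t := Subtype.ext (funext fun x => smul_add _ _ _)
  add_smul f g s := Subtype.ext (funext fun x => by
    change toRational x (f + g) • s.1 x = toRational x f • s.1 x + toRational x g • s.1 x
    rw [toRational, map_add, map_add, add_smul]
    rfl)
  zero_smul s := Subtype.ext (funext fun x => by
    change toRational x 0 • s.1 x = 0
    rw [toRational, map_zero, map_zero, zero_smul])

/-- The presheaf of abelian groups underlying a sheaf of lattices. -/
def latticePresheaf : TopCat.Presheaf AddCommGrpCat.{u} X where
  obj U := AddCommGrpCat.of (latticeSections L U)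
  map {U W} i := AddCommGrpCat.ofHom
    { toFun := fun s => ⟨fun x => s.1 (i.unop x), (latticePredicate L).res i.unop s.1 s.2⟩
      map_zero' := rfl
      map_add' := fun _ _ => rfl }

instance latticePresheafModule (U : X.Opensᵒᵖ) :
    Module (X.ringCatSheaf.obj.obj U) ((latticePresheaf L).obj U) :=
  latticeModule L U

/-- The sheaf of `𝒪_X`-modules defined by a family of lattices `L x ⊆ V`, `x ∈ X`: its sections over
a nonempty open subset `U` are the elements of `⋂ x ∈ U, L x`. -/
def latticeSheaf : X.Modules where
  val := PresheafOfModules.ofPresheaf (R := X.ringCatSheaf.obj) (latticePresheaf L)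
    (fun _ _ i f s => Subtype.ext (funext fun x =>
      congrArg (· • s.1 (i.unop x)) (toRational_map i.unop x f).symm))
  isSheaf := (TopCat.Presheaf.isSheaf_iff_isSheaf_comp (CategoryTheory.forget AddCommGrpCat) _).2
    (TopCat.subsheafToTypes (latticePredicate L)).2

end Lattice

/-! ### Effective divisors with normal crossings -/

section Divisor

/-- The prime divisors of `X`, given by their generic points: the points of codimension one. -/
abbrev PrimeDivisor (X : Scheme.{u}) : Type u :=
  {P : X // ringKrullDim (X.presheaf.stalk P) = 1}

/-- Effective (Weil) divisors: formal sums of prime divisors with coefficients in `ℕ`. -/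
abbrev EffectiveDivisor (X : Scheme.{u}) : Type u := PrimeDivisor X →₀ ℕ

variable {X : Scheme.{u}} (D : EffectiveDivisor X)

/-- The open subset `X - D`, the complement of the union of the components of `D`. -/
def EffectiveDivisor.compl : X.Opens where
  carrier := (⋃ P ∈ D.support, closure {P.1})ᶜ
  is_open' := (D.support.finite_toSet.isClosed_biUnion fun _ _ => isClosed_closure).isOpen_compl

/-- The ideal of `𝒪_{X,x}` consisting of the germs that vanish on all components of `D` through `x`,
that is, the ideal of the reduced divisor `D_red` at `x`. -/
def EffectiveDivisor.reducedIdeal (x : X) : Ideal (X.presheaf.stalk x) :=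
  ⨅ P ∈ D.support, ⨅ h : P.1 ⤳ x,
    (IsLocalRing.maximalIdeal (X.presheaf.stalk P.1)).comap (X.presheaf.stalkSpecializes h).hom

/-- `D` is a (not necessarily reduced) normal crossing divisor on the nonsingular variety `X`: every
point `x` of `X` has an étale neighbourhood `φ : (W, w) ⟶ (X, x)` with a regular system of
parameters `z₁, …, zₙ` of `𝒪_{W,w}` such that `D_red` is defined by the product of some of the `zᵢ`
in `𝒪_{W,w}`. -/
def EffectiveDivisor.IsNormalCrossing : Prop :=
  ∀ x : X, ∃ (W : Scheme.{u}) (φ : W ⟶ X) (_ : Etale φ) (w : W) (_ : φ w = x)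
    (n : ℕ) (z : Fin n → W.presheaf.stalk w) (s : Finset (Fin n)),
    ringKrullDim (W.presheaf.stalk w) = n ∧
    Ideal.span (Set.range z) = IsLocalRing.maximalIdeal (W.presheaf.stalk w) ∧
    (D.reducedIdeal (φ w)).map (φ.stalkMap w).hom = Ideal.span {∏ i ∈ s, z i}

end Divisor

/-! ### Differential forms with logarithmic poles -/

section LogForms

variable (k : Type u) [Field k] {X : Scheme.{u}} [X.Over (Spec (.of k))] [IsIntegral X]

/-- The function field of an integral scheme over `k`, as a `k`-algebra. -/
instance functionFieldAlgebra : Algebra k X.functionField :=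
  ((X.presheaf.germ ⊤ (genericPoint X) trivial).hom.comp
    ((X ↘ Spec (.of k)).appTop.hom.comp (ΓSpecIso (.of k)).inv.hom)).toAlgebra

/-- The sheaf `Ω¹_X(log D)` of one-forms with logarithmic poles along `D`, for an effective divisor
`D` on a smooth variety `X`: its sections over a nonempty open subset `U` are the rational one-forms
on `X` that have logarithmic poles along `D` at all points of `U`. -/
def logCotangentSheaf (D : EffectiveDivisor X) : X.Modules :=
  latticeSheaf (V := Ω[X.functionField⁄k])
    { lattice := fun x => (KaehlerDifferential.logForms k X.functionField
        (D.reducedIdeal x)).toAddSubgroup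
      smul_mem := fun x a v hv => by
        rw [algebraMap_smul]
        exact Submodule.smul_mem _ a hv }

end LogForms

end AlgebraicGeometry.Scheme

end

/-! Every component of D₂ is a component of D, so Ω¹(log D₂) ⊆ Ω¹(log D), with equality on X − D.
Pulling this inclusion back along γ : C → X gives a morphism E → E' of quasi-coherent sheaves that
is surjective over γ⁻¹(X − D), a nonempty open subset of the curve C. It therefore suffices that
ampleness passes from E to E' along such a generically surjective morphism. This is
`isAmple_of_hom`; it is applied in `isQuasiAmpleWrt_logCotangentSheaf`.

Choose a rational function f on C with poles at the finitely many points outside γ⁻¹(X − D), and let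
U and V be the open subsets where f and g = 1/f are regular. They cover C, since the local rings are
valuation rings; U lies in γ⁻¹(X − D), and its complement is the zero set of g. The morphism f : U →
𝔸¹ is proper and quasi-finite, hence finite, and likewise for g, so U and V are affine
(`finite_toAffineLine`, `exists_affine_cover`). Finiteness also gives an n with 𝒪(U ∩ V) = 𝒪(U) + fⁿ
𝒪(V), that is, H¹(C, 𝒪(nZ)) = 0 for the divisor Z of zeros of g on V
(`exists_add_pow_mul_of_finite_aeval`).

Let F be coherent, and let N ⊆ F be the subsheaf that is F on U and gⁿ⁺¹F on V. It is coherent, so B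
= N ⊗ Symᵐ E is globally generated for m ≥ m₀. The morphism Φ from B to A = F ⊗ Symᵐ E' is
surjective over U, and over V its image is divisible by gⁿ⁺¹. Hence A is generated by global
sections over U. For the remaining points, take t ∈ A(V), lift its restriction to U ∩ V to B, write
the lift in terms of global sections of B and split the coefficients: the lift is p + fⁿq with p ∈
B(U), q ∈ B(V). As Φ(q) = gⁿ⁺¹r, one gets t = Φ(p) + g r on U ∩ V, so Φ(p) and t − g r glue to a
global section of A. Global sections thus generate A(V) modulo g, and Nakayama's lemma finishes the
proof (`exists_global_section`, `isGloballyGenerated_of_hom`).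

All sheaf theory is done on sections over affine open subsets. The condition `QC` says that these
localize correctly; it is stable under tensor products and symmetric powers of presheaves, and
sheafifying a presheaf with `QC` does not change its sections over affine open subsets. Logarithmic
forms satisfy it because their defining conditions commute with localization. -/

noncomputable section

namespace AlgebraicGeometry.Scheme

/-! ### Sections of presheaves of modules -/

variable {X : Scheme.{u}}

/-- Presheaves of modules over the structure sheaf, viewed as a presheaf of commutative rings. -/
abbrev PMod (X : Scheme.{u}) : Type _ :=
  _root_.PresheafOfModules.{u} (X.presheaf ⋙ forget₂ CommRingCat RingCat)

/-- Restriction of functions. -/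
def rres {U V : X.Opens} (h : V ≤ U) : Γ(X, U) →+* Γ(X, V) :=
  (X.presheaf.map (homOfLE h).op).hom

@[simp]
theorem rres_rres {U V W : X.Opens} (h : V ≤ U) (h' : W ≤ V) (r : Γ(X, U)) :
    rres h' (rres h r) = rres (h'.trans h) r := by
  simp only [rres, ← CommRingCat.comp_apply, ← Functor.map_comp]
  rfl

@[simp]
theorem rres_self {U : X.Opens} (h : U ≤ U) (r : Γ(X, U)) : rres h r = r := by
  change (X.presheaf.map (𝟙 (op U))).hom r = r
  rw [X.presheaf.map_id]; rfl

/-- The sections of a presheaf of modules over `U`. -/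
def sec (P : PMod X) (U : X.Opens) : Type u := P.obj (op U)

instance (P : PMod X) (U : X.Opens) : AddCommGroup (sec P U) :=
  inferInstanceAs (AddCommGroup (P.obj (op U)))

instance (P : PMod X) (U : X.Opens) : Module Γ(X, U) (sec P U) :=
  (P.obj (op U)).isModule

/-- Restriction of sections of a presheaf of modules. -/
def res (P : PMod X) {U V : X.Opens} (h : V ≤ U) : sec P U →+ sec P V where
  toFun s := P.map (homOfLE h).op s
  map_zero' := map_zero (P.map (homOfLE h).op).hom
  map_add' := map_add (P.map (homOfLE h).op).hom

variable (P : PMod X)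

@[simp]
theorem res_smul {U V : X.Opens} (h : V ≤ U) (r : Γ(X, U)) (s : sec P U) :
    res P h (r • s) = rres h r • res P h s :=
  P.map_smul (homOfLE h).op r s

@[simp]
theorem res_res {U V W : X.Opens} (h : V ≤ U) (h' : W ≤ V) (s : sec P U) :
    res P h' (res P h s) = res P (h'.trans h) s :=
  (P.map_comp_apply (homOfLE h).op (homOfLE h').op s).symm

@[simp]
theorem res_self {U : X.Opens} (h : U ≤ U) (s : sec P U) : res P h s = s := by
  change P.map (𝟙 (op U)) s = s
  simp
  rfl

variable {P} {Q R : PMod X}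

/-- A morphism of presheaves of modules on sections. -/
def secMap (φ : P ⟶ Q) (U : X.Opens) : sec P U →ₗ[Γ(X, U)] sec Q U :=
  (φ.app (op U)).hom

@[simp]
theorem res_secMap (φ : P ⟶ Q) {U V : X.Opens} (h : V ≤ U) (s : sec P U) :
    res Q h (secMap φ U s) = secMap φ V (res P h s) :=
  (PresheafOfModules.naturality_apply φ (homOfLE h).op s).symm

@[simp]
theorem secMap_comp (φ : P ⟶ Q) (ψ : Q ⟶ R) (U : X.Opens) (s : sec P U) :
    secMap (φ ≫ ψ) U s = secMap ψ U (secMap φ U s) := rfl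

theorem secMap_ext {φ ψ : P ⟶ Q} (h : ∀ U s, secMap φ U s = secMap ψ U s) : φ = ψ :=
  PresheafOfModules.hom_ext fun U => ModuleCat.hom_ext (LinearMap.ext fun s => h U.unop s)

/-- The presheaf of modules underlying a sheaf of modules. -/
abbrev Modules.pval (M : X.Modules) : PMod X := M.val

/-- The morphism of presheaves of modules underlying a morphism of sheaves of modules. -/
abbrev Modules.pmap {M N : X.Modules} (φ : M ⟶ N) : M.pval ⟶ N.pval :=
  SheafOfModules.Hom.val φ

theorem Modules.pmap_comp {M N K : X.Modules} (φ : M ⟶ N) (ψ : N ⟶ K) :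
    Modules.pmap (φ ≫ ψ) = Modules.pmap φ ≫ Modules.pmap ψ := rfl

theorem Modules.hom_ext_sec {M N : X.Modules} {φ ψ : M ⟶ N}
    (h : ∀ U s, secMap (Modules.pmap φ) U s = secMap (Modules.pmap ψ) U s) : φ = ψ :=
  SheafOfModules.hom_ext (secMap_ext h)

theorem Modules.sec_ext (M : X.Modules) {U : X.Opens} {s t : sec M.pval U}
    (h : ∀ x ∈ U, ∃ (W : X.Opens) (hW : W ≤ U), x ∈ W ∧ res M.pval hW s = res M.pval hW t) :
    s = t := by
  choose W hW hx e using h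
  refine TopCat.Sheaf.eq_of_locally_eq' (X := X.toTopCat) ⟨M.presheaf, M.isSheaf⟩
    (fun x : U => W x.1 x.2) U
    (fun x => homOfLE (hW x.1 x.2)) (fun x hx' => ?_) s t (fun x => e x.1 x.2)
  exact Opens.mem_iSup.2 ⟨⟨x, hx'⟩, hx x hx'⟩

theorem Modules.sec_glue (M : X.Modules) {U : X.Opens} {ι : Type*} (W : ι → X.Opens)
    (hW : ∀ i, W i ≤ U) (cov : ∀ x ∈ U, ∃ i, x ∈ W i) (s : ∀ i, sec M.pval (W i))
    (h : ∀ i j, res M.pval (inf_le_left : W i ⊓ W j ≤ W i) (s i) =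
      res M.pval (inf_le_right : W i ⊓ W j ≤ W j) (s j)) :
    ∃ t : sec M.pval U, ∀ i, res M.pval (hW i) t = s i := by
  let F : TopCat.Sheaf AddCommGrpCat.{u} X.toTopCat := ⟨M.presheaf, M.isSheaf⟩
  let s' : ∀ i, F.obj.obj (op (W i)) := s
  have h' : TopCat.Presheaf.IsCompatible F.obj W s' := h
  obtain ⟨t, ht, -⟩ := F.existsUnique_gluing' W U
    (fun i => homOfLE (hW i)) (fun x hx => Opens.mem_iSup.2 (cov x hx)) s' h'
  exact ⟨t, ht⟩

theorem Modules.sec_glue_two (M : X.Modules) {A B : X.Opens} (hAB : A ⊔ B = ⊤)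
    (s : sec M.pval A) (t : sec M.pval B)
    (h : res M.pval (inf_le_left : A ⊓ B ≤ A) s = res M.pval (inf_le_right : A ⊓ B ≤ B) t) :
    ∃ r : sec M.pval ⊤, res M.pval le_top r = s ∧ res M.pval le_top r = t := by
  obtain ⟨r, hr⟩ := M.sec_glue (U := ⊤) (fun b : Bool => bif b then A else B)
    (fun _ => le_top) (fun x hx => by
      rw [← hAB] at hx
      rcases hx with hx | hx
      exacts [⟨true, hx⟩, ⟨false, hx⟩])
    (fun b => match b with
      | true => s
      | false => t) (by
      rintro (_ | _) (_ | _)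
      · rfl
      · have := congrArg (res M.pval (show B ⊓ A ≤ A ⊓ B from inf_comm _ _ |>.le)) h
        simpa using this.symm
      · exact h
      · rfl)
  exact ⟨r, hr true, hr false⟩

/-! ### Subsheaves of modules -/

/-- A family of submodules of the sections of a sheaf of modules that is compatible with restriction
and local. -/
structure Modules.LocalSubmodule (M : X.Modules) where
  /-- the submodule of sections over `U` -/
  obj (U : X.Opens) : Submodule Γ(X, U) (sec M.pval U)
  res_mem {U V : X.Opens} (h : V ≤ U) {s : sec M.pval U} (hs : s ∈ obj U) : res M.pval h s ∈ obj V
  mem_of_locally {U : X.Opens} (s : sec M.pval U)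
    (h : ∀ x ∈ U, ∃ (W : X.Opens) (hW : W ≤ U), x ∈ W ∧ res M.pval hW s ∈ obj W) : s ∈ obj U

namespace Modules.LocalSubmodule

variable {M : X.Modules} (N : M.LocalSubmodule)

/-- The presheaf of submodules underlying a local submodule. -/
def toSubmodule : PresheafOfModules.Submodule (R := X.presheaf ⋙ forget₂ CommRingCat RingCat)
    M.pval where
  obj U := N.obj U.unop
  map f _ hs := N.res_mem f.unop.le hs

/-- The subsheaf of modules defined by a local submodule. -/
def toModules : X.Modules where
  val := N.toSubmodule.toPresheafOfModules
  isSheaf := by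
    refine (TopCat.Presheaf.isSheaf_iff_isSheaf_comp (CategoryTheory.forget AddCommGrpCat) _).2
      ((TopCat.Presheaf.isSheaf_iff_isSheafUniqueGluing_types _).2 ?_)
    intro ι W s hs
    let s' : ∀ i, N.obj (W i) := s
    obtain ⟨t, ht⟩ := M.sec_glue W (U := iSup W) (fun i => le_iSup W i)
      (fun x hx => Opens.mem_iSup.1 hx) (fun i => (s' i).1) (fun i j => congrArg Subtype.val (hs i j))
    have hmem : t ∈ N.obj (iSup W) := N.mem_of_locally t fun x hx => by
      obtain ⟨i, hi⟩ := Opens.mem_iSup.1 hx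
      exact ⟨W i, le_iSup W i, hi, by rw [ht]; exact (s' i).2⟩
    refine ⟨(⟨t, hmem⟩ : N.obj (iSup W)), fun i => Subtype.ext (ht i), fun t' ht' => ?_⟩
    let t'' : N.obj (iSup W) := t'
    refine Subtype.ext (M.sec_ext (s := t''.1) fun x hx => ?_)
    obtain ⟨i, hi⟩ := Opens.mem_iSup.1 hx
    exact ⟨W i, le_iSup W i, hi, (congrArg Subtype.val (ht' i)).trans (ht i).symm⟩

/-- The inclusion of a subsheaf of modules. -/
def ι : N.toModules ⟶ M where
  val := N.toSubmodule.ι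

/-- The section of the subsheaf defined by a section that belongs to it. -/
def mkSec {U : X.Opens} (s : sec M.pval U) (hs : s ∈ N.obj U) : sec N.toModules.pval U :=
  (⟨s, hs⟩ : N.obj U)

@[simp]
theorem ι_mkSec {U : X.Opens} (s : sec M.pval U) (hs : s ∈ N.obj U) :
    secMap (Modules.pmap N.ι) U (N.mkSec s hs) = s := rfl

theorem ι_mem {U : X.Opens} (s : sec N.toModules.pval U) :
    secMap (Modules.pmap N.ι) U s ∈ N.obj U := (show N.obj U from s).2

theorem ι_injective {U : X.Opens} : Function.Injective (secMap (Modules.pmap N.ι) U) :=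
  fun _ _ h => Subtype.ext h

instance : Mono N.ι where
  right_cancellation _ _ h := Modules.hom_ext_sec fun U s => N.ι_injective
    (congrArg (fun ψ => secMap (Modules.pmap ψ) U s) h)

/-- Sheaves of modules form a balanced category, so the inclusion is invertible as soon as it is
epi. This is the passage from categorical generation to statements about individual sections. -/
theorem mem_of_epi_ι [Epi N.ι] {U : X.Opens} (s : sec M.pval U) : s ∈ N.obj U := by
  have : IsIso N.ι := isIso_of_mono_of_epi N.ι
  have h : secMap (Modules.pmap N.ι) U (secMap (Modules.pmap (inv N.ι)) U s) = s := by
    rw [← secMap_comp, ← Modules.pmap_comp, IsIso.inv_hom_id]; rfl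
  rw [← h]
  exact N.ι_mem _

end Modules.LocalSubmodule

end AlgebraicGeometry.Scheme

namespace AlgebraicGeometry.Scheme

variable {X Y : Scheme.{u}}

/-! ### Local generation -/

/-- A set of sections of `M` over every open subset, stable under restriction. -/
structure Modules.SectionSet (M : X.Modules) where
  /-- the set of sections over `U` -/
  obj (U : X.Opens) : Set (sec M.pval U)
  res_mem {U V : X.Opens} (h : V ≤ U) {s : sec M.pval U} (hs : s ∈ obj U) : res M.pval h s ∈ obj V

/-- The restriction of a linear combination of sections. -/
theorem res_mem_span {P : PMod X} {U V : X.Opens} (h : V ≤ U) {S : Set (sec P U)}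
    {T : Set (sec P V)} (hST : ∀ s ∈ S, res P h s ∈ Submodule.span Γ(X, V) T) {s : sec P U}
    (hs : s ∈ Submodule.span Γ(X, U) S) : res P h s ∈ Submodule.span Γ(X, V) T := by
  induction hs using Submodule.span_induction with
  | mem s hs => exact hST s hs
  | zero => rw [map_zero]; exact zero_mem _
  | add s t _ _ hs ht => rw [map_add]; exact add_mem hs ht
  | smul r s _ hs => rw [res_smul]; exact Submodule.smul_mem _ _ hs

/-- The sections that are locally linear combinations of sections in `S`. -/
def Modules.SectionSet.locSpan {M : X.Modules} (S : M.SectionSet) : M.LocalSubmodule where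
  obj U :=
    { carrier := {s | ∀ x ∈ U, ∃ (W : X.Opens) (hW : W ≤ U), x ∈ W ∧
        res M.pval hW s ∈ Submodule.span Γ(X, W) (S.obj W)}
      zero_mem' := fun x hx => ⟨U, le_rfl, hx, by rw [map_zero]; exact zero_mem _⟩
      add_mem' := by
        intro s t hs ht x hx
        obtain ⟨W, hW, hxW, h⟩ := hs x hx
        obtain ⟨W', hW', hxW', h'⟩ := ht x hx
        refine ⟨W ⊓ W', inf_le_left.trans hW, ⟨hxW, hxW'⟩, ?_⟩
        rw [map_add]
        refine add_mem ?_ ?_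
        · rw [← res_res M.pval hW inf_le_left]
          exact res_mem_span _ (fun s hs => Submodule.subset_span (S.res_mem _ hs)) h
        · rw [← res_res M.pval hW' inf_le_right]
          exact res_mem_span _ (fun s hs => Submodule.subset_span (S.res_mem _ hs)) h'
      smul_mem' := by
        intro r s hs x hx
        obtain ⟨W, hW, hxW, h⟩ := hs x hx
        exact ⟨W, hW, hxW, by rw [res_smul]; exact Submodule.smul_mem _ _ h⟩ }
  res_mem {U V} h s hs x hx := by
    obtain ⟨W, hW, hxW, h'⟩ := hs x (h hx)
    refine ⟨W ⊓ V, inf_le_right, ⟨hxW, hx⟩, ?_⟩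
    rw [res_res, ← res_res M.pval hW inf_le_left]
    exact res_mem_span _ (fun s hs => Submodule.subset_span (S.res_mem _ hs)) h'
  mem_of_locally {U} s h x hx := by
    obtain ⟨W, hW, hxW, h'⟩ := h x hx
    obtain ⟨W', hW', hxW', h''⟩ := h' x hxW
    exact ⟨W', hW'.trans hW, hxW', by rwa [res_res] at h''⟩

theorem Modules.SectionSet.subset_locSpan {M : X.Modules} (S : M.SectionSet) {U : X.Opens}
    {s : sec M.pval U} (hs : s ∈ S.obj U) : s ∈ S.locSpan.obj U := fun _ hx =>
  ⟨U, le_rfl, hx, Submodule.subset_span (S.res_mem _ hs)⟩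

/-- The hypothesis says precisely that the inclusion of N is an epimorphism. Universal properties
(of free sheaves, of pullbacks) can thus be used to show that certain sections generate. -/
theorem Modules.LocalSubmodule.mem_of_hom_ext {M : X.Modules} (N : M.LocalSubmodule)
    (h : ∀ (K : X.Modules) (a b : M ⟶ K), (∀ U, ∀ s ∈ N.obj U,
      secMap (Modules.pmap a) U s = secMap (Modules.pmap b) U s) → a = b)
    {U : X.Opens} (s : sec M.pval U) : s ∈ N.obj U := by
  have : Epi N.ι := ⟨fun {K} a b hab => h K a b fun U s hs =>
    congrArg (fun φ => secMap (Modules.pmap φ) U (N.mkSec s hs)) hab⟩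
  exact N.mem_of_epi_ι s

theorem Modules.SectionSet.eqOn_locSpan {M K : X.Modules} (S : M.SectionSet) {a b : M ⟶ K}
    (h : ∀ U, ∀ s ∈ S.obj U, secMap (Modules.pmap a) U s = secMap (Modules.pmap b) U s)
    {U : X.Opens} {s : sec M.pval U} (hs : s ∈ S.locSpan.obj U) :
    secMap (Modules.pmap a) U s = secMap (Modules.pmap b) U s := by
  refine K.sec_ext fun x hx => ?_
  obtain ⟨W, hW, hxW, h'⟩ := hs x hx
  refine ⟨W, hW, hxW, ?_⟩
  rw [res_secMap, res_secMap]
  exact LinearMap.eqOn_span (h W) h'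

/-- The restrictions of global sections in `T`. -/
def Modules.globalSections (M : X.Modules) (T : Set (sec M.pval ⊤)) : M.SectionSet where
  obj U := res M.pval (le_top : U ≤ ⊤) '' T
  res_mem h s hs := by
    obtain ⟨t, ht, rfl⟩ := hs
    exact ⟨t, ht, (res_res M.pval _ _ _).symm⟩

/-- The global section of a sheaf of modules as a compatible family of sections. -/
def Modules.sectionsOf (M : X.Modules) (t : sec M.pval ⊤) : SheafOfModules.sections M :=
  PresheafOfModules.sectionsMk (M := M.pval) (fun U => res M.pval (le_top : U.unop ≤ ⊤) t)
    (fun _ _ f => res_res M.pval le_top f.unop.le t)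

theorem Modules.sections_val (M : X.Modules) (σ : SheafOfModules.sections M) (U : X.Opens) :
    σ.val (op U) = res M.pval (le_top : U ≤ ⊤) (σ.val (op ⊤)) :=
  (PresheafOfModules.sections_property (M := M.pval) σ (homOfLE le_top).op).symm

theorem Modules.freeHomEquiv_symm_comp_apply {M K : SheafOfModules.{u} X.ringCatSheaf} {I : Type u}
    (s : I → M.sections) (a : M ⟶ K) (i : I) :
    K.freeHomEquiv (M.freeHomEquiv.symm s ≫ a) i = SheafOfModules.sectionsMap a (s i) := by
  rw [SheafOfModules.freeHomEquiv_comp_apply, Equiv.apply_symm_apply]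

/-- A morphism out of a free sheaf is determined by the images of the basis, so morphisms out of M
that agree on global sections agree after composition with the epimorphism from the free sheaf. With
the converse `isGloballyGenerated_of_locSpan` this makes global generation a condition on sections.
-/
theorem Modules.mem_locSpan_of_isGloballyGenerated {M : X.Modules} (h : M.IsGloballyGenerated)
    {U : X.Opens} (s : sec M.pval U) : s ∈ (M.globalSections Set.univ).locSpan.obj U := by
  obtain ⟨σ⟩ := h
  refine (M.globalSections Set.univ).locSpan.mem_of_hom_ext (fun K a b hab => ?_) s
  have : Epi σ.π := σ.epi
  refine (cancel_epi (C := SheafOfModules X.ringCatSheaf) σ.π).1 ?_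
  apply (SheafOfModules.freeHomEquiv K).injective
  ext i : 1
  refine (Modules.freeHomEquiv_symm_comp_apply σ.s a i).trans
    (Eq.trans ?_ (Modules.freeHomEquiv_symm_comp_apply σ.s b i).symm)
  apply PresheafOfModules.sections_ext
  intro V
  refine hab V.unop ((σ.s i).val V) (Modules.SectionSet.subset_locSpan _ ?_)
  exact ⟨_, Set.mem_univ _, (M.sections_val (σ.s i) V.unop).symm⟩

theorem Modules.isGloballyGenerated_of_locSpan {M : X.Modules}
    (h : ∀ (U : X.Opens) (s : sec M.pval U), s ∈ (M.globalSections Set.univ).locSpan.obj U) :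
    M.IsGloballyGenerated := by
  refine ⟨⟨sec M.pval ⊤, M.sectionsOf, ⟨fun {K} a b hab => ?_⟩⟩⟩
  refine Modules.hom_ext_sec fun U s => (M.globalSections Set.univ).eqOn_locSpan ?_ (h U s)
  rintro U _ ⟨t, -, rfl⟩
  have := (Modules.freeHomEquiv_symm_comp_apply M.sectionsOf a t).symm.trans
    ((congrFun (congrArg (SheafOfModules.freeHomEquiv K) hab) t).trans
      (Modules.freeHomEquiv_symm_comp_apply M.sectionsOf b t))
  exact congrArg (fun σ : SheafOfModules.sections K => σ.val (op U)) this

/-! ### Sections of pullbacks -/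

/-- The pullback of a section. -/
def pullSec (γ : Y ⟶ X) (M : X.Modules) (W : X.Opens) (m : sec M.pval W) :
    sec ((Modules.pullback γ).obj M).pval (γ ⁻¹ᵁ W) :=
  secMap (Modules.pmap ((Modules.pullbackPushforwardAdjunction γ).unit.app M)) W m

theorem res_pullSec (γ : Y ⟶ X) (M : X.Modules) {W W' : X.Opens} (h : W' ≤ W)
    (m : sec M.pval W) :
    res ((Modules.pullback γ).obj M).pval (show γ ⁻¹ᵁ W' ≤ γ ⁻¹ᵁ W from fun _ hx => h hx)
      (pullSec γ M W m) = pullSec γ M W' (res M.pval h m) :=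
  res_secMap (Modules.pmap ((Modules.pullbackPushforwardAdjunction γ).unit.app M)) h m

theorem pullSec_map (γ : Y ⟶ X) {M N : X.Modules} (φ : M ⟶ N) (W : X.Opens) (m : sec M.pval W) :
    secMap (Modules.pmap ((Modules.pullback γ).map φ)) (γ ⁻¹ᵁ W) (pullSec γ M W m) =
      pullSec γ N W (secMap (Modules.pmap φ) W m) := by
  have := (Modules.pullbackPushforwardAdjunction γ).unit.naturality φ
  exact (congrArg (fun ψ => secMap (Modules.pmap ψ) W m) this).symm

/-- The pullbacks of sections over open subsets in `B`. -/
def pullSections (γ : Y ⟶ X) (M : X.Modules) (B : Set X.Opens) :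
    ((Modules.pullback γ).obj M).SectionSet where
  obj U := {t | ∃ W ∈ B, ∃ (h : U ≤ γ ⁻¹ᵁ W) (m : sec M.pval W),
    t = res ((Modules.pullback γ).obj M).pval h (pullSec γ M W m)}
  res_mem h s hs := by
    obtain ⟨W, hW, h', m, rfl⟩ := hs
    exact ⟨W, hW, h.trans h', m, res_res _ _ _ _⟩

/-- The pullback of a sheaf of modules is locally generated by pullbacks of sections. -/
theorem mem_locSpan_pullSections (γ : Y ⟶ X) (M : X.Modules) {B : Set X.Opens}
    (hB : Opens.IsBasis B) {U : Y.Opens} (s : sec ((Modules.pullback γ).obj M).pval U) :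
    s ∈ (pullSections γ M B).locSpan.obj U := by
  refine (pullSections γ M B).locSpan.mem_of_hom_ext (fun K a b hab => ?_) s
  -- By adjunction, a morphism out of the pullback is determined by its values on pulled back
  -- sections; each of these is locally the pullback of a section over a member of B.
  apply ((Modules.pullbackPushforwardAdjunction γ).homEquiv M K).injective
  refine Modules.hom_ext_sec fun W m => ?_
  rw [Adjunction.homEquiv_unit, Adjunction.homEquiv_unit, Modules.pmap_comp, Modules.pmap_comp,
    secMap_comp, secMap_comp]
  refine hab (γ ⁻¹ᵁ W) (pullSec γ M W m) ?_
  intro y hy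
  obtain ⟨W', hW', hyW', h⟩ := Opens.isBasis_iff_nbhd.1 hB (show γ y ∈ W from hy)
  refine ⟨γ ⁻¹ᵁ W', fun _ hx => h hx, hyW', Submodule.subset_span ⟨W', hW', le_rfl,
    res M.pval h m, ?_⟩⟩
  rw [res_self]
  exact res_pullSec γ M h m

/-! ### Sheafification -/

/-- The sheaf associated with a presheaf of modules. -/
def shf (P : PMod X) : X.Modules :=
  (PresheafOfModules.sheafification (𝟙 X.ringCatSheaf.obj)).obj P

/-- The section of the associated sheaf defined by a section of a presheaf. -/
def toShf (P : PMod X) (U : X.Opens) : sec P U →ₗ[Γ(X, U)] sec (shf P).pval U :=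
  (((PresheafOfModules.sheafificationAdjunction (𝟙 X.ringCatSheaf.obj)).unit.app P).app (op U)).hom

@[simp]
theorem res_toShf (P : PMod X) {U V : X.Opens} (h : V ≤ U) (s : sec P U) :
    res (shf P).pval h (toShf P U s) = toShf P V (res P h s) :=
  (PresheafOfModules.naturality_apply
    ((PresheafOfModules.sheafificationAdjunction (𝟙 X.ringCatSheaf.obj)).unit.app P)
    (homOfLE h).op s).symm

theorem toShf_locally_surjective (P : PMod X) {U : X.Opens} (s : sec (shf P).pval U) {x : X}
    (hx : x ∈ U) : ∃ (W : X.Opens) (hW : W ≤ U) (t : sec P W), x ∈ W ∧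
      toShf P W t = res (shf P).pval hW s := by
  have := Presheaf.imageSieve_mem (Opens.grothendieckTopology X)
    (CategoryTheory.toSheafify (Opens.grothendieckTopology X) P.presheaf) (U := op U) s
  obtain ⟨W, i, ⟨t, ht⟩, hxW⟩ := this x hx
  exact ⟨W, i.le, t, hxW, ht⟩

theorem toShf_locally_injective (P : PMod X) {U : X.Opens} {s : sec P U} (hs : toShf P U s = 0)
    {x : X} (hx : x ∈ U) : ∃ (W : X.Opens) (hW : W ≤ U), x ∈ W ∧ res P hW s = 0 := by
  have := Presheaf.equalizerSieve_mem (Opens.grothendieckTopology X)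
    (CategoryTheory.toSheafify (Opens.grothendieckTopology X) P.presheaf) (X := op U) s 0
    (hs.trans (map_zero (toShf P U)).symm)
  obtain ⟨W, i, h, hxW⟩ := this x hx
  exact ⟨W, i.le, hxW, h.trans (map_zero (res P i.le))⟩

/-- The morphism of associated sheaves. -/
def shfMap {P Q : PMod X} (φ : P ⟶ Q) : shf P ⟶ shf Q :=
  (PresheafOfModules.sheafification (𝟙 X.ringCatSheaf.obj)).map φ

@[simp]
theorem shfMap_toShf {P Q : PMod X} (φ : P ⟶ Q) (U : X.Opens) (s : sec P U) :
    secMap (Modules.pmap (shfMap φ)) U (toShf P U s) = toShf Q U (secMap φ U s) := by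
  have := (PresheafOfModules.sheafificationAdjunction (𝟙 X.ringCatSheaf.obj)).unit.naturality φ
  exact (congrArg (fun ψ => (PresheafOfModules.Hom.app ψ (op U)).hom s) this).symm

end AlgebraicGeometry.Scheme

/-! ### Localization of tensor products and symmetric powers -/

section LocalizationAlgebra

open TensorProduct

variable {A B : Type u} [CommRing A] [CommRing B] [Algebra A B] (f : A) [IsLocalization.Away f B]
  {M M' N N' : Type u} [AddCommGroup M] [AddCommGroup M'] [AddCommGroup N] [AddCommGroup N']
  [Module A M] [Module A M'] [Module A N] [Module A N'] [Module B M'] [Module B N']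
  [IsScalarTower A B M'] [IsScalarTower A B N']
  (α : M →ₗ[A] M') (β : N →ₗ[A] N')
  [IsLocalizedModule (.powers f) α] [IsLocalizedModule (.powers f) β]

/-- Since B is a localization of A, M' ⊗ N' is the same over A as over B, and α ⊗ β is again a
localization at the powers of f. Its kernel is therefore f-power torsion. -/
theorem TensorProduct.exists_pow_smul_eq_zero_of_away
    (θ : M ⊗[A] N →+ M' ⊗[B] N') (hθ : ∀ m n, θ (m ⊗ₜ n) = α m ⊗ₜ β n)
    {x : M ⊗[A] N} (hx : θ x = 0) : ∃ n : ℕ, f ^ n • x = 0 := by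
  have key : ∀ y, TensorProduct.map α β y =
      IsLocalization.moduleTensorEquiv (.powers f) B M' N' (θ y) := by
    intro y
    induction y using TensorProduct.induction_on with
    | zero => simp
    | tmul m n => rw [TensorProduct.map_tmul, hθ]; rfl
    | add y z hy hz => rw [map_add, map_add, map_add, hy, hz]
  have h0 : TensorProduct.map α β x = 0 := by rw [key, hx, map_zero]
  obtain ⟨⟨_, n, rfl⟩, hn⟩ := (IsLocalizedModule.eq_zero_iff (.powers f) _).1 h0
  exact ⟨n, hn⟩

/-- The linear map out of a symmetric power defined by a symmetric multilinear map. -/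
def SymmetricPower.liftSymm {L : Type u} [AddCommGroup L] [Module B L] (ι : Type u)
    (g : MultilinearMap B (fun _ : ι => M') L)
    (hg : ∀ (e : Equiv.Perm ι) (m : ι → M'), g (fun i => m (e i)) = g m) :
    SymmetricPower B ι M' →ₗ[B] L :=
  { AddCon.lift (addConGen (SymmetricPower.Rel B ι M')) (PiTensorProduct.lift g).toAddMonoidHom
      (by
        refine AddCon.addConGen_le.mpr ?_
        rintro _ _ ⟨e, m⟩
        refine (AddCon.ker_rel _).mpr ?_
        exact (PiTensorProduct.lift.tprod (φ := g) m).trans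
          ((hg e m).symm.trans (PiTensorProduct.lift.tprod (φ := g) _).symm)) with
    map_smul' := by
      intro r x
      induction x using AddCon.induction_on with
      | H x => exact map_smul (PiTensorProduct.lift g) r x }

theorem SymmetricPower.liftSymm_tprod {L : Type u} [AddCommGroup L] [Module B L] (ι : Type u)
    (g : MultilinearMap B (fun _ : ι => M') L)
    (hg : ∀ (e : Equiv.Perm ι) (m : ι → M'), g (fun i => m (e i)) = g m) (m : ι → M') :
    SymmetricPower.liftSymm ι g hg (SymmetricPower.tprod B m) = g m :=
  PiTensorProduct.lift.tprod (φ := g) m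

theorem SymmetricPower.tprod_smul_univ {ι : Type u} [Fintype ι] (c : ι → A) (m : ι → M) :
    SymmetricPower.tprod A (fun i => c i • m i) = (∏ i, c i) • SymmetricPower.tprod A m :=
  MultilinearMap.map_smul_univ _ c m

section

set_option linter.unusedSectionVars false

variable {ι : Type u} [Fintype ι]

/-- The value of the extension of `tprod` to the localization, in terms of representatives. -/
theorem SymmetricPower.away_wellDefined {y : ι → M'} {c d : ι → ℕ} {z w : ι → M}
    (hz : ∀ i, f ^ c i • y i = α (z i)) (hw : ∀ i, f ^ d i • y i = α (w i)) :
    (IsLocalization.Away.invSelf (S := B) f ^ ∑ i, c i) • ((1 : B) ⊗ₜ[A] SymmetricPower.tprod A z) =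
    (IsLocalization.Away.invSelf (S := B) f ^ ∑ i, d i) •
      ((1 : B) ⊗ₜ[A] SymmetricPower.tprod A w) := by
  have h : ∀ i, ∃ k : ℕ, f ^ (k + d i) • z i = f ^ (k + c i) • w i := by
    intro i
    have : α (f ^ d i • z i) = α (f ^ c i • w i) := by
      rw [map_smul, map_smul, ← hz, ← hw, smul_comm]
    obtain ⟨⟨_, k, rfl⟩, hk⟩ := (IsLocalizedModule.eq_iff_exists (.powers f) α).1 this
    refine ⟨k, ?_⟩
    rw [pow_add, pow_add, mul_smul, mul_smul]
    exact hk
  choose k hk using h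
  have e : (∏ i, f ^ (k i + d i)) • SymmetricPower.tprod A z =
      (∏ i, f ^ (k i + c i)) • SymmetricPower.tprod A w := by
    rw [← SymmetricPower.tprod_smul_univ, ← SymmetricPower.tprod_smul_univ]
    simp only [hk]
  have e' := congrArg (fun t => (1 : B) ⊗ₜ[A] t) e
  simp only [TensorProduct.tmul_smul] at e'
  simp only [Finset.prod_pow_eq_pow_sum, Finset.sum_add_distrib] at e'
  set g := IsLocalization.Away.invSelf (S := B) f
  have hg : ∀ n : ℕ, g ^ n * algebraMap A B f ^ n = 1 := by
    intro n
    rw [← mul_pow, mul_comm, IsLocalization.Away.mul_invSelf, one_pow]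
  have e'' := congrArg (fun t => g ^ (∑ i, k i + ∑ i, d i + ∑ i, c i) • t) e'
  simp only [← algebraMap_smul B (f ^ _), map_pow, smul_smul] at e''
  have h1 : g ^ (∑ i, k i + ∑ i, d i + ∑ i, c i) * algebraMap A B f ^ (∑ i, k i + ∑ i, d i) =
      g ^ ∑ i, c i := by
    rw [pow_add _ _ (∑ i, c i), mul_right_comm, hg, one_mul]
  have h2 : g ^ (∑ i, k i + ∑ i, d i + ∑ i, c i) * algebraMap A B f ^ (∑ i, k i + ∑ i, c i) =
      g ^ ∑ i, d i := by
    rw [add_right_comm, pow_add _ _ (∑ i, d i), mul_right_comm, hg, one_mul]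
  rw [h1, h2] at e''
  exact e''

/-- A B-linear map from Symᴮ M' to B ⊗ Symᴬ M is constructed whose composite with θ is x ↦ 1 ⊗ x. So
θ x = 0 forces 1 ⊗ x = 0, and x ↦ 1 ⊗ x is the localization at the powers of f. -/
theorem SymmetricPower.exists_pow_smul_eq_zero_of_away
    (θ : SymmetricPower A ι M →+ SymmetricPower B ι M')
    (hθ : ∀ m, θ (SymmetricPower.tprod A m) = SymmetricPower.tprod B (fun i => α (m i)))
    (hθ' : ∀ (r : A) x, θ (r • x) = algebraMap A B r • θ x)
    {x : SymmetricPower A ι M} (hx : θ x = 0) : ∃ n : ℕ, f ^ n • x = 0 := by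
  have hsurj : ∀ y : M', ∃ (n : ℕ) (z : M), f ^ n • y = α z := by
    intro y
    obtain ⟨⟨z, _, n, rfl⟩, h⟩ := IsLocalizedModule.surj (.powers f) α y
    exact ⟨n, z, h⟩
  choose c z hz using hsurj
  have hupd : ∀ (d : DecidableEq ι) (y : ι → M') (i : ι) (v : M') (n : ℕ) (w : M),
      f ^ n • v = α w → ∀ j, f ^ (Function.update (fun j => c (y j)) i n j) •
        Function.update y i v j = α (Function.update (fun j => z (y j)) i w j) := by
    intro d y i v n w h j
    by_cases hj : j = i
    · subst hj; simpa using h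
    · simp [hj, hz]
  set g := IsLocalization.Away.invSelf (S := B) f with hgdef
  have hg : ∀ n : ℕ, g ^ n * algebraMap A B f ^ n = 1 := by
    intro n
    rw [← mul_pow, mul_comm, IsLocalization.Away.mul_invSelf, one_pow]
  -- Each y i is written as a fraction z / f ^ c, and the product of the fractions is formed. By
  -- `hG` the value does not depend on the representatives, so multilinearity can be checked with
  -- convenient common denominators.
  let G : (ι → M') → B ⊗[A] SymmetricPower A ι M := fun y =>
    (g ^ ∑ i, c (y i)) • ((1 : B) ⊗ₜ[A] SymmetricPower.tprod A (fun i => z (y i)))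
  have hG : ∀ (y : ι → M') (d : ι → ℕ) (w : ι → M), (∀ i, f ^ d i • y i = α (w i)) →
      G y = (g ^ ∑ i, d i) • ((1 : B) ⊗ₜ[A] SymmetricPower.tprod A w) := fun y d w h =>
    SymmetricPower.away_wellDefined f α (fun i => hz (y i)) h
  let Gm : MultilinearMap B (fun _ : ι => M') (B ⊗[A] SymmetricPower A ι M) :=
    { toFun := G
      map_update_add' := by
        intro d y i u v
        have hu : f ^ (c u + c v) • u = α (f ^ c v • z u) := by
          rw [map_smul, ← hz, smul_smul, ← pow_add, add_comm]
        have hv : f ^ (c u + c v) • v = α (f ^ c u • z v) := by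
          rw [map_smul, ← hz, smul_smul, ← pow_add]
        have huv : f ^ (c u + c v) • (u + v) = α (f ^ c v • z u + f ^ c u • z v) := by
          rw [smul_add, hu, hv, map_add]
        rw [hG _ _ _ (hupd d y i _ _ _ hu), hG _ _ _ (hupd d y i _ _ _ hv),
          hG _ _ _ (hupd d y i _ _ _ huv), MultilinearMap.map_update_add, TensorProduct.tmul_add,
          smul_add]
      map_update_smul' := by
        intro d y i b u
        obtain ⟨n, a, ha⟩ := IsLocalization.Away.surj f b
        have hu : f ^ (c u + n) • (b • u) = α (a • z u) := by
          rw [map_smul, ← hz, pow_add, mul_smul, smul_comm a, ← algebraMap_smul B (f ^ n),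
            smul_smul, map_pow, mul_comm _ b, ha, algebraMap_smul]
        rw [hG _ _ _ (hupd d y i _ _ _ hu), hG _ _ _ (hupd d y i u _ _ (hz u)),
          MultilinearMap.map_update_smul, TensorProduct.tmul_smul,
          Finset.sum_update_of_mem (Finset.mem_univ i), Finset.sum_update_of_mem (Finset.mem_univ i),
          smul_smul, ← algebraMap_smul B a, smul_smul, ← ha]
        congr 1
        have := hg n
        rw [add_right_comm, pow_add _ _ n]
        linear_combination (b * g ^ (c u + ∑ x ∈ Finset.univ \ {i}, c (y x))) * this }
  have hsymm : ∀ (e : Equiv.Perm ι) (m : ι → M'), Gm (fun i => m (e i)) = Gm m := by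
    intro e m
    change (g ^ ∑ i, c (m (e i))) • ((1 : B) ⊗ₜ[A] SymmetricPower.tprod A (fun i => z (m (e i)))) = _
    rw [Equiv.sum_comp e (fun i => c (m i)), SymmetricPower.tprod_equiv e (fun i => z (m i))]
    rfl
  have key : ∀ x, SymmetricPower.liftSymm ι Gm hsymm (θ x) = (1 : B) ⊗ₜ[A] x := by
    intro x
    have hx : x ∈ Submodule.span A (Set.range (SymmetricPower.tprod A (ι := ι) (M := M))) := by
      rw [SymmetricPower.span_tprod_eq_top]; trivial
    induction hx using Submodule.span_induction with
    | mem x hx =>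
      obtain ⟨m, rfl⟩ := hx
      rw [hθ, SymmetricPower.liftSymm_tprod]
      change G _ = _
      rw [hG _ (fun _ => 0) m (fun i => by rw [pow_zero, one_smul])]
      simp
    | zero => simp
    | add x y _ _ hx hy => rw [map_add, map_add, hx, hy, TensorProduct.tmul_add]
    | smul r x _ hx => rw [hθ', map_smul, hx, TensorProduct.tmul_smul, algebraMap_smul]
  have h0 : TensorProduct.mk A B (SymmetricPower A ι M) 1 x = 0 := by
    rw [TensorProduct.mk_apply, ← key, hx, map_zero]
  obtain ⟨⟨_, n, rfl⟩, hn⟩ := (IsLocalizedModule.eq_zero_iff (.powers f) _).1 h0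
  exact ⟨n, hn⟩

end

end LocalizationAlgebra

namespace AlgebraicGeometry.Scheme

variable {X : Scheme.{u}}

/-! ### Quasi-coherence on sections -/

theorem rres_eq_algebraMap {U : X.Opens} (f : Γ(X, U)) :
    rres (X.basicOpen_le f) = algebraMap Γ(X, U) Γ(X, X.basicOpen f) := rfl

theorem _root_.AlgebraicGeometry.IsAffineOpen.exists_basicOpen_subset {U W : X.Opens}
    (hU : IsAffineOpen U) {x : X} (hxU : x ∈ U) (hx : x ∈ W) :
    ∃ f : Γ(X, U), X.basicOpen f ≤ W ∧ x ∈ X.basicOpen f :=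
  hU.exists_basicOpen_le (V := W) ⟨x, hx⟩ hxU

/-- The local-to-global principle on affine open subsets: it is applied to the ideal of all r such
that r • s lies in a given submodule, to conclude that 1 belongs to it. -/
theorem _root_.AlgebraicGeometry.IsAffineOpen.ideal_eq_top {U : X.Opens} (hU : IsAffineOpen U)
    (I : Ideal Γ(X, U)) (h : ∀ x ∈ U, ∃ (f : Γ(X, U)) (n : ℕ), x ∈ X.basicOpen f ∧ f ^ n ∈ I) :
    I = ⊤ := by
  have h' : Ideal.span (I : Set Γ(X, U)) = ⊤ := by
    rw [← hU.iSup_basicOpen_eq_self_iff]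
    refine le_antisymm (iSup_le fun f => X.basicOpen_le _) fun x hx => ?_
    obtain ⟨f, n, hxf, hf⟩ := h x hx
    refine Opens.mem_iSup.2 ⟨⟨f ^ (n + 1), ?_⟩, ?_⟩
    · rw [pow_succ']; exact I.mul_mem_left _ hf
    · rwa [Scheme.basicOpen_pow _ _ (Nat.succ_pos n)]
  rwa [Ideal.span_eq] at h'

theorem isUnit_rres_basicOpen {U V : X.Opens} (f : Γ(X, U)) (h : V ≤ U) (hV : V ≤ X.basicOpen f) :
    IsUnit (rres h f) := by
  have := (RingedSpace.isUnit_res_basicOpen X.toRingedSpace f).map (rres hV)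
  have e : rres h f = rres hV (rres (X.basicOpen_le f) f) := by rw [rres_rres]
  rw [e]
  exact this

/-- A presheaf of modules satisfies the conditions for quasi-coherence on the affine open `U`: the
sections over a basic open subset of `U` are a localization of those over `U`. -/
structure IsQCOn (P : PMod X) (U : X.Opens) : Prop where
  eq_zero (f : Γ(X, U)) (s : sec P U) (hs : res P (X.basicOpen_le f) s = 0) :
    ∃ n : ℕ, f ^ n • s = 0
  extend (f : Γ(X, U)) (t : sec P (X.basicOpen f)) : ∃ (n : ℕ) (s : sec P U),
    res P (X.basicOpen_le f) s = rres (X.basicOpen_le f) f ^ n • t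

/-- A presheaf of modules is quasi-coherent on sections over affine open subsets. -/
def QC (P : PMod X) : Prop := ∀ U : X.Opens, IsAffineOpen U → IsQCOn P U

/-- The coefficients of a linear combination over the basic open subset are fractions with powers of
f as denominators, and these can be cleared. -/
theorem exists_pow_smul_mem_of_mem_span {P : PMod X} {U : X.Opens} (hU : IsAffineOpen U)
    (f : Γ(X, U)) (N : Submodule Γ(X, U) (sec P U)) {t : sec P (X.basicOpen f)}
    (ht : t ∈ Submodule.span Γ(X, X.basicOpen f) (res P (X.basicOpen_le f) '' N)) :
    ∃ (n : ℕ), ∃ s ∈ N, res P (X.basicOpen_le f) s = rres (X.basicOpen_le f) f ^ n • t := by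
  have := hU.isLocalization_basicOpen f
  induction ht using Submodule.span_induction with
  | mem t ht => obtain ⟨s, hs, rfl⟩ := ht; exact ⟨0, s, hs, by simp⟩
  | zero => exact ⟨0, 0, zero_mem _, by simp⟩
  | add t t' _ _ ht ht' =>
    obtain ⟨n, s, hs, h⟩ := ht
    obtain ⟨n', s', hs', h'⟩ := ht'
    refine ⟨n + n', f ^ n' • s + f ^ n • s', add_mem (N.smul_mem _ hs) (N.smul_mem _ hs'), ?_⟩
    rw [map_add, res_smul, res_smul, h, h', map_pow, map_pow, smul_smul, smul_smul, ← pow_add,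
      ← pow_add, smul_add, add_comm n']
  | smul c t _ ht =>
    obtain ⟨n, s, hs, h⟩ := ht
    obtain ⟨m, a, ha⟩ := IsLocalization.Away.surj f c
    refine ⟨m + n, a • s, N.smul_mem _ hs, ?_⟩
    rw [← rres_eq_algebraMap] at ha
    rw [res_smul, h, ← ha, smul_smul, smul_smul]
    congr 1
    ring

/-- Sections which locally belong to the span of a submodule `N` belong to `N`. -/
theorem mem_of_locally_mem_span {P : PMod X} {U : X.Opens} (hU : IsAffineOpen U)
    (hP : IsQCOn P U) (N : Submodule Γ(X, U) (sec P U)) (s : sec P U)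
    (hs : ∀ x ∈ U, ∃ (W : X.Opens) (hW : W ≤ U), x ∈ W ∧
      res P hW s ∈ Submodule.span Γ(X, W) (res P hW '' N)) : s ∈ N := by
  have h := hU.ideal_eq_top (N.comap (LinearMap.toSpanSingleton Γ(X, U) _ s)) ?_
  · have h1 : (1 : Γ(X, U)) ∈ N.comap (LinearMap.toSpanSingleton Γ(X, U) _ s) := by rw [h]; trivial
    simpa using h1
  · intro x hx
    obtain ⟨W, hW, hxW, h⟩ := hs x hx
    obtain ⟨f, hf, hxf⟩ := hU.exists_basicOpen_subset hx hxW
    have h' : res P (X.basicOpen_le f) s ∈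
        Submodule.span Γ(X, X.basicOpen f) (res P (X.basicOpen_le f) '' N) := by
      rw [← res_res P hW hf]
      refine res_mem_span hf ?_ h
      rintro _ ⟨t, ht, rfl⟩
      rw [res_res]
      exact Submodule.subset_span ⟨t, ht, rfl⟩
    obtain ⟨n, t, ht, e⟩ := exists_pow_smul_mem_of_mem_span hU f N h'
    obtain ⟨m, hm⟩ := hP.eq_zero f (f ^ n • s - t) (by
      rw [map_sub, res_smul, map_pow, e, sub_self])
    refine ⟨f, m + n, hxf, ?_⟩
    rw [smul_sub, sub_eq_zero, smul_smul, ← pow_add] at hm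
    rw [Submodule.mem_comap, LinearMap.toSpanSingleton_apply, hm]
    exact N.smul_mem _ ht

/-! ### Sheafification of quasi-coherent presheaves -/

theorem toShf_injective {P : PMod X} {U : X.Opens} (hU : IsAffineOpen U) (hP : IsQCOn P U) :
    Function.Injective (toShf P U) := by
  rw [injective_iff_map_eq_zero]
  intro s hs
  have : s ∈ (⊥ : Submodule Γ(X, U) (sec P U)) := by
    refine mem_of_locally_mem_span hU hP ⊥ s fun x hx => ?_
    obtain ⟨W, hW, hxW, h⟩ := toShf_locally_injective P hs hx
    exact ⟨W, hW, hxW, by rw [h]; exact zero_mem _⟩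
  simpa using this

/-- Locally a power of f kills s, because s comes from the presheaf; compactness of U makes the
exponent uniform. -/
theorem shf_eq_zero {P : PMod X} (hP : QC P) {U : X.Opens} (hU : IsAffineOpen U) (f : Γ(X, U))
    (s : sec (shf P).pval U) (hs : res (shf P).pval (X.basicOpen_le f) s = 0) :
    ∃ n : ℕ, f ^ n • s = 0 := by
  suffices H : ∃ n : ℕ, ∀ x ∈ (U : Set X), ∃ (W : X.Opens) (hW : W ≤ U), x ∈ W ∧
      res (shf P).pval hW (f ^ n • s) = 0 by
    obtain ⟨n, hn⟩ := H
    refine ⟨n, (shf P).sec_ext fun x hx => ?_⟩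
    obtain ⟨W, hW, hxW, h⟩ := hn x hx
    exact ⟨W, hW, hxW, by rw [h, map_zero]⟩
  refine hU.isCompact.induction_on (p := fun S => ∃ n : ℕ, ∀ x ∈ S, ∃ (W : X.Opens) (hW : W ≤ U),
    x ∈ W ∧ res (shf P).pval hW (f ^ n • s) = 0) ?_ ?_ ?_ ?_
  · exact ⟨0, fun x hx => hx.elim⟩
  · rintro S T hST ⟨n, hn⟩
    exact ⟨n, fun x hx => hn x (hST hx)⟩
  · rintro S T ⟨n, hn⟩ ⟨m, hm⟩
    refine ⟨n + m, ?_⟩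
    rintro x (hx | hx)
    · obtain ⟨W, hW, hxW, h⟩ := hn x hx
      exact ⟨W, hW, hxW, by rw [add_comm, pow_add, mul_smul, res_smul, h, smul_zero]⟩
    · obtain ⟨W, hW, hxW, h⟩ := hm x hx
      exact ⟨W, hW, hxW, by rw [pow_add, mul_smul, res_smul, h, smul_zero]⟩
  · intro x hx
    obtain ⟨W, hW, t, hxW, ht⟩ := toShf_locally_surjective P s hx
    obtain ⟨h, hhW, hxh⟩ := hU.exists_basicOpen_subset hx hxW
    have hV := hU.basicOpen h
    set V := X.basicOpen h with hVdef
    have hVU : V ≤ U := X.basicOpen_le h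
    have e : X.basicOpen (rres hVU f) ≤ X.basicOpen f := by
      rw [rres, Scheme.basicOpen_res]; exact inf_le_right
    -- The presheaf section t represents s on V. Its restriction to the locus in V where f is
    -- invertible is zero after sheafification, hence zero, as `toShf` is injective over that affine
    -- open subset.
    obtain ⟨n, hn⟩ := (hP V hV).eq_zero (rres hVU f) (res P hhW t) (by
      apply toShf_injective (hV.basicOpen _) (hP _ (hV.basicOpen _))
      rw [← res_toShf, ← res_toShf, ht, map_zero, res_res, res_res,
        ← res_res _ (X.basicOpen_le f) e, hs, map_zero])
    refine ⟨V, mem_nhdsWithin_of_mem_nhds (V.2.mem_nhds hxh), n, fun y hy => ⟨V, hVU, hy, ?_⟩⟩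
    rw [res_smul, map_pow, ← res_res _ hW hhW, ← ht, res_toShf, ← map_smul, hn, map_zero]

/-- Together with `toShf_injective`: sections of the associated sheaf over affine open subsets are
those of the presheaf. So `tensor` and `symPower` of quasi-coherent sheaves can be computed there
with ordinary tensor products and symmetric powers. -/
theorem toShf_surjective {P : PMod X} (hP : QC P) {U : X.Opens} (hU : IsAffineOpen U) :
    Function.Surjective (toShf P U) := by
  intro s
  have h := hU.ideal_eq_top ((LinearMap.range (toShf P U)).comap
    (LinearMap.toSpanSingleton Γ(X, U) _ s)) ?_
  · have h1 : (1 : Γ(X, U)) ∈ (LinearMap.range (toShf P U)).comap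
      (LinearMap.toSpanSingleton Γ(X, U) _ s) := by rw [h]; trivial
    simpa using h1
  · intro x hx
    obtain ⟨W, hW, t, hxW, ht⟩ := toShf_locally_surjective P s hx
    obtain ⟨f, hf, hxf⟩ := hU.exists_basicOpen_subset hx hxW
    obtain ⟨n, t', ht'⟩ := (hP U hU).extend f (res P hf t)
    obtain ⟨m, hm⟩ := shf_eq_zero hP hU f (f ^ n • s - toShf P U t') (by
      rw [map_sub, res_smul, map_pow, res_toShf, ht', map_smul, ← res_toShf, ht, res_res, sub_self])
    refine ⟨f, m + n, hxf, f ^ m • t', ?_⟩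
    rw [smul_sub, sub_eq_zero, smul_smul, ← pow_add] at hm
    rw [LinearMap.toSpanSingleton_apply, hm, map_smul]

theorem QC.shf {P : PMod X} (hP : QC P) : QC (shf P).pval := fun U hU =>
  { eq_zero := shf_eq_zero hP hU
    extend := by
      intro f t
      obtain ⟨t, rfl⟩ := toShf_surjective hP (hU.basicOpen f) t
      obtain ⟨n, s, hs⟩ := (hP U hU).extend f t
      exact ⟨n, toShf P U s, by rw [res_toShf, hs, map_smul]⟩ }

/-! ### Tensor products and symmetric powers of quasi-coherent presheaves -/

/-- Restriction of sections from `U` to `V`, as a linear map. -/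
def resₗ (P : PMod X) {U V : X.Opens} (h : V ≤ U) :
    letI := Module.compHom (sec P V) (rres h)
    sec P U →ₗ[Γ(X, U)] sec P V :=
  letI := Module.compHom (sec P V) (rres h)
  { res P h with map_smul' := res_smul P h }

theorem IsQCOn.isLocalizedModule {P : PMod X} {U : X.Opens} (hP : IsQCOn P U) (f : Γ(X, U)) :
    letI := Module.compHom (sec P (X.basicOpen f)) (rres (X.basicOpen_le f))
    IsLocalizedModule (.powers f) (resₗ P (X.basicOpen_le f)) := by
  let := Module.compHom (sec P (X.basicOpen f)) (rres (X.basicOpen_le f))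
  refine IsLocalizedModule.Away.mk_of_addCommGroup ?_ ?_ ?_
  · rw [Module.End.isUnit_iff]
    have hu := isUnit_rres_basicOpen f (X.basicOpen_le f) le_rfl
    exact (hu.smul_bijective : Function.Bijective fun t : sec P (X.basicOpen f) =>
      rres (X.basicOpen_le f) f • t)
  · intro t
    obtain ⟨n, s, hs⟩ := hP.extend f t
    refine ⟨n, s, ?_⟩
    change rres (X.basicOpen_le f) (f ^ n) • t = res P (X.basicOpen_le f) s
    rw [hs, map_pow]
  · exact hP.eq_zero f

/-- The product of two presheaves of modules. -/
abbrev tmod (P Q : PMod X) : PMod X :=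
  PresheafOfModules.Monoidal.tensorObj (R := X.presheaf) P Q

/-- A pure tensor. -/
def tmul {P Q : PMod X} {U : X.Opens} (p : sec P U) (q : sec Q U) : sec (tmod P Q) U :=
  TensorProduct.tmul Γ(X, U) p q

theorem tmul_induction {P Q : PMod X} {U : X.Opens} {p : sec (tmod P Q) U → Prop}
    (h0 : p 0) (ht : ∀ a b, p (tmul a b)) (ha : ∀ s t, p s → p t → p (s + t)) (s) : p s := by
  let p' : TensorProduct Γ(X, U) (sec P U) (sec Q U) → Prop := p
  exact TensorProduct.induction_on (motive := p') s h0 ht ha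

theorem res_tmul {P Q : PMod X} {U V : X.Opens} (h : V ≤ U) (p : sec P U) (q : sec Q U) :
    res (tmod P Q) h (tmul p q) = tmul (res P h p) (res Q h q) := rfl

theorem smul_tmul_smul {P Q : PMod X} {U : X.Opens} (a b : Γ(X, U)) (p : sec P U) (q : sec Q U) :
    tmul (a • p) (b • q) = (a * b) • tmul p q := by
  exact TensorProduct.smul_tmul_smul a b p q

/-- Extension up to a power of f need only be checked on generators, here the pure tensors or the
products: each generator is an invertible multiple of a restricted section. -/
theorem exists_extend {P : PMod X} {U : X.Opens} (hU : IsAffineOpen U) (f : Γ(X, U))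
    (S : Set (sec P (X.basicOpen f))) (hS : Submodule.span Γ(X, X.basicOpen f) S = ⊤)
    (h : ∀ t ∈ S, ∃ (n : ℕ) (s : sec P U),
      res P (X.basicOpen_le f) s = rres (X.basicOpen_le f) f ^ n • t)
    (t : sec P (X.basicOpen f)) : ∃ (n : ℕ) (s : sec P U),
      res P (X.basicOpen_le f) s = rres (X.basicOpen_le f) f ^ n • t := by
  have ht : t ∈ Submodule.span Γ(X, X.basicOpen f)
      (res P (X.basicOpen_le f) '' (⊤ : Submodule Γ(X, U) (sec P U))) := by
    have : t ∈ Submodule.span Γ(X, X.basicOpen f) S := by rw [hS]; trivial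
    refine Submodule.span_le.2 (fun t ht => ?_) this
    obtain ⟨n, s, hs⟩ := h t ht
    have hu := (isUnit_rres_basicOpen f (X.basicOpen_le f) le_rfl).pow n
    obtain ⟨v, hv⟩ := hu.exists_left_inv
    have : t = v • res P (X.basicOpen_le f) s := by rw [hs, smul_smul, hv, one_smul]
    rw [this]
    exact Submodule.smul_mem _ _ (Submodule.subset_span ⟨s, trivial, rfl⟩)
  obtain ⟨n, s, -, hs⟩ := exists_pow_smul_mem_of_mem_span hU f ⊤ ht
  exact ⟨n, s, hs⟩

theorem span_range_tmul (P Q : PMod X) (U : X.Opens) :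
    Submodule.span Γ(X, U) (Set.range fun a : sec P U × sec Q U => tmul a.1 a.2) = ⊤ := by
  refine eq_top_iff.2 fun s _ => ?_
  induction s using tmul_induction with
  | h0 => exact zero_mem _
  | ht a b => exact Submodule.subset_span ⟨(a, b), rfl⟩
  | ha s t hs ht => exact add_mem (hs trivial) (ht trivial)

theorem QC.tmod {P Q : PMod X} (hP : QC P) (hQ : QC Q) : QC (tmod P Q) := fun U hU =>
  { eq_zero := by
      intro f s hs
      have := hU.isLocalization_basicOpen f
      let := Module.compHom (sec P (X.basicOpen f)) (rres (X.basicOpen_le f))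
      let := Module.compHom (sec Q (X.basicOpen f)) (rres (X.basicOpen_le f))
      have : IsScalarTower Γ(X, U) Γ(X, X.basicOpen f) (sec P (X.basicOpen f)) :=
        ⟨fun a b c => mul_smul (rres (X.basicOpen_le f) a) b c⟩
      have : IsScalarTower Γ(X, U) Γ(X, X.basicOpen f) (sec Q (X.basicOpen f)) :=
        ⟨fun a b c => mul_smul (rres (X.basicOpen_le f) a) b c⟩
      have := (hP U hU).isLocalizedModule f
      have := (hQ U hU).isLocalizedModule f
      exact TensorProduct.exists_pow_smul_eq_zero_of_away (A := Γ(X, U)) (B := Γ(X, X.basicOpen f))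
        (M := sec P U) (N := sec Q U) f
        (resₗ P (X.basicOpen_le f)) (resₗ Q (X.basicOpen_le f))
        (res (Scheme.tmod P Q) (X.basicOpen_le f)) (fun m n => rfl) hs
    extend := by
      intro f
      refine exists_extend hU f _ (span_range_tmul P Q _) ?_
      rintro _ ⟨⟨p, q⟩, rfl⟩
      obtain ⟨n, s, hs⟩ := (hP U hU).extend f p
      obtain ⟨m, t, ht⟩ := (hQ U hU).extend f q
      exact ⟨n + m, tmul s t, by rw [res_tmul, hs, ht, smul_tmul_smul, pow_add]⟩ }

/-- The presheaf of symmetric powers. -/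
abbrev smod (n : ℕ) (P : PMod X) : PMod X :=
  PresheafOfModules.symPower (R := X.presheaf) P n

/-- A product in a symmetric power. -/
def stprod {n : ℕ} {P : PMod X} {U : X.Opens} (e : ULift.{u} (Fin n) → sec P U) :
    sec (smod n P) U :=
  SymmetricPower.tprod Γ(X, U) e

theorem res_stprod {n : ℕ} {P : PMod X} {U V : X.Opens} (h : V ≤ U)
    (e : ULift.{u} (Fin n) → sec P U) :
    res (smod n P) h (stprod e) = stprod fun i => res P h (e i) :=
  SymmetricPower.mapₛₗ_tprod _ _ _ e

theorem smul_stprod {n : ℕ} {P : PMod X} {U : X.Opens} (c : ULift.{u} (Fin n) → Γ(X, U))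
    (e : ULift.{u} (Fin n) → sec P U) :
    stprod (fun i => c i • e i) = (∏ i, c i) • stprod e :=
  SymmetricPower.tprod_smul_univ c e

theorem span_range_stprod (n : ℕ) (P : PMod X) (U : X.Opens) :
    Submodule.span Γ(X, U) (Set.range (stprod : (ULift.{u} (Fin n) → sec P U) → _)) = ⊤ :=
  SymmetricPower.span_tprod_eq_top Γ(X, U) (ULift.{u} (Fin n)) (sec P U)

theorem QC.smod {P : PMod X} (hP : QC P) (n : ℕ) : QC (smod n P) := fun U hU =>
  { eq_zero := by
      intro f s hs
      have := hU.isLocalization_basicOpen f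
      let := Module.compHom (sec P (X.basicOpen f)) (rres (X.basicOpen_le f))
      have : IsScalarTower Γ(X, U) Γ(X, X.basicOpen f) (sec P (X.basicOpen f)) :=
        ⟨fun a b c => mul_smul (rres (X.basicOpen_le f) a) b c⟩
      have := (hP U hU).isLocalizedModule f
      exact SymmetricPower.exists_pow_smul_eq_zero_of_away (A := Γ(X, U))
        (B := Γ(X, X.basicOpen f)) (M := sec P U) f
        (resₗ P (X.basicOpen_le f)) (res (Scheme.smod n P) (X.basicOpen_le f))
        (res_stprod _)
        (res_smul (Scheme.smod n P) (X.basicOpen_le f)) hs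
    extend := by
      intro f
      refine exists_extend hU f _ (span_range_stprod n P _) ?_
      rintro _ ⟨e, rfl⟩
      choose c z hz using fun i => (hP U hU).extend f (e i)
      refine ⟨∑ i, c i, stprod z, ?_⟩
      rw [res_stprod, ← Finset.prod_pow_eq_pow_sum, ← smul_stprod]
      congr 1
      ext i
      exact hz i }

end AlgebraicGeometry.Scheme

namespace AlgebraicGeometry.Scheme

variable {X Y : Scheme.{u}}

/-! ### Quasi-coherent sheaves of modules -/

/-- The whole space gives a terminal object in each category of structured arrows. Finality is what
makes the pullback of the structure sheaf the structure sheaf. -/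
instance Modules.final_opensMap (f : X ⟶ Y) : (Opens.map f.base).Final where
  out d := by
    have h : Limits.IsTerminal (StructuredArrow.mk (Y := (⊤ : Opens Y)) (T := Opens.map f.base)
        (homOfLE le_top : d ⟶ (Opens.map f.base).obj ⊤)) :=
      Limits.IsTerminal.ofUniqueHom (fun s => StructuredArrow.homMk (homOfLE le_top))
        (fun s m => StructuredArrow.hom_ext _ _ (Subsingleton.elim _ _))
    have := h.hasTerminal
    exact isConnected_of_hasTerminal _

/-- The pullback of the structure sheaf is the structure sheaf. -/
def Modules.pullbackUnitIso (f : X ⟶ Y) :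
    (Modules.pullback f).obj (SheafOfModules.unit Y.ringCatSheaf) ≅
      (SheafOfModules.unit X.ringCatSheaf : X.Modules) :=
  have : (SheafOfModules.pushforward.{u} f.toRingCatSheafHom).IsRightAdjoint :=
    (Modules.pullbackPushforwardAdjunction f).isRightAdjoint
  @asIso X.Modules _ _ _ (SheafOfModules.pullbackObjUnitToUnit f.toRingCatSheafHom)
    (SheafOfModules.instIsIsoPullbackObjUnitToUnitOfFinal f.toRingCatSheafHom)

/-- The image of a presentation under a functor between categories of sheaves of modules. -/
def Modules.presentationMap (F : Y.Modules ⥤ X.Modules)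
    [hF : Limits.PreservesColimitsOfSize.{u, u} F]
    (η : (SheafOfModules.unit X.ringCatSheaf : X.Modules) ≅
      F.obj (SheafOfModules.unit Y.ringCatSheaf)) {M : Y.Modules}
    (pres : SheafOfModules.Presentation M) :
    SheafOfModules.Presentation (F.obj M) :=
  @SheafOfModules.Presentation.map _ _ _ _ _ _ _ _ _ _ _ _ _ pres F hF η

theorem _root_.SheafOfModules.Presentation.isFinite_map {C C' : Type*} [Category* C] [Category* C']
    {J : GrothendieckTopology C} {R : Sheaf J RingCat.{u}} [HasSheafify J AddCommGrpCat.{u}]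
    [J.WEqualsLocallyBijective AddCommGrpCat.{u}] {J' : GrothendieckTopology C'}
    {S : Sheaf J' RingCat.{u}} [HasSheafify J' AddCommGrpCat.{u}]
    [J'.WEqualsLocallyBijective AddCommGrpCat.{u}] {M : SheafOfModules.{u} R}
    (P : M.Presentation) [P.IsFinite] (F : SheafOfModules.{u} R ⥤ SheafOfModules.{u} S)
    [Limits.PreservesColimitsOfSize.{u, u} F]
    (η : SheafOfModules.unit S ≅ F.obj (SheafOfModules.unit R)) : (P.map F η).IsFinite where
  isFiniteType_generators := ⟨by
    rw [SheafOfModules.Presentation.map_generators_I]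
    exact SheafOfModules.GeneratingSections.IsFiniteType.finite⟩
  isFiniteType_relations := ⟨by
    rw [SheafOfModules.Presentation.map_relations_I]
    exact SheafOfModules.GeneratingSections.IsFiniteType.finite⟩

theorem Modules.isFinite_presentationMap (F : Y.Modules ⥤ X.Modules)
    [hF : Limits.PreservesColimitsOfSize.{u, u} F]
    (η : (SheafOfModules.unit X.ringCatSheaf : X.Modules) ≅
      F.obj (SheafOfModules.unit Y.ringCatSheaf)) {M : Y.Modules}
    (pres : SheafOfModules.Presentation M) [h : pres.IsFinite] :
    (Modules.presentationMap F η pres).IsFinite :=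
  @SheafOfModules.Presentation.isFinite_map _ _ _ _ _ _ _ _ _ _ _ _ _ pres h F hF η

/-- A presentation of the pullback of a sheaf of modules. -/
def Modules.presentationPullback (f : X ⟶ Y) {M : Y.Modules}
    (pres : SheafOfModules.Presentation M) :
    SheafOfModules.Presentation ((Modules.pullback f).obj M) :=
  have : Limits.PreservesColimitsOfSize.{u, u} (Modules.pullback f) :=
    (Modules.pullbackPushforwardAdjunction f).leftAdjoint_preservesColimits
  Modules.presentationMap (Modules.pullback f) (Modules.pullbackUnitIso f).symm pres

/-- A presentation of an isomorphic sheaf of modules. -/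
def Modules.presentationOfIso {M N : X.Modules} (e : M ≅ N)
    (pres : SheafOfModules.Presentation M) : SheafOfModules.Presentation N :=
  @SheafOfModules.Presentation.ofIsIso _ _ _ _ _ _ M N e.hom
    (Iso.isIso_hom e) pres

theorem Modules.isFinite_presentationOfIso {M N : X.Modules} (e : M ≅ N)
    (pres : SheafOfModules.Presentation M) [h : pres.IsFinite] :
    (Modules.presentationOfIso e pres).IsFinite where
  isFiniteType_generators := ⟨h.1.1⟩
  isFiniteType_relations := ⟨h.2.1⟩

/-- A presentation of the restriction to an open subscheme. -/
def Modules.presentationOver {M : X.Modules} (U : X.Opens)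
    (pres : SheafOfModules.Presentation (M.restrict U.ι)) :
    SheafOfModules.Presentation (SheafOfModules.over (R := X.ringCatSheaf) M U) :=
  have h : Limits.PreservesColimitsOfSize.{u, u} (overEquiv U).inverse :=
    (overEquiv U).symm.toAdjunction.leftAdjoint_preservesColimits
  @SheafOfModules.Presentation.ofIsIso _ _ _ _ _ _ _ _
    ((overEquiv U).unitIso.symm.app (SheafOfModules.over (R := X.ringCatSheaf) M U)).hom
    (Iso.isIso_hom _)
    (@SheafOfModules.Presentation.map _ _ _ _ _ _ _ _ _ _ _ _ _
      (Modules.presentationOfIso ((overFunctorEquiv U).symm.app M) pres) (overEquiv U).inverse h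
      (Opens.sheafOfModulesEquivOverInverseUnit U X.ringCatSheaf).symm)

theorem Modules.isFinite_presentationOver {M : X.Modules} (U : X.Opens)
    (pres : SheafOfModules.Presentation (M.restrict U.ι)) [hp : pres.IsFinite] :
    (Modules.presentationOver U pres).IsFinite := by
  have h1 := Modules.isFinite_presentationOfIso ((overFunctorEquiv U).symm.app M) pres
  have h : Limits.PreservesColimitsOfSize.{u, u} (overEquiv U).inverse :=
    (overEquiv U).symm.toAdjunction.leftAdjoint_preservesColimits
  have h2 := @SheafOfModules.Presentation.isFinite_map _ _ _ _ _ _ _ _ _ _ _ _ _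
      (Modules.presentationOfIso ((overFunctorEquiv U).symm.app M) pres) h1 (overEquiv U).inverse h
      (Opens.sheafOfModulesEquivOverInverseUnit U X.ringCatSheaf).symm
  exact @SheafOfModules.instIsFiniteOfIsIso _ _ _ _ _ _ _ _
    ((overEquiv U).unitIso.symm.app (SheafOfModules.over (R := X.ringCatSheaf) M U)).hom
    (Iso.isIso_hom _) _ h2

/-- The quasi-coherence data given by presentations of the restrictions to an open cover. -/
def Modules.quasicoherentData {M : X.Modules} {ι : Type u} (U : ι → X.Opens)
    (hU : IsOpenCover U) (pres : ∀ i, SheafOfModules.Presentation (M.restrict (U i).ι)) :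
    SheafOfModules.QuasicoherentData.{u} (R := X.ringCatSheaf) M where
  I := ι
  X := U
  coversTop := (Opens.coversTop_iff _ _).2 hU
  presentation i := Modules.presentationOver (U i) (pres i)

theorem Modules.isFinitePresentation_of_cover {M : X.Modules} {ι : Type u} (U : ι → X.Opens)
    (hU : IsOpenCover U) (pres : ∀ i, SheafOfModules.Presentation (M.restrict (U i).ι))
    (h : ∀ i, (pres i).IsFinite) :
    SheafOfModules.IsFinitePresentation (R := X.ringCatSheaf) M := by
  have h1 : ∀ i : (Modules.quasicoherentData U hU pres).I,
      ((Modules.quasicoherentData U hU pres).presentation i).IsFinite := by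
    intro i
    exact Modules.isFinite_presentationOver (U i) (pres i) (hp := h i)
  have h2 : (Modules.quasicoherentData U hU pres).IsFinitePresentation := by
    constructor
    exact h1
  constructor
  exact ⟨_, h2⟩

/-- Local presentations pull back to presentations, since pullback preserves colimits and the
structure sheaf; the chain of isomorphisms below identifies the pullback of a restriction with the
restriction of the pullback. -/
theorem Modules.isQuasicoherent_pullback (f : X ⟶ Y) (M : Y.Modules)
    [SheafOfModules.IsQuasicoherent (R := Y.ringCatSheaf) M] :
    SheafOfModules.IsQuasicoherent (R := X.ringCatSheaf) ((Modules.pullback f).obj M) := by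
  obtain ⟨ι, U, pres, hU, -⟩ := M.exists_isOpenCover_presentation
  refine (Modules.quasicoherentData (fun i => f ⁻¹ᵁ U i) ?_ fun i => ?_).isQuasicoherent
  · rw [IsOpenCover, ← Hom.preimage_iSup, hU, Hom.preimage_top]
  · refine Modules.presentationOfIso ?_ (Modules.presentationPullback (f ∣_ U i) (pres i))
    exact (Modules.pullback (f ∣_ U i)).mapIso ((restrictFunctorIsoPullback (U i).ι).app M) ≪≫
      (pullbackComp (f ∣_ U i) (U i).ι).app M ≪≫ (pullbackCongr (morphismRestrict_ι f (U i))).app M ≪≫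
      ((pullbackComp _ _).app M).symm ≪≫ ((restrictFunctorIsoPullback _).app _).symm

/-- Functions act on the restriction of a sheaf to Spec Γ(X, U) through the isomorphisms attached to
`fromSpec`. That action is identified with multiplication by restricted functions, which allows
`IsQCOn` to be compared with `IsLocalizing`. -/
theorem appIso_inv_fromSpec {U : X.Opens} (hU : IsAffineOpen U) (f : Γ(X, U))
    (W : (Spec Γ(X, U)).Opens) (h : hU.fromSpec ''ᵁ W ≤ U) :
    (hU.fromSpec.appIso W).inv ((Spec Γ(X, U)).presheaf.map W.leTop.op
      ((ΓSpecIso Γ(X, U)).inv f)) = rres h f := by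
  have e : W ≤ hU.fromSpec ⁻¹ᵁ U := by rw [hU.fromSpec_preimage_self]; exact le_top
  have h1 : hU.fromSpec.appLE U W e = (ΓSpecIso Γ(X, U)).inv ≫ (Spec Γ(X, U)).presheaf.map W.leTop.op := by
    rw [Hom.appLE, hU.fromSpec_app_of_le U le_rfl]
    simp only [Category.assoc, ← Functor.map_comp]
    erw [X.presheaf.map_id, Category.id_comp]
  have h2 := hU.fromSpec.appLE_appIso_inv e
  rw [h1] at h2
  exact congrArg (fun φ => φ.hom f) h2

theorem smul_restrict_fromSpec (M : X.Modules) {U : X.Opens} (hU : IsAffineOpen U)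
    (W : (Spec Γ(X, U)).Opens) (hW : hU.fromSpec ''ᵁ W ≤ U) (f : Γ(X, U))
    (x : sec M.pval (hU.fromSpec ''ᵁ W)) :
    (show sec M.pval (hU.fromSpec ''ᵁ W) from
      (f • (show Γ(M.restrict hU.fromSpec, W) from x))) = rres hW f • x :=
  congrArg (fun r : Γ(X, hU.fromSpec ''ᵁ W) => r • x) (appIso_inv_fromSpec hU f W hW)

theorem image_fromSpec_le {U : X.Opens} (hU : IsAffineOpen U) (W : (Spec Γ(X, U)).Opens) :
    hU.fromSpec ''ᵁ W ≤ U := by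
  conv_rhs => rw [← hU.opensRange_fromSpec]
  exact hU.fromSpec.image_le_opensRange W

theorem le_image_fromSpec_top {U : X.Opens} (hU : IsAffineOpen U) :
    U ≤ hU.fromSpec ''ᵁ ⊤ := by
  rw [Hom.image_top_eq_opensRange, hU.opensRange_fromSpec]

/-- The images under `fromSpec` of the spectrum and of its basic open subsets equal U and its basic
open subsets only propositionally, so sections are carried across by `res`. After that the two
notions coincide. -/
theorem isLocalizing_of_isQCOn {M : X.Modules} {U : X.Opens} (hU : IsAffineOpen U)
    (h : IsQCOn M.pval U) : IsLocalizing (modulesSpecToSheaf.obj (M.restrict hU.fromSpec)) := by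
  intro f
  have hD := hU.fromSpec_image_basicOpen f
  have hle : hU.fromSpec ''ᵁ (PrimeSpectrum.basicOpen f) ≤ hU.fromSpec ''ᵁ ⊤ :=
    hU.fromSpec.image_mono le_top
  refine IsLocalizedModule.Away.mk_of_addCommGroup ?_ ?_ ?_
  · exact Scheme.Modules.isUnit_algebraMap_end_of_le_basicOpen f le_rfl
  · intro (x : sec M.pval (hU.fromSpec ''ᵁ (PrimeSpectrum.basicOpen f)))
    obtain ⟨n, s, hs⟩ := h.extend f (res M.pval hD.ge x)
    refine ⟨n, res M.pval (image_fromSpec_le hU ⊤) s, ?_⟩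
    have e1 := smul_restrict_fromSpec M hU _ (image_fromSpec_le hU _) (f ^ n) x
    have e2 : res M.pval hle (res M.pval (image_fromSpec_le hU ⊤) s) =
        rres (image_fromSpec_le hU (PrimeSpectrum.basicOpen f)) (f ^ n) • x := by
      have := congrArg (res M.pval hD.le) hs
      rw [res_smul, res_res, res_res, res_self, map_pow, rres_rres] at this
      rw [res_res, this, map_pow]
    exact e1.trans e2.symm
  · intro (x : sec M.pval (hU.fromSpec ''ᵁ ⊤)) hx
    have hx : res M.pval hle x = 0 := hx
    obtain ⟨n, hn⟩ := h.eq_zero f (res M.pval (le_image_fromSpec_top hU) x) (by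
      have := congrArg (res M.pval hD.ge) hx
      rw [res_res, map_zero] at this
      rw [res_res, this])
    refine ⟨n, ?_⟩
    have e1 := smul_restrict_fromSpec M hU _ (image_fromSpec_le hU _) (f ^ n) x
    refine e1.trans ?_
    have := congrArg (res M.pval (image_fromSpec_le hU ⊤)) hn
    rw [res_smul, res_res, res_self, map_zero] at this
    exact this

theorem isQCOn_of_isLocalizing {M : X.Modules} {U : X.Opens} (hU : IsAffineOpen U)
    (h : IsLocalizing (modulesSpecToSheaf.obj (M.restrict hU.fromSpec))) : IsQCOn M.pval U := by
  have hle : ∀ f, hU.fromSpec ''ᵁ (PrimeSpectrum.basicOpen f) ≤ hU.fromSpec ''ᵁ ⊤ := fun f =>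
    hU.fromSpec.image_mono le_top
  constructor
  · intro f s hs
    have := h f
    have hD := hU.fromSpec_image_basicOpen f
    obtain ⟨⟨_, n, rfl⟩, hn⟩ := (IsLocalizedModule.eq_zero_iff (.powers f)
      ((modulesSpecToSheaf.obj (M.restrict hU.fromSpec)).obj.map
        (PrimeSpectrum.basicOpen f).leTop.op).hom
      (m := res M.pval (image_fromSpec_le hU ⊤) s)).1 (by
        have := congrArg (res M.pval hD.le) hs
        rw [res_res, map_zero] at this
        exact (res_res M.pval (image_fromSpec_le hU ⊤) (hle f) s).trans this)
    refine ⟨n, ?_⟩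
    have e1 : rres (image_fromSpec_le hU ⊤) (f ^ n) • res M.pval (image_fromSpec_le hU ⊤) s = 0 :=
      (smul_restrict_fromSpec M hU _ (image_fromSpec_le hU ⊤) (f ^ n)
        (res M.pval (image_fromSpec_le hU ⊤) s)).symm.trans hn
    have := congrArg (res M.pval (le_image_fromSpec_top hU)) e1
    rw [res_smul, res_res, res_self, map_zero, rres_rres, rres_self] at this
    exact this
  · intro f t
    have := h f
    have hD := hU.fromSpec_image_basicOpen f
    obtain ⟨⟨s, _, n, rfl⟩, hn⟩ := IsLocalizedModule.surj (.powers f)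
      ((modulesSpecToSheaf.obj (M.restrict hU.fromSpec)).obj.map
        (PrimeSpectrum.basicOpen f).leTop.op).hom
      (res M.pval hD.le t)
    let s : sec M.pval (hU.fromSpec ''ᵁ ⊤) := s
    refine ⟨n, res M.pval (le_image_fromSpec_top hU) s, ?_⟩
    have e1 : _ = res M.pval (hle f) s :=
      (smul_restrict_fromSpec M hU _ (image_fromSpec_le hU _) (f ^ n) _).symm.trans hn
    have := congrArg (res M.pval hD.ge) e1
    rw [res_smul, res_res, res_self, res_res, rres_rres, map_pow] at this
    rw [res_res, this]

theorem isQCOn_of_isQuasicoherent (M : X.Modules)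
    [hM : SheafOfModules.IsQuasicoherent (R := X.ringCatSheaf) M] : QC M.pval := by
  intro U hU
  refine isQCOn_of_isLocalizing hU ?_
  rw [← isIso_fromTildeΓ_iff_isLocalizing]
  have := Scheme.Modules.isQuasicoherent_restrictFunctor hU.fromSpec M
  exact Scheme.Modules.isIso_fromTildeΓ_of_isQuasicoherent _

/-- The isomorphism between the two forms of the restriction to an affine open subscheme. -/
def restrictFromSpecIso (M : X.Modules) {U : X.Opens} (hU : IsAffineOpen U) :
    (M.restrict hU.fromSpec).restrict hU.isoSpec.hom ≅ M.restrict U.ι :=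
  ((Modules.restrictFunctorComp hU.isoSpec.hom hU.fromSpec).symm ≪≫
    Modules.restrictFunctorCongr hU.isoSpec_hom_fromSpec).app M

/-- On U the sheaf is the one associated with a finitely generated module, whose relations are
finitely generated because the ring is noetherian. -/
theorem exists_presentation_of_isQCOn {M : X.Modules} {U : X.Opens} (hU : IsAffineOpen U)
    (h : IsQCOn M.pval U) [hN : IsNoetherianRing Γ(X, U)]
    (hF : Module.Finite Γ(X, U) (sec M.pval U)) :
    ∃ p : SheafOfModules.Presentation (M.restrict U.ι), p.IsFinite := by
  have h1 := (isIso_fromTildeΓ_iff_isLocalizing _).2 (isLocalizing_of_isQCOn hU h)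
  let N : ModuleCat Γ(X, U) := moduleSpecΓFunctor.obj (M.restrict hU.fromSpec)
  have hNF : Module.Finite Γ(X, U) N := by
    let φ : sec M.pval U →ₗ[Γ(X, U)] N :=
      { toFun := res M.pval (image_fromSpec_le hU ⊤)
        map_add' := map_add _
        map_smul' := fun f x => (res_smul M.pval _ f x).trans
          (smul_restrict_fromSpec M hU _ (image_fromSpec_le hU _) f _).symm }
    refine Module.Finite.of_surjective φ fun y => ⟨res M.pval (le_image_fromSpec_top hU) y, ?_⟩
    let y' : sec M.pval (hU.fromSpec ''ᵁ ⊤) := y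
    exact (res_res M.pval _ _ y').trans (res_self M.pval le_rfl y')
  obtain ⟨s, hs⟩ := hNF
  let S : Set N := s
  have hS : Submodule.span Γ(X, U) S = ⊤ := hs
  have : Finite S := inferInstanceAs (Finite (s : Set N))
  obtain ⟨t, ht⟩ := IsNoetherian.noetherian
    (LinearMap.ker (Finsupp.linearCombination Γ(X, U) ((↑) : S → N)))
  let p := presentationTilde N S hS (t : Set (S →₀ Γ(X, U))) ht
  have hp : p.IsFinite := ⟨⟨inferInstanceAs (Finite S)⟩,
    ⟨inferInstanceAs (Finite (t : Set (S →₀ Γ(X, U))))⟩⟩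
  let e : tilde N ≅ M.restrict hU.fromSpec := @asIso (Spec Γ(X, U)).Modules _ _ _ (M.restrict hU.fromSpec).fromTildeΓ h1
  have hp' := Modules.isFinite_presentationOfIso e p
  have hp'' := Modules.isFinite_presentationMap (Modules.restrictFunctor hU.isoSpec.hom)
    (Modules.restrictUnitIso _).symm (Modules.presentationOfIso e p)
  exact ⟨Modules.presentationOfIso (restrictFromSpecIso M hU) (Modules.presentationMap
    (Modules.restrictFunctor hU.isoSpec.hom) (Modules.restrictUnitIso _).symm
    (Modules.presentationOfIso e p)),
    Modules.isFinite_presentationOfIso (h := hp'') (restrictFromSpecIso M hU) _⟩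

theorem isCoherent_of_isQCOn {M : X.Modules} {ι : Type u} (U : ι → X.Opens)
    (hU : IsOpenCover U) (hA : ∀ i, IsAffineOpen (U i)) (hN : ∀ i, IsNoetherianRing Γ(X, U i))
    (h : ∀ i, IsQCOn M.pval (U i)) (hF : ∀ i, Module.Finite Γ(X, U i) (sec M.pval (U i))) :
    M.IsCoherent := by
  choose p hp using fun i => exists_presentation_of_isQCOn (hA i) (h i) (hF i)
  exact Modules.isFinitePresentation_of_cover U hU p hp

end AlgebraicGeometry.Scheme

/-! ### Logarithmic forms and localization -/

namespace KaehlerDifferential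

variable (k : Type u) [Field k] {A S K : Type u} [CommRing A] [CommRing S] [Field K]
  [Algebra A K] [Algebra S K] [Algebra k K]

theorem D_mem_regularForms (a : A) : D k K (algebraMap A K a) ∈ regularForms k A K :=
  Submodule.subset_span ⟨a, rfl⟩

variable {k}

theorem add_wedge (α β γ : Ω[K⁄k]) : wedge k (α + β) γ = wedge k α γ + wedge k β γ := by
  rw [wedge, map_add, add_mul]; rfl

theorem smul_wedge (a : A) (α β : Ω[K⁄k]) : wedge k (a • α) β = a • wedge k α β := by
  rw [← algebraMap_smul K a α, wedge, map_smul, smul_mul_assoc, algebraMap_smul K a]; rfl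

theorem wedge_smul (a : A) (α β : Ω[K⁄k]) : wedge k α (a • β) = a • wedge k α β := by
  rw [← algebraMap_smul K a β, wedge, map_smul, mul_smul_comm, algebraMap_smul K a]; rfl

theorem wedge_mem_regularTwoForms {α β : Ω[K⁄k]} (hα : α ∈ regularForms k A K)
    (hβ : β ∈ regularForms k A K) : wedge k α β ∈ regularTwoForms k A K :=
  Submodule.subset_span ⟨α, hα, β, hβ, rfl⟩

theorem D_mul_algebraMap (a b : A) : D k K (algebraMap A K (a * b)) =
    a • D k K (algebraMap A K b) + b • D k K (algebraMap A K a) := by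
  rw [map_mul, Derivation.leibniz, algebraMap_smul, algebraMap_smul]

/-- The second condition passes from g to a g because d(a g) ∧ ω = a dg ∧ ω + da ∧ (g ω), where g ω
is regular by the first condition. -/
theorem mem_logForms_span {s : Set A} {ω : Ω[K⁄k]}
    (h : ∀ g ∈ s, g • ω ∈ regularForms k A K ∧
      wedge k (D k K (algebraMap A K g)) ω ∈ regularTwoForms k A K) :
    ω ∈ logForms k K (Ideal.span s) := by
  intro g hg
  induction hg using Submodule.span_induction with
  | mem g hg => exact h g hg
  | zero =>
    refine ⟨by rw [zero_smul]; exact zero_mem _, ?_⟩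
    rw [map_zero, map_zero, wedge, map_zero, zero_mul]; exact zero_mem _
  | add a b _ _ ha hb =>
    refine ⟨by rw [add_smul]; exact add_mem ha.1 hb.1, ?_⟩
    rw [map_add, map_add, add_wedge]; exact add_mem ha.2 hb.2
  | smul a g _ hg =>
    refine ⟨by rw [smul_eq_mul, mul_smul]; exact Submodule.smul_mem _ _ hg.1, ?_⟩
    rw [smul_eq_mul, D_mul_algebraMap, add_wedge, smul_wedge, smul_wedge, ← wedge_smul g]
    exact add_mem (Submodule.smul_mem _ _ hg.2)
      (wedge_mem_regularTwoForms (D_mem_regularForms k a) hg.1)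

theorem logForms_antitone {I J : Ideal A} (h : I ≤ J) : logForms k K J ≤ logForms k K I :=
  fun _ hω g hg => hω g (h hg)

variable [Algebra A S] [IsScalarTower A S K]

theorem mem_regularForms_of_algebra {ω : Ω[K⁄k]} (h : ω ∈ regularForms k A K) :
    ω ∈ regularForms k S K := by
  induction h using Submodule.span_induction with
  | mem ω h =>
    obtain ⟨a, rfl⟩ := h
    dsimp only
    rw [IsScalarTower.algebraMap_apply A S K]
    exact D_mem_regularForms k _
  | zero => exact zero_mem _
  | add _ _ _ _ h h' => exact add_mem h h'
  | smul a ω _ h => rw [← algebraMap_smul S a ω]; exact Submodule.smul_mem _ _ h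

theorem mem_regularTwoForms_of_algebra {τ : ExteriorAlgebra K Ω[K⁄k]}
    (h : τ ∈ regularTwoForms k A K) : τ ∈ regularTwoForms k S K := by
  induction h using Submodule.span_induction with
  | mem ω h =>
    obtain ⟨α, hα, β, hβ, rfl⟩ := h
    exact wedge_mem_regularTwoForms (mem_regularForms_of_algebra hα) (mem_regularForms_of_algebra hβ)
  | zero => exact zero_mem _
  | add _ _ _ _ h h' => exact add_mem h h'
  | smul a ω _ h => rw [← algebraMap_smul S a ω]; exact Submodule.smul_mem _ _ h

variable (M : Submonoid A) [IsLocalization M S]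

theorem exists_smul_mem_of_mem_span {V : Type*} [AddCommGroup V] [Module A V] [Module S V]
    [IsScalarTower A S V] (N : Submodule A V) {t : Set V} (ht : ∀ v ∈ t, ∃ s ∈ M, s • v ∈ N)
    {v : V} (hv : v ∈ Submodule.span S t) : ∃ s ∈ M, s • v ∈ N := by
  induction hv using Submodule.span_induction with
  | mem v hv => exact ht v hv
  | zero => exact ⟨1, one_mem _, by rw [smul_zero]; exact zero_mem _⟩
  | add v w _ _ hv hw =>
    obtain ⟨s, hs, h⟩ := hv
    obtain ⟨r, hr, h'⟩ := hw
    refine ⟨s * r, mul_mem hs hr, ?_⟩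
    rw [smul_add, mul_smul, smul_comm, mul_smul]
    exact add_mem (N.smul_mem _ h) (N.smul_mem _ h')
  | smul b v _ hv =>
    obtain ⟨s, hs, h⟩ := hv
    obtain ⟨⟨a, r⟩, e⟩ := IsLocalization.surj M b
    refine ⟨s * r, mul_mem hs r.2, ?_⟩
    have : ((s * r : A)) • b • v = a • s • v := by
      rw [mul_smul, ← algebraMap_smul S (r : A), smul_smul, mul_comm, e, algebraMap_smul, smul_comm]
    rw [this]
    exact N.smul_mem _ h

theorem exists_smul_mem_regularForms {ω : Ω[K⁄k]} (h : ω ∈ regularForms k S K) :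
    ∃ s ∈ M, s • ω ∈ regularForms k A K := by
  refine exists_smul_mem_of_mem_span M _ ?_ h
  rintro _ ⟨b, rfl⟩
  obtain ⟨⟨a, s⟩, e⟩ := IsLocalization.surj M b
  -- The quotient rule: for b = a / s one has s² db = s da − a ds.
  refine ⟨s * s, mul_mem s.2 s.2, ?_⟩
  have e' : algebraMap A K a = algebraMap A K s * algebraMap S K b := by
    rw [IsScalarTower.algebraMap_apply A S K, ← e, map_mul, mul_comm,
      ← IsScalarTower.algebraMap_apply]
  have h1 : D k K (algebraMap A K a) = (s : A) • D k K (algebraMap S K b) +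
      algebraMap S K b • D k K (algebraMap A K s) := by
    rw [e', Derivation.leibniz, algebraMap_smul]
  have h2 : ((s * s : A)) • D k K (algebraMap S K b) =
      (s : A) • D k K (algebraMap A K a) - a • D k K (algebraMap A K s) := by
    rw [h1, smul_add, mul_smul, ← algebraMap_smul K (s : A) (algebraMap S K b • _), smul_smul (algebraMap A K _), ← e',
      algebraMap_smul, add_sub_cancel_right]
  dsimp only
  rw [h2]
  exact sub_mem (Submodule.smul_mem _ _ (D_mem_regularForms k _))
    (Submodule.smul_mem _ _ (D_mem_regularForms k _))

theorem exists_smul_mem_regularTwoForms {τ : ExteriorAlgebra K Ω[K⁄k]}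
    (h : τ ∈ regularTwoForms k S K) : ∃ s ∈ M, s • τ ∈ regularTwoForms k A K := by
  refine exists_smul_mem_of_mem_span M _ ?_ h
  rintro _ ⟨α, hα, β, hβ, rfl⟩
  obtain ⟨s, hs, h⟩ := exists_smul_mem_regularForms M hα
  obtain ⟨r, hr, h'⟩ := exists_smul_mem_regularForms M hβ
  refine ⟨s * r, mul_mem hs hr, ?_⟩
  rw [mul_smul, ← wedge_smul, ← smul_wedge]
  exact wedge_mem_regularTwoForms h h'

theorem mem_logForms_map {I : Ideal A} {ω : Ω[K⁄k]} (h : ω ∈ logForms k K I) :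
    ω ∈ logForms k K (I.map (algebraMap A S)) := by
  refine mem_logForms_span ?_
  rintro _ ⟨g, hg, rfl⟩
  obtain ⟨h1, h2⟩ := h g hg
  rw [algebraMap_smul, ← IsScalarTower.algebraMap_apply]
  exact ⟨mem_regularForms_of_algebra h1, mem_regularTwoForms_of_algebra h2⟩

/-- Only finitely many generators of I have to be tested, so their denominators have a common
multiple in M. With `mem_logForms_map` this shows that logarithmic forms commute with localization.
-/
theorem exists_smul_mem_logForms {I : Ideal A} (hI : I.FG) {ω : Ω[K⁄k]}
    (h : ω ∈ logForms k K (I.map (algebraMap A S))) : ∃ s ∈ M, s • ω ∈ logForms k K I := by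
  obtain ⟨t, rfl⟩ := hI
  -- The arbitrary factor r leaves room for the denominators belonging to the other generators.
  have H : ∀ g ∈ t, ∃ s ∈ M, ∀ r : A, g • ((r * s) • ω) ∈ regularForms k A K ∧
      wedge k (D k K (algebraMap A K g)) ((r * s) • ω) ∈ regularTwoForms k A K := by
    intro g hg
    obtain ⟨h1, h2⟩ := h _ (Ideal.mem_map_of_mem _ (Ideal.subset_span hg))
    rw [algebraMap_smul] at h1
    rw [← IsScalarTower.algebraMap_apply] at h2
    obtain ⟨s, hs, h1⟩ := exists_smul_mem_regularForms M h1
    obtain ⟨r, hr, h2⟩ := exists_smul_mem_regularTwoForms M h2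
    refine ⟨s * r, mul_mem hs hr, fun a => ⟨?_, ?_⟩⟩
    · have : g • (a * (s * r)) • ω = (a * r) • s • g • ω := by
        rw [smul_smul, smul_smul, smul_smul]; congr 1; ring
      rw [this]
      exact Submodule.smul_mem _ _ h1
    · rw [wedge_smul, ← mul_assoc, mul_smul]
      exact Submodule.smul_mem _ _ h2
  choose! s hs H using H
  refine ⟨∏ g ∈ t, s g, prod_mem hs, mem_logForms_span fun g hg => ?_⟩
  classical
  rw [← Finset.prod_erase_mul t s hg]
  exact H g hg _

theorem regularForms_fg [Algebra k A] [IsScalarTower k A K] [Algebra.FiniteType k A] :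
    (regularForms k A K).FG := by
  obtain ⟨t, ht⟩ := Algebra.FiniteType.out (R := k) (A := A)
  have : regularForms k A K =
      Submodule.span A ((fun a : A => D k K (algebraMap A K a)) '' t) := by
    refine le_antisymm (Submodule.span_le.2 ?_) (Submodule.span_mono (Set.image_subset_range _ _))
    rintro _ ⟨a, rfl⟩
    have ha : a ∈ Algebra.adjoin k (t : Set A) := by rw [ht]; trivial
    dsimp only
    induction ha using Algebra.adjoin_induction with
    | mem a ha => exact Submodule.subset_span ⟨a, ha, rfl⟩
    | algebraMap r =>
      rw [← IsScalarTower.algebraMap_apply, Derivation.map_algebraMap]; exact zero_mem _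
    | add a b _ _ ha hb => rw [map_add, map_add]; exact add_mem ha hb
    | mul a b _ _ ha hb =>
      rw [SetLike.mem_coe, D_mul_algebraMap]
      exact add_mem (Submodule.smul_mem _ _ hb) (Submodule.smul_mem _ _ ha)
  rw [this]
  exact Submodule.fg_span (t.finite_toSet.image _)

/-- Multiplication by a nonzero element of I embeds the logarithmic forms into the regular forms, a
finitely generated module over a noetherian ring. -/
theorem logForms_fg [Algebra k A] [IsScalarTower k A K] [Algebra.FiniteType k A]
    [FaithfulSMul A K] {I : Ideal A} (hI : I ≠ ⊥) : (logForms k K I).FG := by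
  have : IsNoetherianRing A := Algebra.FiniteType.isNoetherianRing k A
  have : Module.Finite A (regularForms k A K) :=
    Module.Finite.iff_fg.2 regularForms_fg
  obtain ⟨g, hg, hg0⟩ := Submodule.exists_mem_ne_zero_of_ne_bot hI
  let φ : logForms k K I →ₗ[A] regularForms k A K :=
    { toFun := fun ω => ⟨g • ω.1, (ω.2 g hg).1⟩
      map_add' := fun a b => Subtype.ext (smul_add _ _ _)
      map_smul' := fun a b => Subtype.ext (smul_comm _ _ _) }
  have hφ : Function.Injective φ := by
    intro a b h
    have h : g • a.1 = g • b.1 := congrArg Subtype.val h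
    rw [← algebraMap_smul K g, ← algebraMap_smul K g] at h
    exact Subtype.ext (smul_right_injective _
      ((map_ne_zero_iff _ (FaithfulSMul.algebraMap_injective A K)).2 hg0) h)
  exact Module.Finite.iff_fg.1 (Module.Finite.of_injective φ hφ)

end KaehlerDifferential

namespace AlgebraicGeometry.Scheme

/-! ### Sections of sheaves of lattices -/

section LatticeSections

set_option linter.unusedSectionVars false

variable {X : Scheme.{u}} [IsIntegral X]
variable {V : Type u} [AddCommGroup V] [Module X.functionField V] {L L' : LatticeFamily X V}

/-- The value at `x` of a section of a sheaf of lattices. -/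
def latVal {U : X.Opens} (s : sec (latticeSheaf L).pval U) (x : U) : V :=
  (show latticeSections L (op U) from s).1 x

/-- The section of a sheaf of lattices with constant value `v`. -/
def latMk (L : LatticeFamily X V) (U : X.Opens) (v : V) (hv : ∀ x : U, v ∈ L.lattice x) :
    sec (latticeSheaf L).pval U :=
  (⟨fun _ => v, fun _ _ => rfl, hv⟩ : latticeSections L (op U))

theorem latVal_mk {U : X.Opens} (v : V) (hv : ∀ x : U, v ∈ L.lattice x) (x : U) :
    latVal (latMk L U v hv) x = v := rfl

theorem latVal_ext {U : X.Opens} {s t : sec (latticeSheaf L).pval U}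
    (h : ∀ x, latVal s x = latVal t x) : s = t :=
  Subtype.ext (funext h)

theorem latVal_const {U : X.Opens} (s : sec (latticeSheaf L).pval U) (x y : U) :
    latVal s x = latVal s y :=
  (show latticeSections L (op U) from s).2.1 x y

theorem latVal_mem {U : X.Opens} (s : sec (latticeSheaf L).pval U) (x : U) :
    latVal s x ∈ L.lattice x :=
  (show latticeSections L (op U) from s).2.2 x

theorem latVal_mem' {U : X.Opens} (s : sec (latticeSheaf L).pval U) (x y : U) :
    latVal s x ∈ L.lattice y := by
  rw [latVal_const s x y]; exact latVal_mem s y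

theorem latVal_res {U W : X.Opens} (h : W ≤ U) (s : sec (latticeSheaf L).pval U) (x : W) :
    latVal (res (latticeSheaf L).pval h s) x = latVal s ⟨x.1, h x.2⟩ := rfl

theorem latVal_zero {U : X.Opens} (x : U) :
    latVal (0 : sec (latticeSheaf L).pval U) x = 0 := rfl

variable {U : X.Opens} [Nonempty U]

theorem toRational_eq_algebraMap (x : U) (f : Γ(X, U)) :
    toRational x f = algebraMap Γ(X, U) X.functionField f :=
  algebraMap_germ_eq_germToFunctionField X x.2 f

variable [Module Γ(X, U) V] [IsScalarTower Γ(X, U) X.functionField V]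

theorem latVal_smul (f : Γ(X, U)) (s : sec (latticeSheaf L).pval U) (x : U) :
    latVal (f • s) x = f • latVal s x := by
  rw [← algebraMap_smul X.functionField f (latVal s x), ← toRational_eq_algebraMap x]
  rfl

theorem mem_of_smul_mem_lattice (x : U) (f : Γ(X, U)) (hf : x.1 ∈ X.basicOpen f) {v : V}
    (hv : f • v ∈ L.lattice x) : v ∈ L.lattice x := by
  rw [X.mem_basicOpen f x.1 x.2] at hf
  obtain ⟨b, hb⟩ := hf.exists_left_inv
  rw [← algebraMap_smul X.functionField f, ← toRational_eq_algebraMap x] at hv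
  have := L.smul_mem x.1 b hv
  rwa [smul_smul, toRational, ← map_mul, show b * (X.presheaf.germ U x.1 x.2).hom f = 1 from hb,
    map_one, one_smul] at this

/-- A submodule `N` of `V` over the coordinate ring of an affine open subset `U` that has the
localizations `L x`, for `x ∈ U`. -/
def IsLatticeModel (L : LatticeFamily X V) (U : X.Opens) [Nonempty U] [Module Γ(X, U) V]
    (N : Submodule Γ(X, U) V) : Prop :=
  ∀ (x : U) (v : V), v ∈ L.lattice x ↔ ∃ s : Γ(X, U), x.1 ∈ X.basicOpen s ∧ s • v ∈ N

variable {N : Submodule Γ(X, U) V}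

theorem IsLatticeModel.mem_of_forall (hN : IsLatticeModel L U N) (hU : IsAffineOpen U) {v : V}
    (h : ∀ x : U, v ∈ L.lattice x) : v ∈ N := by
  have : (N.comap (LinearMap.toSpanSingleton Γ(X, U) V v)) = ⊤ := by
    refine hU.ideal_eq_top _ fun x hx => ?_
    obtain ⟨s, hs, hsv⟩ := (hN ⟨x, hx⟩ v).1 (h ⟨x, hx⟩)
    exact ⟨s, 1, hs, by simpa using hsv⟩
  have h1 : (1 : Γ(X, U)) ∈ N.comap (LinearMap.toSpanSingleton Γ(X, U) V v) := this ▸ trivial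
  simpa using h1

theorem IsLatticeModel.mem_lattice (hN : IsLatticeModel L U N) {v : V} (hv : v ∈ N) (x : U) :
    v ∈ L.lattice x :=
  (hN x v).2 ⟨1, by rw [basicOpen_one]; exact x.2, by rwa [one_smul]⟩

theorem IsLatticeModel.finite (hN : IsLatticeModel L U N) (hU : IsAffineOpen U) (hf : N.FG) :
    Module.Finite Γ(X, U) (sec (latticeSheaf L).pval U) := by
  have : Module.Finite Γ(X, U) N := Module.Finite.iff_fg.2 hf
  let φ : N →ₗ[Γ(X, U)] sec (latticeSheaf L).pval U :=
    { toFun := fun v => latMk L U v.1 (hN.mem_lattice v.2)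
      map_add' := fun v w => rfl
      map_smul' := fun f v => latVal_ext fun x => by
        rw [RingHom.id_apply, latVal_smul]; rfl }
  refine Module.Finite.of_surjective φ fun s => ?_
  obtain ⟨x⟩ := ‹Nonempty U›
  exact ⟨⟨latVal s x, hN.mem_of_forall hU (latVal_mem' s x)⟩, latVal_ext fun y => latVal_const s x y⟩

/-- Over a nonempty open subset a section is a single vector v lying in all lattices there. What has
to be shown is that a vector lying in the lattices over `X.basicOpen f` is carried into N by a power
of f. -/
theorem IsLatticeModel.isQCOn (hN : IsLatticeModel L U N) (hU : IsAffineOpen U) :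
    IsQCOn (latticeSheaf L).pval U where
  eq_zero f s hs := by
    by_cases h : f = 0
    · exact ⟨1, by rw [h, pow_one, zero_smul]⟩
    · have : X.basicOpen f ≠ ⊥ := fun h' => h ((basicOpen_eq_bot_iff f).1 h')
      obtain ⟨x, hx⟩ := (Opens.ne_bot_iff_nonempty _).1 this
      -- A constant section that vanishes on a nonempty open subset is zero, so no power of f is
      -- needed.
      refine ⟨0, ?_⟩
      rw [pow_zero, one_smul]
      refine latVal_ext fun y => ?_
      have := congrArg (fun t => latVal t ⟨x, hx⟩) hs
      simp only [latVal_res, latVal_zero] at this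
      rw [latVal_const s y ⟨x, X.basicOpen_le f hx⟩, this, latVal_zero]
  extend f t := by
    by_cases h : f = 0
    · refine ⟨1, 0, ?_⟩
      subst h
      rw [map_zero, pow_one, map_zero, zero_smul]
    · have : X.basicOpen f ≠ ⊥ := fun h' => h ((basicOpen_eq_bot_iff f).1 h')
      obtain ⟨x, hx⟩ := (Opens.ne_bot_iff_nonempty _).1 this
      let v := latVal t ⟨x, hx⟩
      let I := N.comap (LinearMap.toSpanSingleton Γ(X, U) V v)
      -- Otherwise a prime p contains I and avoids the powers of f. At the point y of p the vector v
      -- lies in the lattice, so some s outside p satisfies s • v ∈ N, that is, s ∈ I ⊆ p.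
      have hI : ∃ n, f ^ n ∈ I := by
        by_contra hc
        push Not at hc
        have hd : Disjoint (I : Set Γ(X, U)) (Submonoid.powers f) := by
          rw [Set.disjoint_left]
          rintro _ ha ⟨n, rfl⟩
          exact hc n ha
        obtain ⟨p, hp, hle, hpd⟩ := Ideal.exists_le_prime_disjoint I _ hd
        let y : X := hU.fromSpec ⟨p, hp⟩
        have hy : y ∈ U := hU.opensRange_fromSpec.le ⟨_, rfl⟩
        have hyf : ∀ g : Γ(X, U), y ∈ X.basicOpen g ↔ g ∉ p := by
          intro g
          have : y ∈ X.basicOpen g ↔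
              (⟨p, hp⟩ : PrimeSpectrum Γ(X, U)) ∈ hU.fromSpec ⁻¹ᵁ X.basicOpen g := Iff.rfl
          rw [this, hU.fromSpec_preimage_basicOpen]
          rfl
        have hfy : y ∈ X.basicOpen f := (hyf f).2 fun h =>
          Set.disjoint_left.1 hpd h ⟨1, pow_one f⟩
        obtain ⟨s, hs, hsv⟩ := (hN ⟨y, hy⟩ v).1 (latVal_mem' t ⟨x, hx⟩ ⟨y, hfy⟩)
        exact (hyf s).1 hs (hle (by simpa [I] using hsv))
      obtain ⟨n, hn⟩ := hI
      refine ⟨n, latMk L U (f ^ n • v) (hN.mem_lattice (by simpa [I] using hn)), ?_⟩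
      rw [← map_pow]
      refine latVal_ext fun y => ?_
      rw [latVal_res, latVal_mk]
      change _ = toRational y (rres _ (f ^ n)) • latVal t y
      have e : toRational y (rres (X.basicOpen_le f) (f ^ n)) =
        toRational (⟨y.1, X.basicOpen_le f y.2⟩ : U) (f ^ n) := toRational_map
          (homOfLE (X.basicOpen_le f)) y (f ^ n)
      rw [e, toRational_eq_algebraMap, algebraMap_smul, latVal_const t y ⟨x, hx⟩]

end LatticeSections

/-- An inclusion of families of lattices defines a morphism of sheaves. -/
def latIncl {X : Scheme.{u}} [IsIntegral X] {V : Type u} [AddCommGroup V]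
    [Module X.functionField V] {L L' : LatticeFamily X V} (h : ∀ x, L.lattice x ≤ L'.lattice x) :
    latticeSheaf L ⟶ latticeSheaf L' where
  val :=
    { app := fun U => ModuleCat.ofHom (X := (latticePresheaf L).obj U)
        (Y := (latticePresheaf L').obj U) (R := X.ringCatSheaf.obj.obj U)
        { toFun := fun s => ⟨s.1, s.2.1, fun x => h x.1 (s.2.2 x)⟩
          map_add' := fun _ _ => rfl
          map_smul' := fun _ _ => rfl }
      naturality := fun _ => rfl }

theorem latIncl_surjective {X : Scheme.{u}} [IsIntegral X] {V : Type u} [AddCommGroup V]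
    [Module X.functionField V] {L L' : LatticeFamily X V} (h : ∀ x, L.lattice x ≤ L'.lattice x)
    {U : X.Opens} (h' : ∀ x ∈ U, L'.lattice x ≤ L.lattice x) :
    Function.Surjective (secMap (Modules.pmap (latIncl h)) U) := fun s =>
  ⟨(⟨(show latticeSections L' (op U) from s).1, latVal_const s,
    fun x => h' x.1 x.2 (latVal_mem s x)⟩ : latticeSections L (op U)), rfl⟩

/-! ### The sheaf of logarithmic forms is coherent -/

section LogCotangentSheaf

set_option linter.unusedSectionVars false

variable (k : Type u) [Field k] {X : Scheme.{u}} [X.Over (Spec (.of k))]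

/-- The sections over an open subset of a scheme over `k`, as a `k`-algebra. -/
@[reducible]
def sectionAlgebra (U : X.Opens) : Algebra k Γ(X, U) :=
  (((X ↘ Spec (.of k)).appLE ⊤ U le_top).hom.comp (ΓSpecIso (.of k)).inv.hom).toAlgebra

attribute [local instance] sectionAlgebra

theorem sectionAlgebra_finiteType [LocallyOfFiniteType (X ↘ Spec (.of k))] {U : X.Opens}
    (hU : IsAffineOpen U) : Algebra.FiniteType k Γ(X, U) := by
  have h1 := (X ↘ Spec (.of k)).finiteType_appLE (isAffineOpen_top _) hU le_top
  have h2 : (ΓSpecIso (.of k)).inv.hom.FiniteType := RingHom.FiniteType.of_surjective _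
    (ConcreteCategory.bijective_of_isIso (ΓSpecIso (.of k)).inv).2
  exact h1.comp h2

theorem sectionAlgebra_isScalarTower [IsIntegral X] (U : X.Opens) [Nonempty U] :
    IsScalarTower k Γ(X, U) X.functionField := by
  refine IsScalarTower.of_algebraMap_eq fun c => ?_
  exact (X.presheaf.germ_res_apply (homOfLE (le_top : U ≤ ⊤)) (genericPoint X) _
    ((X ↘ Spec (.of k)).appTop.hom ((ΓSpecIso (.of k)).inv.hom c))).symm

variable {k} [IsIntegral X] (D : EffectiveDivisor X)

/-- The ideal of functions on `U` that vanish on all components of `D` that meet `U`. -/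
def EffectiveDivisor.sectionIdeal (U : X.Opens) : Ideal Γ(X, U) :=
  ⨅ P ∈ D.support, ⨅ h : P.1 ∈ U,
    (IsLocalRing.maximalIdeal (X.presheaf.stalk P.1)).comap (X.presheaf.germ U P.1 h).hom

theorem EffectiveDivisor.mem_sectionIdeal {U : X.Opens} {a : Γ(X, U)} :
    a ∈ D.sectionIdeal U ↔ ∀ P ∈ D.support, P.1 ∉ X.basicOpen a := by
  simp only [sectionIdeal, Submodule.mem_iInf, Ideal.mem_comap]
  refine forall_congr' fun P => forall_congr' fun _ =>
    ⟨fun h hP => ?_, fun h hP => (IsLocalRing.mem_maximalIdeal _).2 fun hu => ?_⟩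
  · exact (IsLocalRing.mem_maximalIdeal _).1 (h (X.basicOpen_le a hP))
      ((X.mem_basicOpen a P.1 _).1 hP)
  · exact h ((X.mem_basicOpen a P.1 hP).2 hu)

theorem mem_basicOpen_of_prod {ι : Type*} {U : X.Opens} (t : Finset ι) (s : ι → Γ(X, U)) {i : ι}
    (hi : i ∈ t) {x : X} (hx : x ∈ X.basicOpen (∏ i ∈ t, s i)) : x ∈ X.basicOpen (s i) := by
  obtain ⟨c, hc⟩ := Finset.dvd_prod_of_mem s hi
  rw [hc, basicOpen_mul] at hx
  exact hx.1

theorem EffectiveDivisor.mem_reducedIdeal {x : X} {r : X.presheaf.stalk x} :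
    r ∈ D.reducedIdeal x ↔ ∀ P ∈ D.support, ∀ h : P.1 ⤳ x,
      ¬ IsUnit ((X.presheaf.stalkSpecializes h).hom r) := by
  simp only [reducedIdeal, Submodule.mem_iInf, Ideal.mem_comap]
  rfl

/-- The local ring at a point of codimension one has a nonzero maximal ideal, which gives a nonzero
function vanishing on that component; the product over the components of D is nonzero and lies in
the ideal. -/
theorem EffectiveDivisor.sectionIdeal_ne_bot {U : X.Opens} (hU : IsAffineOpen U) [Nonempty U] :
    D.sectionIdeal U ≠ ⊥ := by
  have H : ∀ P : PrimeDivisor X, ∃ a : Γ(X, U), a ≠ 0 ∧ P.1 ∉ X.basicOpen a := by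
    intro P
    by_cases hP : P.1 ∈ U
    · let := TopCat.Presheaf.algebra_section_stalk X.presheaf ⟨P.1, hP⟩
      have hm : IsLocalRing.maximalIdeal (X.presheaf.stalk P.1) ≠ ⊥ := by
        intro h
        have := ringKrullDim_eq_zero_of_isField (IsLocalRing.isField_iff_maximalIdeal_eq.2 h)
        rw [P.2] at this
        exact one_ne_zero this
      obtain ⟨r, hr, hr0⟩ := Submodule.exists_mem_ne_zero_of_ne_bot hm
      have hl := hU.isLocalization_stalk ⟨P.1, hP⟩
      obtain ⟨⟨a, m⟩, ha⟩ := IsLocalization.surj (hU.primeIdealOf ⟨P.1, hP⟩).asIdeal.primeCompl r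
      have hmu := IsLocalization.map_units (X.presheaf.stalk P.1) m
      refine ⟨a, ?_, ?_⟩
      · rintro rfl
        dsimp only at ha
        rw [map_zero] at ha
        exact hr0 ((hmu.mul_left_eq_zero).1 ha)
      · rw [X.mem_basicOpen a P.1 hP]
        change ¬ IsUnit (algebraMap Γ(X, U) (X.presheaf.stalk P.1) a)
        rw [← ha]
        exact fun h => hr (isUnit_of_mul_isUnit_left h)
    · exact ⟨1, one_ne_zero, fun h => hP (X.basicOpen_le _ h)⟩
  choose a ha0 ha using H
  exact fun h => (Finset.prod_ne_zero_iff (s := D.support)).2 (fun P _ => ha0 P)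
    ((Submodule.eq_bot_iff _).1 h _ (D.mem_sectionIdeal.2
      fun P hP hc => ha P (mem_basicOpen_of_prod _ _ hP hc)))

theorem EffectiveDivisor.map_sectionIdeal {U : X.Opens} (hU : IsAffineOpen U) (x : U) :
    (D.sectionIdeal U).map (algebraMap Γ(X, U) (X.presheaf.stalk x.1)) = D.reducedIdeal x.1 := by
  refine le_antisymm (Ideal.map_le_iff_le_comap.2 fun a ha => ?_) fun r hr => ?_
  · rw [Ideal.mem_comap, mem_reducedIdeal]
    intro P hP h hu
    have hPU : P.1 ∈ U := h.mem_open U.2 x.2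
    refine D.mem_sectionIdeal.1 ha P hP ((X.mem_basicOpen a P.1 hPU).2 ?_)
    rw [← TopCat.Presheaf.germ_stalkSpecializes (F := X.presheaf) x.2 h]
    exact hu
  -- A germ in the ideal at x need not vanish on components that miss x. Multiplying by functions
  -- that vanish on those components and are units at x repairs this without changing the ideal
  -- generated at x.
  · have H : ∀ P : PrimeDivisor X, ∃ s : Γ(X, U), x.1 ∈ X.basicOpen s ∧
        (¬ P.1 ⤳ x.1 → P.1 ∉ X.basicOpen s) := by
      intro P
      by_cases hP : P.1 ⤳ x.1
      · exact ⟨1, by rw [basicOpen_one]; exact x.2, fun h => (h hP).elim⟩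
      · obtain ⟨s, hs, hxs⟩ := hU.exists_basicOpen_subset
          (W := ⟨(closure {P.1})ᶜ, isClosed_closure.isOpen_compl⟩) x.2
          (fun h => hP (specializes_iff_mem_closure.2 h))
        exact ⟨s, hxs, fun _ h => hs h (subset_closure rfl)⟩
    choose s hxs hs using H
    have hl := hU.isLocalization_stalk x
    obtain ⟨⟨a, m⟩, ha⟩ := IsLocalization.surj (hU.primeIdealOf x).asIdeal.primeCompl r
    have hmu := IsLocalization.map_units (X.presheaf.stalk x.1) m
    dsimp only at ha
    have hsu : IsUnit (algebraMap Γ(X, U) (X.presheaf.stalk x.1) (∏ P ∈ D.support, s P)) := by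
      rw [map_prod, IsUnit.prod_iff]
      exact fun P _ => (X.mem_basicOpen _ x.1 x.2).1 (hxs P)
    rw [← Ideal.mul_unit_mem_iff_mem _ (hmu.mul hsu), ← mul_assoc, ha, ← map_mul]
    refine Ideal.mem_map_of_mem _ (D.mem_sectionIdeal.2 fun P hP hc => ?_)
    have hPU : P.1 ∈ U := X.basicOpen_le _ hc
    rw [basicOpen_mul] at hc
    by_cases hPx : P.1 ⤳ x.1
    · have h1 := (X.mem_basicOpen a P.1 hPU).1 hc.1
      rw [← TopCat.Presheaf.germ_stalkSpecializes (F := X.presheaf) x.2 hPx] at h1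
      change IsUnit ((X.presheaf.stalkSpecializes hPx).hom
        (algebraMap Γ(X, U) (X.presheaf.stalk x.1) a)) at h1
      rw [← ha, map_mul] at h1
      exact D.mem_reducedIdeal.1 hr P hP hPx (isUnit_of_mul_isUnit_left h1)
    · exact hs P hPx (mem_basicOpen_of_prod _ _ hP hc.2)

variable [LocallyOfFiniteType (X ↘ Spec (.of k))]

theorem isLatticeModel_logForms {U : X.Opens} (hU : IsAffineOpen U) [Nonempty U] :
    IsLatticeModel (V := Ω[X.functionField⁄k])
      { lattice := fun x => (KaehlerDifferential.logForms k X.functionField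
          (D.reducedIdeal x)).toAddSubgroup
        smul_mem := fun x a v hv => by
          rw [algebraMap_smul]
          exact Submodule.smul_mem _ a hv } U
      (KaehlerDifferential.logForms k X.functionField (D.sectionIdeal U)) := by
  intro x v
  have := sectionAlgebra_finiteType k hU
  have : IsNoetherianRing Γ(X, U) := Algebra.FiniteType.isNoetherianRing k _
  have hl := hU.isLocalization_stalk x
  constructor
  · intro hv
    change v ∈ KaehlerDifferential.logForms k X.functionField (D.reducedIdeal x.1) at hv
    rw [← D.map_sectionIdeal hU x] at hv
    obtain ⟨s, hs, hsv⟩ := KaehlerDifferential.exists_smul_mem_logForms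
      (hU.primeIdealOf x).asIdeal.primeCompl (IsNoetherian.noetherian _) hv
    refine ⟨s, ?_, hsv⟩
    rw [X.mem_basicOpen s x.1 x.2]
    exact IsLocalization.map_units (X.presheaf.stalk x.1)
      (⟨s, hs⟩ : (hU.primeIdealOf x).asIdeal.primeCompl)
  · rintro ⟨s, hs, hsv⟩
    refine mem_of_smul_mem_lattice x s hs ?_
    have := KaehlerDifferential.mem_logForms_map (S := X.presheaf.stalk x.1) hsv
    rw [D.map_sectionIdeal hU x] at this
    exact this

theorem isQCOn_logCotangentSheaf {U : X.Opens} (hU : IsAffineOpen U) [Nonempty U] :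
    IsQCOn (logCotangentSheaf k D).pval U :=
  (isLatticeModel_logForms D hU).isQCOn hU

theorem finite_logCotangentSheaf {U : X.Opens} (hU : IsAffineOpen U) [Nonempty U] :
    Module.Finite Γ(X, U) (sec (logCotangentSheaf k D).pval U) := by
  have := sectionAlgebra_finiteType k hU
  have := sectionAlgebra_isScalarTower k U
  have : FaithfulSMul Γ(X, U) X.functionField :=
    (faithfulSMul_iff_algebraMap_injective _ _).2 (X.germToFunctionField_injective U)
  exact (isLatticeModel_logForms D hU).finite hU
    (KaehlerDifferential.logForms_fg (D.sectionIdeal_ne_bot hU))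

theorem isCoherent_logCotangentSheaf : (logCotangentSheaf k D).IsCoherent := by
  let U : X → X.Opens := fun x => (exists_isAffineOpen_mem_and_subset
    (U := (⊤ : X.Opens)) (x := x) trivial).choose
  have hU : ∀ x, IsAffineOpen (U x) ∧ x ∈ U x := fun x =>
    ⟨(exists_isAffineOpen_mem_and_subset (U := (⊤ : X.Opens)) (x := x) trivial).choose_spec.1,
      (exists_isAffineOpen_mem_and_subset (U := (⊤ : X.Opens)) (x := x) trivial).choose_spec.2.1⟩
  have hne : ∀ x, Nonempty (U x) := fun x => ⟨⟨x, (hU x).2⟩⟩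
  refine isCoherent_of_isQCOn U (eq_top_iff.2 fun x _ => Opens.mem_iSup.2 ⟨x, (hU x).2⟩)
    (fun x => (hU x).1) (fun x => ?_) (fun x => isQCOn_logCotangentSheaf D (hU x).1)
    (fun x => finite_logCotangentSheaf D (hU x).1)
  have := sectionAlgebra_finiteType k (hU x).1
  exact Algebra.FiniteType.isNoetherianRing k _

end LogCotangentSheaf

end AlgebraicGeometry.Scheme

namespace AlgebraicGeometry.Scheme

/-! ### Finite generation on affine open subsets, and local surjectivity -/

section LocSpan

variable {X Y : Scheme.{u}}

theorem Modules.SectionSet.locSpan_le {M : X.Modules} (S : M.SectionSet) (N : M.LocalSubmodule)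
    {U : X.Opens} (h : ∀ W ≤ U, S.obj W ⊆ N.obj W) : S.locSpan.obj U ≤ N.obj U := by
  intro s hs
  refine N.mem_of_locally s fun x hx => ?_
  obtain ⟨W, hW, hxW, hs⟩ := hs x hx
  exact ⟨W, hW, hxW, Submodule.span_le.2 (h W hW) hs⟩

/-- The restrictions of sections over `U` in `T`. -/
def Modules.sectionsOn (M : X.Modules) (U : X.Opens) (T : Set (sec M.pval U)) : M.SectionSet where
  obj W := {s | ∃ h : W ≤ U, ∃ t ∈ T, s = res M.pval h t}
  res_mem h s hs := by
    obtain ⟨h', t, ht, rfl⟩ := hs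
    exact ⟨h.trans h', t, ht, res_res M.pval _ _ _⟩

theorem Modules.sectionsOn_obj (M : X.Modules) {U W : X.Opens} (h : W ≤ U)
    (T : Set (sec M.pval U)) : (M.sectionsOn U T).obj W = res M.pval h '' T :=
  Set.ext fun _ => ⟨fun ⟨_, t, ht, e⟩ => ⟨t, ht, e.symm⟩, fun ⟨t, ht, e⟩ => ⟨h, t, ht, e.symm⟩⟩

/-- On an affine open subset, sections of a quasi-coherent sheaf over smaller open subsets are
locally linear combinations of generators. -/
theorem IsQCOn.mem_locSpan {M : X.Modules} {U : X.Opens} (hU : IsAffineOpen U)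
    (hM : IsQCOn M.pval U) {T : Set (sec M.pval U)} (hT : Submodule.span Γ(X, U) T = ⊤)
    {W : X.Opens} (hW : W ≤ U) (s : sec M.pval W) : s ∈ (M.sectionsOn U T).locSpan.obj W := by
  intro x hx
  obtain ⟨f, hf, hxf⟩ := hU.exists_basicOpen_subset (hW hx) hx
  refine ⟨X.basicOpen f, hf, hxf, ?_⟩
  obtain ⟨n, t, ht⟩ := hM.extend f (res M.pval hf s)
  have hu := (isUnit_rres_basicOpen f (X.basicOpen_le f) le_rfl).pow n
  rw [← Submodule.smul_mem_iff_of_isUnit _ hu, ← ht, M.sectionsOn_obj (X.basicOpen_le f)]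
  have ht' : t ∈ Submodule.span Γ(X, U) T := hT ▸ trivial
  exact res_mem_span _ (fun s hs => Submodule.subset_span (Set.mem_image_of_mem _ hs)) ht'

/-- A sheaf of modules is locally generated by finitely many sections. -/
def Modules.IsLocallyFinite (M : X.Modules) : Prop :=
  ∀ x : X, ∃ (U : X.Opens) (_ : x ∈ U) (T : Set (sec M.pval U)) (_ : T.Finite),
    ∀ (W : X.Opens) (_ : W ≤ U) (s : sec M.pval W), s ∈ (M.sectionsOn U T).locSpan.obj W

/-- By compactness of U, finitely many sections over U generate near every point of U; on an affine
open subset such sections generate the module. -/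
theorem Modules.IsLocallyFinite.finite {M : X.Modules} (hM : M.IsLocallyFinite) {U : X.Opens}
    (hU : IsAffineOpen U) (hq : IsQCOn M.pval U) : Module.Finite Γ(X, U) (sec M.pval U) := by
  suffices H : ∃ T : Set (sec M.pval U), T.Finite ∧ ∀ x ∈ (U : Set X),
      ∃ (V : X.Opens) (_ : x ∈ V) (hV : V ≤ U), ∀ (W : X.Opens) (hW : W ≤ V) (s : sec M.pval W),
        s ∈ (M.sectionsOn U T).locSpan.obj W by
    obtain ⟨T, hT, h⟩ := H
    refine ⟨(Submodule.fg_def (R := Γ(X, U)) (M := sec M.pval U)).2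
      ⟨T, hT, eq_top_iff.2 fun s _ => ?_⟩⟩
    refine mem_of_locally_mem_span hU hq _ s fun x hx => ?_
    obtain ⟨V, hxV, hV, h⟩ := h x hx
    obtain ⟨W, hW, hxW, hs⟩ := h V le_rfl (res M.pval hV s) x hxV
    refine ⟨W, hW.trans hV, hxW, ?_⟩
    rw [M.sectionsOn_obj (hW.trans hV), res_res] at hs
    exact Submodule.span_mono (Set.image_mono Submodule.subset_span) hs
  refine hU.isCompact.induction_on (p := fun S => ∃ T : Set (sec M.pval U), T.Finite ∧ ∀ x ∈ S,
      ∃ (V : X.Opens) (_ : x ∈ V) (hV : V ≤ U), ∀ (W : X.Opens) (hW : W ≤ V) (s : sec M.pval W),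
        s ∈ (M.sectionsOn U T).locSpan.obj W) ?_ ?_ ?_ ?_
  · exact ⟨∅, Set.finite_empty, fun x hx => hx.elim⟩
  · rintro S S' h ⟨T, hT, h'⟩
    exact ⟨T, hT, fun x hx => h' x (h hx)⟩
  · rintro S S' ⟨T, hT, h⟩ ⟨T', hT', h'⟩
    refine ⟨T ∪ T', hT.union hT', ?_⟩
    have key : ∀ (T₁ T₂ : Set (sec M.pval U)) (_ : T₁ ⊆ T₂) (W : X.Opens),
        (M.sectionsOn U T₁).locSpan.obj W ≤ (M.sectionsOn U T₂).locSpan.obj W := by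
      intro T₁ T₂ hTT W
      refine Modules.SectionSet.locSpan_le _ _ fun W' _ => ?_
      rintro _ ⟨hW', t, ht, rfl⟩
      exact Modules.SectionSet.subset_locSpan _ ⟨hW', t, hTT ht, rfl⟩
    rintro x (hx | hx)
    · obtain ⟨V, hxV, hV, h⟩ := h x hx
      exact ⟨V, hxV, hV, fun W hW s => key T _ Set.subset_union_left W (h W hW s)⟩
    · obtain ⟨V, hxV, hV, h⟩ := h' x hx
      exact ⟨V, hxV, hV, fun W hW s => key T' _ Set.subset_union_right W (h W hW s)⟩
  · intro x hx
    obtain ⟨V, hxV, T, hT, h⟩ := hM x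
    obtain ⟨f, hf, hxf⟩ := hU.exists_basicOpen_subset hx hxV
    -- Multiplied by powers of f, the local generators extend to U. As f is invertible on its basic
    -- open subset, the extensions still generate there.
    choose n t ht using fun s : sec M.pval V => hq.extend f (res M.pval hf s)
    refine ⟨X.basicOpen f, mem_nhdsWithin_of_mem_nhds ((X.basicOpen f).2.mem_nhds hxf),
      t '' T, hT.image _, fun y hy => ⟨X.basicOpen f, hy, X.basicOpen_le f, fun W hW s => ?_⟩⟩
    refine Modules.SectionSet.locSpan_le _ _ (fun W' hW' => ?_) (h W (hW.trans hf) s)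
    rintro _ ⟨hV', s, hs, rfl⟩
    have hu := (isUnit_rres_basicOpen f ((hW'.trans hW).trans (X.basicOpen_le f))
      (hW'.trans hW)).pow (n s)
    rw [SetLike.mem_coe, ← Submodule.smul_mem_iff_of_isUnit _ hu]
    refine Modules.SectionSet.subset_locSpan _ ⟨(hW'.trans hW).trans (X.basicOpen_le f), t s,
      ⟨s, hs, rfl⟩, ?_⟩
    rw [← res_res M.pval (X.basicOpen_le f) (hW'.trans hW), ht, res_smul, res_res, map_pow,
      rres_rres]

/-- The sections that belong locally to the image of a morphism of sheaves. -/
def Modules.locRange {M N : X.Modules} (φ : M ⟶ N) : N.LocalSubmodule :=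
  Modules.SectionSet.locSpan
    { obj := fun U => Set.range (secMap (Modules.pmap φ) U)
      res_mem := by
        rintro U V h _ ⟨s, rfl⟩
        exact ⟨res M.pval h s, (res_secMap _ _ _).symm⟩ }

/-- Quasi-coherence of N makes membership in the image a local question, and quasi-coherence of M
extends local preimages, up to powers of f, to U. -/
theorem Modules.secMap_surjective_of_locRange {M N : X.Modules} (φ : M ⟶ N) {U : X.Opens}
    (hU : IsAffineOpen U) (hM : IsQCOn M.pval U) (hN : IsQCOn N.pval U)
    (h : ∀ s, s ∈ (Modules.locRange φ).obj U) :
    Function.Surjective (secMap (Modules.pmap φ) U) := by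
  intro s
  refine mem_of_locally_mem_span hU hN (LinearMap.range (secMap (Modules.pmap φ) U)) s
    fun x hx => ?_
  obtain ⟨W, hW, hxW, hs⟩ := h s x hx
  obtain ⟨f, hf, hxf⟩ := hU.exists_basicOpen_subset hx hxW
  refine ⟨X.basicOpen f, X.basicOpen_le f, hxf, ?_⟩
  rw [← res_res N.pval hW hf]
  refine res_mem_span hf ?_ hs
  rintro _ ⟨e, rfl⟩
  obtain ⟨n, e', he'⟩ := hM.extend f (res M.pval hf e)
  have hu := (isUnit_rres_basicOpen f (X.basicOpen_le f) le_rfl).pow n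
  rw [← Submodule.smul_mem_iff_of_isUnit _ hu, res_secMap, ← LinearMap.map_smul, ← he', ← res_secMap]
  exact Submodule.subset_span ⟨_, ⟨e', rfl⟩, rfl⟩

variable (γ : Y ⟶ X)

theorem pullSec_zero (M : X.Modules) (W : X.Opens) : pullSec γ M W 0 = 0 :=
  map_zero (secMap (Modules.pmap ((Modules.pullbackPushforwardAdjunction γ).unit.app M)) W)

theorem pullSec_add (M : X.Modules) (W : X.Opens) (m m' : sec M.pval W) :
    pullSec γ M W (m + m') = pullSec γ M W m + pullSec γ M W m' :=
  map_add (secMap (Modules.pmap ((Modules.pullbackPushforwardAdjunction γ).unit.app M)) W) m m'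

theorem pullSec_smul (M : X.Modules) (W : X.Opens) (r : Γ(X, W)) (m : sec M.pval W) :
    pullSec γ M W (r • m) = (show Γ(Y, γ ⁻¹ᵁ W) from (γ.app W).hom r) • pullSec γ M W m :=
  (secMap (Modules.pmap ((Modules.pullbackPushforwardAdjunction γ).unit.app M)) W).map_smul r m

/-- The pullback of N is locally generated by pulled back sections, and over V these lift to pulled
back sections of M. -/
theorem mem_locRange_pullback_map {M N : X.Modules} (φ : M ⟶ N) {V : X.Opens}
    (h : ∀ W ≤ V, Function.Surjective (secMap (Modules.pmap φ) W)) {U : Y.Opens}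
    (hU : U ≤ γ ⁻¹ᵁ V) (s : sec ((Modules.pullback γ).obj N).pval U) :
    s ∈ (Modules.locRange ((Modules.pullback γ).map φ)).obj U := by
  refine Modules.SectionSet.locSpan_le _ _ (fun W hW => ?_)
    (mem_locSpan_pullSections γ N (B := Set.univ) (Opens.isBasis_iff_nbhd.2
      fun {U x} hx => ⟨U, trivial, hx, le_rfl⟩) s)
  rintro _ ⟨W', -, hW', m, rfl⟩
  refine Modules.SectionSet.subset_locSpan _ ?_
  obtain ⟨m', hm'⟩ := h (W' ⊓ V) inf_le_right (res N.pval inf_le_left m)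
  have hle : W ≤ γ ⁻¹ᵁ (W' ⊓ V) := le_inf hW' (hW.trans hU)
  refine ⟨res _ hle (pullSec γ M (W' ⊓ V) m'), ?_⟩
  rw [← res_secMap, pullSec_map, hm', ← res_pullSec γ N inf_le_left, res_res]

theorem isLocallyFinite_pullback {M : X.Modules} (hM : QC M.pval)
    (hf : ∀ U : X.Opens, IsAffineOpen U → Module.Finite Γ(X, U) (sec M.pval U)) :
    ((Modules.pullback γ).obj M).IsLocallyFinite := by
  intro y
  obtain ⟨V, hV, hyV, -⟩ := exists_isAffineOpen_mem_and_subset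
    (U := (⊤ : X.Opens)) (x := γ y) trivial
  obtain ⟨T, hT, hspan⟩ := Submodule.fg_def.1 (hf V hV).fg_top
  refine ⟨γ ⁻¹ᵁ V, hyV, pullSec γ M V '' T, hT.image _, fun W hW s => ?_⟩
  refine Modules.SectionSet.locSpan_le _ _ (fun W' hWW => ?_)
    (mem_locSpan_pullSections γ M (B := Set.univ) (Opens.isBasis_iff_nbhd.2
      fun {U x} hx => ⟨U, trivial, hx, le_rfl⟩) s)
  rintro _ ⟨A, -, hA, m, rfl⟩
  intro z hz
  obtain ⟨B, hB, hzB, hm⟩ := (hM V hV).mem_locSpan hV hspan (W := A ⊓ V) inf_le_right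
    (res M.pval inf_le_left m) (γ z) ⟨hA hz, hW (hWW hz)⟩
  rw [M.sectionsOn_obj (hB.trans inf_le_right), res_res] at hm
  refine ⟨W' ⊓ γ ⁻¹ᵁ B, inf_le_left, ⟨hz, hzB⟩, ?_⟩
  have e : res ((Modules.pullback γ).obj M).pval (inf_le_left : W' ⊓ γ ⁻¹ᵁ B ≤ W')
      (res ((Modules.pullback γ).obj M).pval hA (pullSec γ M A m)) =
      res ((Modules.pullback γ).obj M).pval (inf_le_right : W' ⊓ γ ⁻¹ᵁ B ≤ γ ⁻¹ᵁ B)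
        (pullSec γ M B (res M.pval (hB.trans inf_le_left) m)) := by
    rw [← res_pullSec γ M (hB.trans inf_le_left), res_res, res_res]
  rw [e, Modules.sectionsOn_obj _ ((inf_le_left.trans hWW).trans hW)]
  generalize res M.pval (hB.trans inf_le_left) m = m' at hm
  induction hm using Submodule.span_induction with
  | mem m hm =>
    obtain ⟨t, ht, rfl⟩ := hm
    refine Submodule.subset_span ⟨_, ⟨t, ht, rfl⟩, ?_⟩
    rw [← res_pullSec γ M (hB.trans inf_le_right), res_res]
  | zero => rw [pullSec_zero, map_zero]; exact zero_mem _
  | add m m' _ _ h h' => rw [pullSec_add, map_add]; exact add_mem h h'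
  | smul r m _ h =>
    rw [pullSec_smul, res_smul]
    exact Submodule.smul_mem _ _ h

end LocSpan

end AlgebraicGeometry.Scheme

/-! ### Local rings of smooth curves -/

/-- B is étale over a polynomial ring in one variable over a field, a principal ideal ring; since it
is unramified, the maximal ideal at q is extended from the localization at the prime below. -/
theorem RingHom.IsStandardSmoothOfRelativeDimension.isPrincipal_maximalIdeal {A B : Type u}
    [CommRing A] [CommRing B] {f : A →+* B} (hf : f.IsStandardSmoothOfRelativeDimension 1)
    (hA : IsField A) (q : Ideal B) [q.IsPrime] :
    (IsLocalRing.maximalIdeal (Localization.AtPrime q)).IsPrincipal := by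
  obtain ⟨g, -, hg⟩ := hf.exists_etale_mvPolynomial
  let := hA.toField
  have : IsPrincipalIdealRing (MvPolynomial (Fin 1) A) := IsPrincipalIdealRing.of_surjective
    (MvPolynomial.uniqueAlgEquiv A (Fin 1)).symm (MvPolynomial.uniqueAlgEquiv A (Fin 1)).symm.surjective
  algebraize [g]
  let p := q.comap (algebraMap (MvPolynomial (Fin 1) A) B)
  have : q.LiesOver p := ⟨rfl⟩
  let : Algebra (Localization.AtPrime p) (Localization.AtPrime q) :=
    (Localization.localRingHom p q (algebraMap _ B) rfl).toAlgebra
  have : Localization.AtPrime.IsLiesOverAlgebra p q := ⟨rfl⟩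
  have : Algebra.IsUnramifiedAt (MvPolynomial (Fin 1) A) q := inferInstance
  rw [← ((Algebra.isUnramifiedAt_iff_map_eq (MvPolynomial (Fin 1) A) p q).1 this).2]
  infer_instance

namespace AlgebraicGeometry.Scheme

section Curve

variable (k : Type u) [Field k] {C : Scheme.{u}}

theorem isPrincipal_maximalIdeal_stalk [C.Over (Spec (.of k))]
    [SmoothOfRelativeDimension 1 (C ↘ Spec (.of k))] (x : C) :
    (IsLocalRing.maximalIdeal (C.presheaf.stalk x)).IsPrincipal := by
  obtain ⟨U, hU, V, hV, hxV, e, hf⟩ :=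
    SmoothOfRelativeDimension.exists_isStandardSmoothOfRelativeDimension
      (n := 1) (f := C ↘ Spec (.of k)) x
  have hUtop : U = ⊤ := by
    refine eq_top_iff.2 fun y _ => ?_
    rw [Subsingleton.elim y ((C ↘ Spec (.of k)) x)]
    exact e hxV
  subst hUtop
  have hA : IsField Γ(Spec (.of k), ⊤) :=
    MulEquiv.isField (Field.toIsField k) (ΓSpecIso (.of k)).commRingCatIsoToRingEquiv.toMulEquiv
  have := hf.isPrincipal_maximalIdeal hA (hV.primeIdealOf ⟨x, hxV⟩).asIdeal
  let := TopCat.Presheaf.algebra_section_stalk C.presheaf ⟨x, hxV⟩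
  have hl := hV.isLocalization_stalk ⟨x, hxV⟩
  let ε : _ →+* _ := (IsLocalization.algEquiv (hV.primeIdealOf ⟨x, hxV⟩).asIdeal.primeCompl
    (Localization.AtPrime (hV.primeIdealOf ⟨x, hxV⟩).asIdeal) (C.presheaf.stalk x)).toRingEquiv.toRingHom
  have hε : Function.Bijective ε := (IsLocalization.algEquiv
    (hV.primeIdealOf ⟨x, hxV⟩).asIdeal.primeCompl
    (Localization.AtPrime (hV.primeIdealOf ⟨x, hxV⟩).asIdeal) (C.presheaf.stalk x)).bijective
  have h2 : (IsLocalRing.maximalIdeal (Localization.AtPrime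
      (hV.primeIdealOf ⟨x, hxV⟩).asIdeal)).map ε =
      IsLocalRing.maximalIdeal (C.presheaf.stalk x) := by
    exact IsLocalRing.eq_maximalIdeal (Ideal.map_isMaximal_of_equiv (RingEquiv.ofBijective ε hε))
  rw [← h2]
  infer_instance

theorem isLocallyNoetherian_of_over [C.Over (Spec (.of k))]
    [LocallyOfFiniteType (C ↘ Spec (.of k))] :
    IsLocallyNoetherian C :=
  have : IsNoetherianRing (CommRingCat.of k) := inferInstanceAs (IsNoetherianRing k)
  LocallyOfFiniteType.isLocallyNoetherian (C ↘ Spec (.of k))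

variable [IsIntegral C]

theorem isPrincipalIdealRing_stalk [C.Over (Spec (.of k))]
    [SmoothOfRelativeDimension 1 (C ↘ Spec (.of k))] (x : C) : IsPrincipalIdealRing (C.presheaf.stalk x) := by
  have : Smooth (C ↘ Spec (.of k)) := SmoothOfRelativeDimension.smooth 1 _
  have := isLocallyNoetherian_of_over k (C := C)
  exact ((tfae_of_isNoetherianRing_of_isLocalRing_of_isDomain (C.presheaf.stalk x)).out 0 4).2
    (isPrincipal_maximalIdeal_stalk k x)

theorem valuationRing_stalk [C.Over (Spec (.of k))]
    [SmoothOfRelativeDimension 1 (C ↘ Spec (.of k))] (x : C) : ValuationRing (C.presheaf.stalk x) :=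
  have := isPrincipalIdealRing_stalk k x
  inferInstance

/-- The points specializing to x are the primes of the local ring at x, a principal ideal domain:
only zero and the maximal ideal occur. -/
theorem eq_or_eq_genericPoint [C.Over (Spec (.of k))]
    [SmoothOfRelativeDimension 1 (C ↘ Spec (.of k))] {x y : C} (h : y ⤳ x) : y = x ∨ y = genericPoint C := by
  have := isPrincipalIdealRing_stalk k x
  have key : ∀ z : C, z ⤳ x → z = x ∨
      z = C.fromSpecStalk x (⟨⊥, Ideal.isPrime_bot⟩ : PrimeSpectrum (C.presheaf.stalk x)) := by
    intro z hz
    obtain ⟨p, rfl⟩ : z ∈ Set.range (C.fromSpecStalk x) := by rw [range_fromSpecStalk]; exact hz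
    by_cases hp : p.asIdeal = ⊥
    · right
      congr 1
      exact PrimeSpectrum.ext hp
    · left
      have := p.2
      have h1 := IsLocalRing.eq_maximalIdeal (IsPrime.to_maximal_ideal hp)
      rw [show p = IsLocalRing.closedPoint _ from PrimeSpectrum.ext h1]
      exact fromSpecStalk_closedPoint
  rcases key y h with h1 | h1
  · exact .inl h1
  · rcases key (genericPoint C) ((genericPoint_spec C).specializes trivial) with h2 | h2
    · right
      rw [← h2] at h
      refine (h.antisymm ((genericPoint_spec C).specializes trivial)).eq
    · exact .inr (h1.trans h2.symm)

theorem isClosed_singleton_of_ne_genericPoint [C.Over (Spec (.of k))]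
    [SmoothOfRelativeDimension 1 (C ↘ Spec (.of k))] {x : C} (hx : x ≠ genericPoint C) :
    IsClosed ({x} : Set C) := by
  rw [← closure_subset_iff_isClosed]
  intro z hz
  rcases eq_or_eq_genericPoint k (specializes_iff_mem_closure.2 hz) with h | h
  · exact h.symm
  · exact (hx h).elim

theorem finite_of_isClosed [C.Over (Spec (.of k))]
    [SmoothOfRelativeDimension 1 (C ↘ Spec (.of k))] [QuasiCompact (C ↘ Spec (.of k))] {Z : Set C} (hZ : IsClosed Z)
    (h : genericPoint C ∉ Z) : Z.Finite := by
  have : Smooth (C ↘ Spec (.of k)) := SmoothOfRelativeDimension.smooth 1 _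
  have := isLocallyNoetherian_of_over k (C := C)
  have : CompactSpace C := QuasiCompact.compactSpace_of_compactSpace (C ↘ Spec (.of k))
  have : IsNoetherian C := {}
  obtain ⟨S, hS, hcl, hirr, hsup⟩ :=
    NoetherianSpace.exists_finite_set_isClosed_irreducible hZ
  have hle : ∀ t ∈ S, t ⊆ Z := fun t ht => hsup ▸ Set.subset_sUnion_of_mem ht
  rw [hsup]
  refine hS.sUnion fun t ht => ?_
  obtain ⟨z, hz⟩ := QuasiSober.sober (hirr t ht) (hcl t ht)
  have hz' : z ≠ genericPoint C := fun e => h (hle t ht (e ▸ hz.mem))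
  have : t = {z} := by
    rw [← hz.def, (isClosed_singleton_of_ne_genericPoint k hz').closure_eq]
  rw [this]
  exact Set.finite_singleton z

/-! ### Rational functions on curves -/

/-- The points where a rational function is regular. -/
def regularLocus (f : C.functionField) : C.Opens where
  carrier := {x | ∃ r : C.presheaf.stalk x, algebraMap _ C.functionField r = f}
  is_open' := by
    rw [isOpen_iff_mem_nhds]
    rintro x ⟨r, rfl⟩
    obtain ⟨U, hx, s, rfl⟩ := C.presheaf.exists_germ_eq r
    refine Filter.mem_of_superset (U.2.mem_nhds hx) fun y hy => ?_
    exact ⟨C.presheaf.germ U y hy s, toRational_eq ⟨y, hy⟩ ⟨x, hx⟩ s⟩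

theorem genericPoint_mem_regularLocus (f : C.functionField) : genericPoint C ∈ regularLocus f :=
  ⟨f, by
    change (C.presheaf.stalkSpecializes _).hom f = f
    rw [TopCat.Presheaf.stalkSpecializes_refl]
    rfl⟩

instance (f : C.functionField) : Nonempty (regularLocus f) :=
  ⟨⟨_, genericPoint_mem_regularLocus f⟩⟩

theorem exists_regularSection (f : C.functionField) :
    ∃ s : Γ(C, regularLocus f), algebraMap _ C.functionField s = f := by
  have H : ∀ x : regularLocus f, ∃ (U : C.Opens) (_ : U ≤ regularLocus f) (_ : x.1 ∈ U)
      (s : Γ(C, U)), ∀ y : U, toRational y s = f := by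
    rintro ⟨x, r, hr⟩
    obtain ⟨U, hx, s, rfl⟩ := C.presheaf.exists_germ_eq r
    have h : ∀ y : U, toRational y s = f := fun y => (toRational_eq y ⟨x, hx⟩ s).trans hr
    exact ⟨U, fun y hy => ⟨_, h ⟨y, hy⟩⟩, hx, s, h⟩
  choose U hU hxU s hs using H
  obtain ⟨t, ht, -⟩ := C.sheaf.existsUnique_gluing' U (regularLocus f)
    (fun x => homOfLE (hU x)) (fun x hx => Opens.mem_iSup.2 ⟨⟨x, hx⟩, hxU ⟨x, hx⟩⟩) s (by
      intro x y
      by_cases h : Nonempty (U x ⊓ U y : C.Opens)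
      · obtain ⟨z⟩ := h
        apply germ_injective_of_isIntegral C z.1 z.2
        apply IsFractionRing.injective (C.presheaf.stalk z.1) C.functionField
        exact (toRational_map (Opens.infLELeft _ _) z (s x)).trans ((hs x _).trans
          ((hs y _).symm.trans (toRational_map (Opens.infLERight _ _) z (s y)).symm))
      · have : (U x ⊓ U y : C.Opens) = ⊥ := by
          rw [← not_ne_iff, Opens.ne_bot_iff_nonempty]
          exact fun ⟨z, hz⟩ => h ⟨⟨z, hz⟩⟩
        have : Subsingleton Γ(C, U x ⊓ U y) := by
          rw [this]; infer_instance
        exact Subsingleton.elim (α := Γ(C, U x ⊓ U y)) _ _)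
  change Γ(C, regularLocus f) at t
  refine ⟨t, ?_⟩
  let x : regularLocus f := ⟨_, genericPoint_mem_regularLocus f⟩
  rw [← toRational_eq_algebraMap x]
  have h := toRational_map (homOfLE (hU x)) ⟨x.1, hxU x⟩ t
  exact h.symm.trans ((congrArg (toRational _) (ht x)).trans (hs x ⟨x.1, hxU x⟩))

theorem regularLocus_sup_inv [C.Over (Spec (.of k))]
    [SmoothOfRelativeDimension 1 (C ↘ Spec (.of k))] (f : C.functionField) : regularLocus f ⊔ regularLocus f⁻¹ = ⊤ := by
  refine eq_top_iff.2 fun x _ => ?_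
  have := valuationRing_stalk k x
  exact ValuationRing.isInteger_or_isInteger (C.presheaf.stalk x) f

end Curve

end AlgebraicGeometry.Scheme

namespace AlgebraicGeometry.Scheme

/-! ### Poles of rational functions -/

section Poles

variable {C : Scheme.{u}} [IsIntegral C]

theorem algebraMap_mem_regularLocus {k : Type u} [Field k] [C.Over (Spec (.of k))] (c : k) (x : C) :
    x ∈ regularLocus (algebraMap k C.functionField c) :=
  ⟨C.presheaf.germ ⊤ x trivial ((C ↘ Spec (.of k)).appTop ((ΓSpecIso (.of k)).inv c)),
    toRational_eq (U := ⊤) ⟨x, trivial⟩ ⟨genericPoint C, trivial⟩ _ |>.trans (by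
      change (C.presheaf.stalkSpecializes _).hom _ = _
      rw [TopCat.Presheaf.stalkSpecializes_refl]
      rfl)⟩

theorem sub_mem_regularLocus {f g : C.functionField} {x : C} (hf : x ∈ regularLocus f)
    (hg : x ∈ regularLocus g) : x ∈ regularLocus (f - g) := by
  obtain ⟨a, rfl⟩ := hf
  obtain ⟨b, rfl⟩ := hg
  exact ⟨a - b, map_sub _ _ _⟩

theorem pow_mem_regularLocus {f : C.functionField} {x : C} (hf : x ∈ regularLocus f) (n : ℕ) :
    x ∈ regularLocus (f ^ n) := by
  obtain ⟨a, rfl⟩ := hf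
  exact ⟨a ^ n, map_pow _ _ _⟩

variable (k : Type u) [Field k]

/-- A rational function with a pole at `x` is the inverse of a function that vanishes at `x`. -/
theorem exists_mem_maximalIdeal_of_notMem_regularLocus [C.Over (Spec (.of k))]
    [SmoothOfRelativeDimension 1 (C ↘ Spec (.of k))] {f : C.functionField} {x : C}
    (hf : x ∉ regularLocus f) : ∃ r ∈ IsLocalRing.maximalIdeal (C.presheaf.stalk x),
      algebraMap _ C.functionField r = f⁻¹ := by
  have : x ∈ regularLocus f ⊔ regularLocus f⁻¹ := regularLocus_sup_inv k f ▸ trivial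
  obtain ⟨r, hr⟩ := this.resolve_left hf
  refine ⟨r, fun hu => hf ?_, hr⟩
  obtain ⟨b, hb⟩ := (show IsUnit r from hu).exists_right_inv
  refine ⟨b, ?_⟩
  rw [← inv_inv f, ← hr]
  refine eq_inv_of_mul_eq_one_right ?_
  rw [← map_mul, hb, map_one]

/-- For large n the pole of fⁿ outweighs that of t. With r = 1/f and t = a/b, regularity of fⁿ + t =
c gives b = rⁿ(c b − a), so b lies in the n-th power of the maximal ideal, which for large n
contradicts Krull's intersection theorem. -/
theorem exists_notMem_regularLocus_pow_add [C.Over (Spec (.of k))]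
    [SmoothOfRelativeDimension 1 (C ↘ Spec (.of k))] {f : C.functionField} (t : C.functionField)
    {x : C} (hf : x ∉ regularLocus f) :
    ∃ N, ∀ n ≥ N, x ∉ regularLocus (f ^ n + t) := by
  obtain ⟨r, hr, hrf⟩ := exists_mem_maximalIdeal_of_notMem_regularLocus k hf
  have := isPrincipalIdealRing_stalk k x
  have hf0 : f ≠ 0 := by
    rintro rfl
    exact hf ⟨0, map_zero _⟩
  obtain ⟨a, b, hb, hab⟩ := IsFractionRing.div_surjective (A := C.presheaf.stalk x) t
  have hb0 : b ≠ 0 := nonZeroDivisors.ne_zero hb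
  have hb1 : algebraMap _ C.functionField b ≠ 0 :=
    (map_ne_zero_iff _ (IsFractionRing.injective (C.presheaf.stalk x) C.functionField)).2 hb0
  have hN : ∃ N, b ∉ IsLocalRing.maximalIdeal (C.presheaf.stalk x) ^ N := by
    by_contra! h
    have := Ideal.iInf_pow_eq_bot_of_isLocalRing
      (IsLocalRing.maximalIdeal (C.presheaf.stalk x)) (IsLocalRing.maximalIdeal.isMaximal _).ne_top
    exact hb0 ((Submodule.mem_bot _).1 (this ▸ (Submodule.mem_iInf _).2 h))
  obtain ⟨N, hN⟩ := hN
  refine ⟨N, fun n hn hx => hN (Ideal.pow_le_pow_right hn ?_)⟩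
  obtain ⟨c, hc⟩ := hx
  have e : b = r ^ n * (c * b - a) := by
    apply IsFractionRing.injective (C.presheaf.stalk x) C.functionField
    rw [map_mul, map_sub, map_mul, map_pow, hrf, hc, ← hab]
    rw [inv_pow]
    have := pow_ne_zero n hf0
    field_simp
    ring
  rw [e]
  exact Ideal.mul_mem_right _ _ (Ideal.pow_mem_pow hr n)

theorem exists_notMem_regularLocus [C.Over (Spec (.of k))]
    [SmoothOfRelativeDimension 1 (C ↘ Spec (.of k))] {x : C} (hx : x ≠ genericPoint C) :
    ∃ f : C.functionField, x ∉ regularLocus f := by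
  by_contra! h
  have hfield : ∀ r ∈ IsLocalRing.maximalIdeal (C.presheaf.stalk x), r = 0 := by
    intro r hr
    by_contra hr0
    obtain ⟨c, hc⟩ := h (algebraMap _ C.functionField r)⁻¹
    have hr1 : algebraMap _ C.functionField r ≠ 0 :=
      (map_ne_zero_iff _ (IsFractionRing.injective (C.presheaf.stalk x) C.functionField)).2 hr0
    have : c * r = 1 := by
      apply IsFractionRing.injective (C.presheaf.stalk x) C.functionField
      rw [map_mul, hc, map_one, inv_mul_cancel₀ hr1]
    exact hr (IsUnit.of_mul_eq_one_right c this)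
  have hg : genericPoint C ∈ Set.range (C.fromSpecStalk x) := by
    rw [range_fromSpecStalk]
    exact (genericPoint_spec C).specializes trivial
  obtain ⟨p, hp⟩ := hg
  have : p = IsLocalRing.closedPoint _ := PrimeSpectrum.ext (le_antisymm
    (IsLocalRing.le_maximalIdeal p.2.ne_top) fun r hr => by
      rw [hfield r hr]; exact zero_mem _)
  rw [this, fromSpecStalk_closedPoint] at hp
  exact hx hp

/-- There is a rational function on a smooth curve with poles at any given closed points. -/
theorem exists_forall_notMem_regularLocus [C.Over (Spec (.of k))]
    [SmoothOfRelativeDimension 1 (C ↘ Spec (.of k))] {S : Set C} (hS : S.Finite)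
    (h : genericPoint C ∉ S) : ∃ f : C.functionField, ∀ x ∈ S, x ∉ regularLocus f := by
  induction S, hS using Set.Finite.induction_on with
  | empty => exact ⟨0, fun x hx => hx.elim⟩
  | @insert s S hs hS ih =>
    obtain ⟨f, hf⟩ := ih fun h' => h (Set.mem_insert_of_mem _ h')
    by_cases hfs : s ∈ regularLocus f
    -- Here f is regular at s. Then f ^ N + t keeps the pole of t at s, and for large N it keeps the
    -- poles of f ^ N at the points of S.
    · obtain ⟨t, ht⟩ := exists_notMem_regularLocus k (x := s) fun e => h (e ▸ Set.mem_insert _ _)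
      have : ∃ N, ∀ n ≥ N, ∀ x ∈ S, x ∉ regularLocus (f ^ n + t) := by
        choose! N hN using fun x (hx : x ∈ S) => exists_notMem_regularLocus_pow_add k t (hf x hx)
        obtain ⟨M, hM⟩ := (hS.image N).bddAbove
        exact ⟨M, fun n hn x hx => hN x hx n ((hM ⟨x, hx, rfl⟩).trans hn)⟩
      obtain ⟨N, hN⟩ := this
      refine ⟨f ^ N + t, ?_⟩
      rintro x (rfl | hx)
      · intro hc
        have := sub_mem_regularLocus hc (pow_mem_regularLocus hfs N)
        rw [add_sub_cancel_left] at this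
        exact ht this
      · exact hN N le_rfl x hx
    · refine ⟨f, ?_⟩
      rintro x (rfl | hx)
      exacts [hfs, hf x hx]

end Poles

/-! ### Rational functions as finite morphisms to the affine line -/

section AffineLine

theorem appTop_appLE {T Y Z : Scheme.{u}} (i : T ⟶ Y) (f : Y ⟶ Z) {V : Z.Opens}
    (h : ⊤ ≤ f ⁻¹ᵁ V) (h' : ⊤ ≤ (i ≫ f) ⁻¹ᵁ V) (s : Γ(Z, V)) :
    i.appTop (f.appLE V ⊤ h s) = (i ≫ f).appLE V ⊤ h' s := by
  have hle : (⊤ : T.Opens) ≤ i ⁻¹ᵁ ⊤ := le_rfl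
  have h1 : i.appTop = i.appLE ⊤ ⊤ hle := (Hom.appLE_eq_app i).symm
  rw [h1, ← CommRingCat.comp_apply, Hom.appLE_comp_appLE]

theorem appLE_rres {Y Z : Scheme.{u}} (f : Y ⟶ Z) {V V' : Z.Opens} (h : V' ≤ V) {W : Y.Opens}
    (e : W ≤ f ⁻¹ᵁ V') (e' : W ≤ f ⁻¹ᵁ V) (s : Γ(Z, V)) :
    f.appLE V' W e (rres h s) = f.appLE V W e' s :=
  ConcreteCategory.congr_hom (Hom.map_appLE f e (homOfLE h).op) s

attribute [local instance] sectionAlgebra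

variable {k : Type u} [Field k] {C : Scheme.{u}} [C.Over (Spec (.of k))]

/-- The morphism to the affine line defined by a function on an open subset. -/
def toAffineLine {U : C.Opens} (s : Γ(C, U)) : U.toScheme ⟶ Spec (.of (Polynomial k)) :=
  U.toSpecΓ ≫ Spec.map (CommRingCat.ofHom (Polynomial.aeval s).toRingHom)

theorem toAffineLine_comp {U : C.Opens} (s : Γ(C, U)) :
    toAffineLine s ≫ Spec.map (CommRingCat.ofHom Polynomial.C) = U.ι ≫ C ↘ Spec (.of k) := by
  have hU : U ≤ (C ↘ Spec (.of k)) ⁻¹ᵁ ⊤ := le_top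
  have : CommRingCat.ofHom Polynomial.C ≫ CommRingCat.ofHom (Polynomial.aeval s).toRingHom =
      (ΓSpecIso (.of k)).inv ≫ (C ↘ Spec (.of k)).appLE ⊤ U hU := by
    ext c
    exact Polynomial.aeval_C s c
  rw [toAffineLine, Category.assoc, ← Spec.map_comp, this, Spec.map_comp,
    Scheme.Opens.toSpecΓ_SpecMap_appLE_assoc, Scheme.Opens.toSpecΓ_top]
  simp

theorem toAffineLine_X {U : C.Opens} (s : Γ(C, U)) {T : Scheme.{u}} (i : T ⟶ U.toScheme) :
    (i ≫ toAffineLine s).appTop ((ΓSpecIso (.of (Polynomial k))).inv Polynomial.X) =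
      (i ≫ U.ι).appLE U ⊤ (by simp) s := by
  have hle' : (⊤ : U.toScheme.Opens) ≤ U.ι ⁻¹ᵁ U := by simp
  have h1 : (toAffineLine s).appTop ((ΓSpecIso (.of (Polynomial k))).inv Polynomial.X) =
      U.topIso.inv s := by
    have := ConcreteCategory.congr_hom (ΓSpecIso_inv_naturality
      (CommRingCat.ofHom (Polynomial.aeval (R := k) s).toRingHom)) Polynomial.X
    rw [toAffineLine, Hom.comp_appTop, CommRingCat.comp_apply]
    rw [CommRingCat.comp_apply, CommRingCat.comp_apply] at this
    rw [← this, Scheme.Opens.toSpecΓ_appTop]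
    change U.topIso.inv ((ΓSpecIso _).hom ((ΓSpecIso _).inv (Polynomial.aeval s Polynomial.X))) = _
    rw [Polynomial.aeval_X]
    simp
  have h2 : U.topIso.inv = U.ι.appLE U ⊤ hle' := by rw [Opens.ι_appLE]; rfl
  rw [Hom.comp_appTop, CommRingCat.comp_apply, h1, h2]
  exact appTop_appLE i U.ι hle' _ s

theorem mem_of_specializes_closedPoint {R : Type u} [CommRing R] [IsLocalRing R]
    (l : Spec (.of R) ⟶ C) {U : C.Opens}
    (h : l (IsLocalRing.closedPoint R) ∈ U) :
    Set.range l ⊆ U := by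
  rintro _ ⟨p, rfl⟩
  exact (((IsLocalRing.specializes_closedPoint p).map l.continuous).mem_open U.2 h)

/-- The existence part of the valuative criterion for `f : U ⟶ 𝔸¹`, where the rational function `f`
is regular on `U` and its inverse vanishes outside `U`. -/
theorem existence_toAffineLine [IsProper (C ↘ Spec (.of k))] {U V : C.Opens} (hUV : U ⊔ V = ⊤)
    (s : Γ(C, U)) (t : Γ(C, V)) (hst : rres (inf_le_left : U ⊓ V ≤ U) s *
      rres (inf_le_right : U ⊓ V ≤ V) t = 1) (ht : C.basicOpen t ≤ U) :
    ValuativeCriterion.Existence (toAffineLine (k := k) s) := by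
  intro S
  have hv : ValuativeCriterion (C ↘ Spec (.of k)) := by
    have : IsProper (C ↘ Spec (.of k)) := inferInstance
    rw [IsProper.eq_valuativeCriterion] at this
    exact this.1.1.1
  have w := S.commSq.w
  let j : Spec (.of S.K) ⟶ Spec (.of S.R) := Spec.map (CommRingCat.ofHom (algebraMap S.R S.K))
  -- The enlarged square has a lift l to C, because C is proper; the point is that l lands in U.
  let S' : ValuativeCommSq (C ↘ Spec (.of k)) :=
    { R := S.R
      K := S.K
      i₁ := S.i₁ ≫ U.ι
      i₂ := S.i₂ ≫ Spec.map (CommRingCat.ofHom Polynomial.C)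
      commSq := ⟨by
        rw [Category.assoc, ← toAffineLine_comp s, reassoc_of% w]⟩ }
  obtain ⟨⟨l, hl1, hl2⟩⟩ := (hv.existence S').exists_lift
  change j ≫ l = S.i₁ ≫ U.ι at hl1
  have hjinj : Function.Injective j.appTop := by
    intro a b hab
    have hn := ΓSpecIso_naturality (CommRingCat.ofHom (algebraMap S.R S.K))
    apply (ConcreteCategory.bijective_of_isIso (ΓSpecIso (.of S.R)).hom).1
    apply IsFractionRing.injective S.R S.K
    have := congrArg (ΓSpecIso (.of S.K)).hom hab
    rw [← CommRingCat.comp_apply, ← CommRingCat.comp_apply] at this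
    have h1 := ConcreteCategory.congr_hom hn a
    have h2 := ConcreteCategory.congr_hom hn b
    exact h1.symm.trans (this.trans h2)
  have hlU : l (IsLocalRing.closedPoint S.R) ∈ U := by
    by_contra hx
    have hxV : l (IsLocalRing.closedPoint S.R) ∈ V :=
      (show _ ∈ U ⊔ V from hUV ▸ trivial).resolve_left hx
    have hlV : (⊤ : (Spec (.of S.R)).Opens) ≤ l ⁻¹ᵁ V := fun p _ =>
      mem_of_specializes_closedPoint l hxV ⟨p, rfl⟩
    -- If the closed point goes outside U, then l factors through V. The pullbacks a of the
    -- coordinate and r of t multiply to 1 over the fraction field, hence over the valuation ring,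
    -- so t is invertible at the image of the closed point; by `ht` that point lies in U after all.
    let a := S.i₂.appTop ((ΓSpecIso (.of (Polynomial k))).inv Polynomial.X)
    let r := l.appLE V ⊤ hlV t
    have har : a * r = 1 := by
      apply hjinj
      rw [map_mul, map_one]
      have hqU : ⊤ ≤ (j ≫ l) ⁻¹ᵁ U := by rw [hl1]; simp
      have hqV : ⊤ ≤ (j ≫ l) ⁻¹ᵁ V := fun p _ => hlV (x := j p) trivial
      have hq : ⊤ ≤ (j ≫ l) ⁻¹ᵁ (U ⊓ V) := le_inf hqU hqV
      have e1 : j.appTop a = (j ≫ l).appLE U ⊤ hqU s := by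
        have : j.appTop a = (S.i₁ ≫ U.ι).appLE U ⊤ (by simp) s := by
          rw [← toAffineLine_X (k := k) s S.i₁, w, Hom.comp_appTop, CommRingCat.comp_apply]
        simpa only [hl1] using this
      have e2 : j.appTop r = (j ≫ l).appLE V ⊤ hqV t := appTop_appLE j l hlV _ t
      rw [e1, e2, ← appLE_rres (j ≫ l) inf_le_left hq, ← appLE_rres (j ≫ l) inf_le_right hq,
        ← map_mul, hst, map_one]
    have hr : IsUnit r := IsUnit.of_mul_eq_one_right a har
    refine hx (ht ?_)
    have hmem : IsLocalRing.closedPoint S.R ∈ (Spec (.of S.R)).basicOpen r := by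
      rw [basicOpen_of_isUnit _ hr]; trivial
    rw [basicOpen_appLE] at hmem
    exact hmem.2
  have hrange : Set.range l ⊆ Set.range U.ι := by
    rw [Opens.range_ι]; exact mem_of_specializes_closedPoint l hlU
  have hj : j ≫ IsOpenImmersion.lift U.ι l hrange = S.i₁ := by
    rw [← cancel_mono U.ι, Category.assoc, IsOpenImmersion.lift_fac, hl1]
  refine ⟨⟨IsOpenImmersion.lift U.ι l hrange, hj, ?_⟩⟩
  -- The two morphisms to the affine line agree over the fraction field, into which the valuation
  -- ring injects.
  obtain ⟨α, hα⟩ := Spec.map_surjective (IsOpenImmersion.lift U.ι l hrange ≫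
    toAffineLine (k := k) s)
  obtain ⟨β, hβ⟩ := Spec.map_surjective S.i₂
  rw [← hα, ← hβ]
  congr 1
  have : Spec.map (α ≫ CommRingCat.ofHom (algebraMap S.R S.K)) =
      Spec.map (β ≫ CommRingCat.ofHom (algebraMap S.R S.K)) := by
    rw [Spec.map_comp, Spec.map_comp, hα, hβ, ← w, ← Category.assoc]
    exact congrArg (· ≫ toAffineLine (k := k) s) hj
  refine CommRingCat.hom_ext (RingHom.ext fun p => ?_)
  exact IsFractionRing.injective S.R S.K (ConcreteCategory.congr_hom (Spec.map_injective this) p)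

theorem toAffineLine_mem_basicOpen {U : C.Opens} (s : Γ(C, U)) (z : U.toScheme)
    (q : Polynomial k) : q ∉ (toAffineLine (k := k) s z).asIdeal ↔
      z.1 ∈ C.basicOpen (Polynomial.aeval s q) := by
  have h : U.toSpecΓ ⁻¹ᵁ PrimeSpectrum.basicOpen (Polynomial.aeval s q) =
      U.ι ⁻¹ᵁ C.basicOpen (Polynomial.aeval s q) := U.toSpecΓ_preimage_basicOpen _
  have : z ∈ U.toSpecΓ ⁻¹ᵁ PrimeSpectrum.basicOpen (Polynomial.aeval s q) ↔
    z ∈ U.ι ⁻¹ᵁ C.basicOpen (Polynomial.aeval s q) := by rw [h]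
  exact this

theorem isAffineOpen_of_finite_toAffineLine {U : C.Opens} (s : Γ(C, U))
    (h : IsFinite (toAffineLine (k := k) s)) : IsAffineOpen U ∧
      (Polynomial.aeval (R := k) s).toRingHom.Finite := by
  have hU : IsAffineOpen U := isAffine_of_isAffineHom (toAffineLine (k := k) s)
  refine ⟨hU, ?_⟩
  have : Spec.map (CommRingCat.ofHom (Polynomial.aeval (R := k) s).toRingHom) =
      hU.isoSpec.inv ≫ toAffineLine (k := k) s := by
    rw [toAffineLine, hU.isoSpec_inv_toSpecΓ_assoc]
  have h2 : IsFinite (Spec.map (CommRingCat.ofHom (Polynomial.aeval (R := k) s).toRingHom)) := by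
    rw [this]; infer_instance
  exact (IsFinite.SpecMap_iff _).1 h2

variable [IsIntegral C] [IsAlgClosed k]

/-- A nonconstant rational function is transcendental over the algebraically closed field k, so the
generic point of the curve goes to that of the line. -/
theorem toAffineLine_genericPoint {U : C.Opens} [Nonempty U] (s : Γ(C, U))
    (hs : algebraMap Γ(C, U) C.functionField s ∉ Set.range (algebraMap k C.functionField))
    (z : U.toScheme) (hz : z.1 = genericPoint C) :
    (toAffineLine (k := k) s z).asIdeal = ⊥ := by
  have := sectionAlgebra_isScalarTower k U
  rw [eq_bot_iff]
  intro q hq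
  by_contra hq0
  have hq0 : q ≠ 0 := hq0
  obtain ⟨z, hzU⟩ := z
  subst hz
  have h1 : genericPoint C ∉ C.basicOpen (Polynomial.aeval s q) := fun h =>
    (toAffineLine_mem_basicOpen s ⟨_, hzU⟩ q).2 h hq
  rw [C.mem_basicOpen _ _ hzU] at h1
  have hroot : Polynomial.aeval (algebraMap Γ(C, U) C.functionField s) q = 0 := by
    rw [Polynomial.aeval_algebraMap_apply]
    by_contra h0
    exact h1 (isUnit_iff_ne_zero.2 h0)
  have hint : _root_.IsIntegral k (algebraMap Γ(C, U) C.functionField s) :=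
    IsAlgebraic.isIntegral ⟨q, hq0, hroot⟩
  exact hs (minpoly.mem_range_of_degree_eq_one k _
    (IsAlgClosed.degree_eq_one_of_irreducible k (minpoly.irreducible hint)))

/-- The morphism is proper by the valuative criterion and has finite fibres. -/
theorem finite_toAffineLine [IsProper (C ↘ Spec (.of k))]
    [SmoothOfRelativeDimension 1 (C ↘ Spec (.of k))] {U V : C.Opens} (hUV : U ⊔ V = ⊤)
    [Nonempty U] (s : Γ(C, U)) (t : Γ(C, V)) (hst : rres (inf_le_left : U ⊓ V ≤ U) s *
      rres (inf_le_right : U ⊓ V ≤ V) t = 1) (ht : C.basicOpen t ≤ U)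
    (hs : algebraMap Γ(C, U) C.functionField s ∉ Set.range (algebraMap k C.functionField)) :
    IsFinite (toAffineLine (k := k) s) := by
  have : IsLocallyNoetherian C := isLocallyNoetherian_of_over k
  have : CompactSpace C := QuasiCompact.compactSpace_of_compactSpace (C ↘ Spec (.of k))
  have : IsNoetherian C := {}
  have : CompactSpace U.toScheme := isCompact_iff_compactSpace.1 (NoetherianSpace.isCompact _)
  have hcomp := toAffineLine_comp (k := k) s
  have : IsSeparated (toAffineLine (k := k) s ≫ Spec.map (CommRingCat.ofHom Polynomial.C)) := by
    rw [hcomp]; infer_instance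
  have : LocallyOfFiniteType
      (toAffineLine (k := k) s ≫ Spec.map (CommRingCat.ofHom Polynomial.C)) := by
    rw [hcomp]; infer_instance
  have : IsSeparated (toAffineLine (k := k) s) := IsSeparated.of_comp _
    (Spec.map (CommRingCat.ofHom Polynomial.C))
  have : LocallyOfFiniteType (toAffineLine (k := k) s) := locallyOfFiniteType_of_comp _
    (Spec.map (CommRingCat.ofHom Polynomial.C))
  have : QuasiCompact (toAffineLine (k := k) s) := inferInstance
  have : IsProper (toAffineLine (k := k) s) := IsProper.of_valuativeCriterion _
    (ValuativeCriterion.iff.2 ⟨existence_toAffineLine hUV s t hst ht,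
      IsSeparated.valuativeCriterion _⟩)
  have hη : genericPoint C ∈ U := by
    obtain ⟨x, hx⟩ := ‹Nonempty U›
    exact ((genericPoint_spec C).specializes trivial).mem_open U.2 hx
  have : LocallyQuasiFinite (toAffineLine (k := k) s) := by
    refine LocallyQuasiFinite.of_finite_preimage_singleton _ fun y => ?_
    -- Over the generic point of the line there is at most the generic point of C: all other points
    -- are closed, and closed points go to closed points. The fibre over a closed point is closed in
    -- U and misses the generic point, which forces it to be finite.
    by_cases hy : y.asIdeal = ⊥
    · refine (Set.finite_singleton (⟨genericPoint C, hη⟩ : U)).subset fun z hz => ?_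
      by_contra hne
      have hz' : z.1 ≠ genericPoint C := fun e => hne (Subtype.ext e)
      have hcl : IsClosed ({z} : Set U.toScheme) := by
        have := (isClosed_singleton_of_ne_genericPoint k hz').preimage U.ι.continuous
        convert this using 1
        ext w
        exact ⟨fun h => congrArg Subtype.val h, fun h => Subtype.ext h⟩
      have : JacobsonSpace (Spec (.of (Polynomial k))) :=
        inferInstanceAs (JacobsonSpace (PrimeSpectrum (Polynomial k)))
      have hcl' : IsClosed ({toAffineLine (k := k) s z} : Set (Spec (.of (Polynomial k)))) :=
        (toAffineLine (k := k) s).closePoints_subset_preimage_closedPoints hcl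
      rw [show toAffineLine s z = y from hz] at hcl'
      have hmax := (PrimeSpectrum.isClosed_singleton_iff_isMaximal y).1 hcl'
      rw [hy] at hmax
      exact Polynomial.not_isField k (Ring.isField_iff_maximal_bot.2 hmax)
    · let Z : Set U.toScheme := toAffineLine (k := k) s ⁻¹' {y}
      have hZ : IsClosed Z := by
        refine IsClosed.preimage (Hom.continuous _) ?_
        refine (PrimeSpectrum.isClosed_singleton_iff_isMaximal y).2 ?_
        have := y.2
        exact IsPrime.to_maximal_ideal hy
      have hfin : ((U.ι '' Zᶜ)ᶜ).Finite := by
        refine finite_of_isClosed k (U.ι.isOpenEmbedding.isOpenMap _ hZ.isOpen_compl).isClosed_compl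
          (not_not.2 ⟨⟨genericPoint C, hη⟩, fun hz => hy ?_, rfl⟩)
        rw [← show toAffineLine s ⟨genericPoint C, hη⟩ = y from hz]
        exact toAffineLine_genericPoint s hs _ rfl
      refine Set.Finite.of_finite_image (f := U.ι) (hfin.subset ?_)
        (U.ι.isOpenEmbedding.injective.injOn)
      rintro _ ⟨z, hz, rfl⟩ ⟨w, hw, hwz⟩
      exact hw (U.ι.isOpenEmbedding.injective hwz ▸ hz)
  exact IsFinite.of_isProper_of_locallyQuasiFinite _

end AffineLine

end AlgebraicGeometry.Scheme

/-! ### Vanishing of first Čech cohomology, and the affine cover of the curve -/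

/-- Choose n such that gⁿ t ∈ B for all t in a finite set of generators of A over k[f]. Every
element of R has the form gʲ a, so it is a k-linear combination of terms gʲ fᵐ t. Such a term lies
in A if m ≥ j; otherwise it equals fⁿ gʲ⁻ᵐ (gⁿ t), which lies in fⁿ B. -/
theorem exists_add_pow_mul_of_finite_aeval {k A B R : Type*} [Field k] [CommRing A] [CommRing B]
    [CommRing R] [Algebra k A] [Algebra k B] [Algebra k R] (α : A →ₐ[k] R) (β : B →ₐ[k] R) {f : A}
    {g : B} (hfg : α f * β g = 1) (hf : (Polynomial.aeval (R := k) f).toRingHom.Finite)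
    (hα : ∀ c : R, ∃ (n : ℕ) (a : A), α f ^ n * c = α a)
    (hβ : ∀ c : R, ∃ (n : ℕ) (b : B), β g ^ n * c = β b) :
    ∃ n : ℕ, ∀ c : R, ∃ (a : A) (b : B), c = α a + α f ^ n * β b := by
  let := (Polynomial.aeval (R := k) f).toRingHom.toAlgebra
  have hfin : Module.Finite (Polynomial k) A := hf
  obtain ⟨T, hT⟩ := hfin.fg_top
  have hn : ∃ n : ℕ, ∀ t ∈ T, ∃ b : B, β g ^ n * α t = β b := by
    choose n b hb using fun t => hβ (α t)
    refine ⟨T.sup n, fun t ht => ⟨g ^ (T.sup n - n t) * b t, ?_⟩⟩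
    rw [map_mul, map_pow, ← hb, ← mul_assoc, ← pow_add, Nat.sub_add_cancel (Finset.le_sup ht)]
  obtain ⟨n, hn⟩ := hn
  refine ⟨n, ?_⟩
  let P : R → Prop := fun c => ∃ (a : A) (b : B), c = α a + α f ^ n * β b
  have hadd : ∀ c d, P c → P d → P (c + d) := by
    rintro _ _ ⟨a, b, rfl⟩ ⟨a', b', rfl⟩
    exact ⟨a + a', b + b', by rw [map_add, map_add]; ring⟩
  have hgf : ∀ m, β g ^ m * α f ^ m = 1 := fun m => by
    rw [← mul_pow, mul_comm, hfg, one_pow]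
  have key : ∀ (a : A) (j : ℕ), P (β g ^ j * α a) := by
    intro a
    have ha : a ∈ Submodule.span (Polynomial k) (T : Set A) := hT ▸ trivial
    induction ha using Submodule.span_induction with
    | mem t ht =>
      intro j
      obtain ⟨b, hb⟩ := hn t ht
      refine ⟨0, g ^ j * b, ?_⟩
      rw [map_zero, zero_add, map_mul, ← hb, map_pow]
      calc β g ^ j * α t = β g ^ j * α t * (β g ^ n * α f ^ n) := by rw [hgf, mul_one]
        _ = _ := by ring
    | zero => exact fun j => ⟨0, 0, by simp⟩
    | add x y _ _ hx hy =>
      intro j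
      rw [map_add, mul_add]
      exact hadd _ _ (hx j) (hy j)
    | smul p x _ hx =>
      induction p using Polynomial.induction_on' with
      | add p q hp hq =>
        intro j
        rw [add_smul, map_add, mul_add]
        exact hadd _ _ (hp j) (hq j)
      | monomial m c =>
        intro j
        have e : (Polynomial.monomial m c) • x = c • (f ^ m * x) := by
          change Polynomial.aeval f (Polynomial.monomial m c) * x = _
          rw [Polynomial.aeval_monomial, Algebra.smul_def, mul_assoc]
        rw [e]
        -- If m ≤ j, then f ^ m cancels against g ^ j and the induction hypothesis applies with
        -- exponent j - m; this is why the induction runs over all j at once.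
        rcases le_total m j with h | h
        · obtain ⟨a, b, hab⟩ := hx (j - m)
          refine ⟨c • a, c • b, ?_⟩
          rw [map_smul, map_smul, map_smul, mul_smul_comm, mul_smul_comm, ← smul_add, ← hab,
            map_mul, map_pow]
          congr 1
          calc β g ^ j * (α f ^ m * α x) = β g ^ (j - m + m) * (α f ^ m * α x) := by
                rw [Nat.sub_add_cancel h]
            _ = β g ^ (j - m) * α x * (β g ^ m * α f ^ m) := by rw [pow_add]; ring
            _ = _ := by rw [hgf, mul_one]
        · refine ⟨c • (f ^ (m - j) * x), 0, ?_⟩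
          rw [map_zero, mul_zero, add_zero, map_smul, map_smul, mul_smul_comm, map_mul, map_mul,
            map_pow, map_pow]
          congr 1
          calc β g ^ j * (α f ^ m * α x) = β g ^ j * (α f ^ (m - j + j) * α x) := by
                rw [Nat.sub_add_cancel h]
            _ = α f ^ (m - j) * α x * (β g ^ j * α f ^ j) := by rw [pow_add]; ring
            _ = _ := by rw [hgf, mul_one]
  intro c
  obtain ⟨j, a, ha⟩ := hα c
  have := key a j
  rwa [← ha, ← mul_assoc, hgf, one_mul] at this

namespace AlgebraicGeometry.Scheme

section Cover

attribute [local instance] sectionAlgebra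

variable (k : Type u) [Field k] {C : Scheme.{u}} [C.Over (Spec (.of k))]

/-- Restriction of functions as a homomorphism of `k`-algebras. -/
def rresAlgHom {U V : C.Opens} (h : V ≤ U) : Γ(C, U) →ₐ[k] Γ(C, V) :=
  { rres h with
    commutes' := fun _ => ConcreteCategory.congr_hom
      (Hom.appLE_map (C ↘ Spec (.of k)) (V := U) le_top (homOfLE h).op) _ }

theorem exists_pow_mul_eq_rres {U W : C.Opens} (hU : IsAffineOpen U) (f : Γ(C, U)) (h : W ≤ U)
    (hW : W = C.basicOpen f) (c : Γ(C, W)) : ∃ (n : ℕ) (a : Γ(C, U)),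
      rres h f ^ n * c = rres h a := by
  subst hW
  have := hU.isLocalization_basicOpen f
  obtain ⟨n, a, ha⟩ := IsLocalization.Away.surj f c
  exact ⟨n, a, by rw [mul_comm]; exact ha⟩

variable [IsIntegral C]

theorem basicOpen_le_regularLocus_inv {f : C.functionField} {U : C.Opens} [Nonempty U]
    {s : Γ(C, U)} (hs : algebraMap _ C.functionField s = f) :
    C.basicOpen s ≤ regularLocus f⁻¹ := by
  intro x hx
  have hxU := C.basicOpen_le s hx
  obtain ⟨b, hb⟩ := ((C.mem_basicOpen s x hxU).1 hx).exists_right_inv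
  refine ⟨b, ?_⟩
  rw [← hs, ← toRational_eq_algebraMap ⟨x, hxU⟩]
  refine eq_inv_of_mul_eq_one_right ?_
  rw [toRational, ← map_mul]
  exact (congrArg _ hb).trans (map_one _)

theorem rres_mul_rres_eq_one {f : C.functionField} (hf : f ≠ 0) {U V : C.Opens} [Nonempty U]
    [Nonempty V] {s : Γ(C, U)} (hs : algebraMap _ C.functionField s = f) {t : Γ(C, V)}
    (ht : algebraMap _ C.functionField t = f⁻¹) {W : C.Opens} (hU : W ≤ U) (hV : W ≤ V)
    (hη : genericPoint C ∈ W) : rres hU s * rres hV t = 1 := by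
  have : Nonempty W := ⟨⟨_, hη⟩⟩
  apply C.germToFunctionField_injective W
  change algebraMap Γ(C, W) C.functionField _ = algebraMap Γ(C, W) C.functionField _
  rw [← toRational_eq_algebraMap ⟨_, hη⟩, ← toRational_eq_algebraMap ⟨_, hη⟩]
  have h1 : toRational (⟨_, hη⟩ : W) (rres hU s) = f :=
    (toRational_map (homOfLE hU) ⟨_, hη⟩ s).trans ((toRational_eq_algebraMap _ s).trans hs)
  have h2 : toRational (⟨_, hη⟩ : W) (rres hV t) = f⁻¹ :=
    (toRational_map (homOfLE hV) ⟨_, hη⟩ t).trans ((toRational_eq_algebraMap _ t).trans ht)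
  have h3 : toRational (⟨_, hη⟩ : W) (rres hU s * rres hV t) = 1 := by
    rw [toRational, map_mul, map_mul]
    exact (congrArg₂ (· * ·) h1 h2).trans (mul_inv_cancel₀ hf)
  have h4 : toRational (⟨_, hη⟩ : W) (1 : Γ(C, W)) = 1 := by rw [toRational, map_one, map_one]
  exact h3.trans h4.symm

/-- A covering of a complete smooth curve by the affine open subsets where a rational function and
its inverse are regular. -/
theorem exists_affine_cover [IsAlgClosed k] [IsProper (C ↘ Spec (.of k))]
    [SmoothOfRelativeDimension 1 (C ↘ Spec (.of k))] {V₀ : C.Opens} {c₀ c₁ : C} (hc₀ : c₀ ∈ V₀)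
    (hc₁ : c₁ ≠ genericPoint C) :
    ∃ (U V : C.Opens) (f : Γ(C, U)) (g : Γ(C, V)), IsAffineOpen U ∧ IsAffineOpen V ∧ U ⊔ V = ⊤ ∧
      U ≤ V₀ ∧ U ⊓ V = C.basicOpen f ∧ U ⊓ V = C.basicOpen g ∧
      rres (inf_le_left : U ⊓ V ≤ U) f * rres (inf_le_right : U ⊓ V ≤ V) g = 1 ∧
      ∃ n : ℕ, ∀ c : Γ(C, U ⊓ V), ∃ (a : Γ(C, U)) (b : Γ(C, V)),
        c = rres inf_le_left a + rres inf_le_left f ^ n * rres inf_le_right b := by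
  -- Poles are prescribed outside V₀, which forces U ≤ V₀, and at c₁, which makes the function
  -- nonconstant even if V₀ is all of C.
  have hη : genericPoint C ∉ (V₀ : Set C)ᶜ ∪ {c₁} := by
    rintro (h | h)
    · exact h (((genericPoint_spec C).specializes trivial).mem_open V₀.2 hc₀)
    · exact hc₁ h.symm
  obtain ⟨φ, hφ⟩ := exists_forall_notMem_regularLocus k
    (finite_of_isClosed k (V₀.2.isClosed_compl.union
      (isClosed_singleton_of_ne_genericPoint k hc₁)) hη) hη
  have hφ1 : c₁ ∉ regularLocus φ := hφ c₁ (.inr rfl)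
  have hφ0 : φ ≠ 0 := by
    rintro rfl
    exact hφ1 ⟨0, map_zero _⟩
  have hφk : φ ∉ Set.range (algebraMap k C.functionField) := by
    rintro ⟨c, rfl⟩
    exact hφ1 (algebraMap_mem_regularLocus c c₁)
  have hφk' : φ⁻¹ ∉ Set.range (algebraMap k C.functionField) := by
    rintro ⟨c, hc⟩
    exact hφk ⟨c⁻¹, by rw [map_inv₀, hc, inv_inv]⟩
  obtain ⟨f, hf⟩ := exists_regularSection φ
  obtain ⟨g, hg⟩ := exists_regularSection φ⁻¹
  have hU := genericPoint_mem_regularLocus φ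
  have hV := genericPoint_mem_regularLocus φ⁻¹
  have hUV := regularLocus_sup_inv k φ
  have hfg := rres_mul_rres_eq_one hφ0 hf hg inf_le_left inf_le_right ⟨hU, hV⟩
  have hgf := rres_mul_rres_eq_one (inv_ne_zero hφ0) hg (hf.trans (inv_inv φ).symm)
    inf_le_left inf_le_right ⟨hV, hU⟩
  have hfV := basicOpen_le_regularLocus_inv hf
  have hgU := basicOpen_le_regularLocus_inv hg
  rw [inv_inv] at hgU
  obtain ⟨hUaff, hfin⟩ := isAffineOpen_of_finite_toAffineLine (k := k) f
    (finite_toAffineLine hUV f g hfg hgU (by rwa [hf]))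
  obtain ⟨hVaff, -⟩ := isAffineOpen_of_finite_toAffineLine (k := k) g
    (finite_toAffineLine (sup_comm _ _ |>.trans hUV) g f hgf hfV (by rwa [hg]))
  have hOf : regularLocus φ ⊓ regularLocus φ⁻¹ = C.basicOpen f := by
    refine le_antisymm ?_ (le_inf (C.basicOpen_le f) hfV)
    have := basicOpen_of_isUnit C (IsUnit.of_mul_eq_one _ hfg)
    rw [rres, basicOpen_res] at this
    exact inf_eq_left.1 this
  have hOg : regularLocus φ ⊓ regularLocus φ⁻¹ = C.basicOpen g := by
    refine le_antisymm ?_ (le_inf hgU (C.basicOpen_le g))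
    have := basicOpen_of_isUnit C (IsUnit.of_mul_eq_one_right _ hfg)
    rw [rres, basicOpen_res] at this
    exact inf_eq_left.1 this
  refine ⟨_, _, f, g, hUaff, hVaff, hUV, fun x hx => ?_, hOf, hOg, hfg, ?_⟩
  · by_contra h
    exact hφ x (.inl h) hx
  · exact exists_add_pow_mul_of_finite_aeval (rresAlgHom k inf_le_left) (rresAlgHom k inf_le_right)
      hfg hfin (exists_pow_mul_eq_rres hUaff f inf_le_left hOf)
      (exists_pow_mul_eq_rres hVaff g inf_le_right hOg)

end Cover

end AlgebraicGeometry.Scheme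

namespace AlgebraicGeometry.Scheme

/-! ### Coherent sheaves have finitely generated sections over affine open subsets -/

section FiniteType

variable {X : Scheme.{u}}

instance Modules.LocalSubmodule.mono_over {M : X.Modules} (N : M.LocalSubmodule) (U : X.Opens) :
    Mono (SheafOfModules.Hom.over (R := X.ringCatSheaf) N.ι U) := by
  constructor
  intro K a b hab
  apply SheafOfModules.Hom.ext
  apply PresheafOfModules.hom_ext
  intro V
  ext s
  exact N.ι_injective (U := V.unop.left) (congrArg
    (fun φ : K ⟶ SheafOfModules.over (R := X.ringCatSheaf) M U => (φ.val.app V).hom s) hab)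

theorem Modules.LocalSubmodule.mem_of_epi_over {M : X.Modules} (N : M.LocalSubmodule) {U : X.Opens}
    [Epi (SheafOfModules.Hom.over (R := X.ringCatSheaf) N.ι U)] {W : X.Opens} (h : W ≤ U)
    (s : sec M.pval W) : s ∈ N.obj W := by
  have : IsIso (SheafOfModules.Hom.over (R := X.ringCatSheaf) N.ι U) :=
    isIso_of_mono_of_epi _
  let t : sec N.toModules.pval W :=
    ((inv (SheafOfModules.Hom.over (R := X.ringCatSheaf) N.ι U)).val.app
      (op (Over.mk (homOfLE h)))).hom s
  have ht : secMap (Modules.pmap N.ι) W t = s := congrArg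
    (fun φ : SheafOfModules.over (R := X.ringCatSheaf) M U ⟶
      SheafOfModules.over (R := X.ringCatSheaf) M U => (φ.val.app (op (Over.mk (homOfLE h)))).hom s)
    (IsIso.inv_hom_id (SheafOfModules.Hom.over (R := X.ringCatSheaf) N.ι U))
  exact ht ▸ N.ι_mem t

/-- The given epimorphism from a free sheaf factors over U through the subsheaf N that the
generators span. So the inclusion of N is epi over U, and being mono it is invertible there. -/
theorem Modules.mem_locSpan_of_generatingSections {M : X.Modules} {U : X.Opens}
    (σ : (SheafOfModules.over (R := X.ringCatSheaf) M U).GeneratingSections) {W : X.Opens}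
    (h : W ≤ U) (s : sec M.pval W) :
    s ∈ (M.sectionsOn U (Set.range fun i =>
      (show sec M.pval U from (σ.s i).val (op (Over.mk (𝟙 U)))))).locSpan.obj W := by
  set N := (M.sectionsOn U (Set.range fun i =>
      (show sec M.pval U from (σ.s i).val (op (Over.mk (𝟙 U)))))).locSpan with hN
  have hmem : ∀ i (V : Over U), (show sec M.pval V.left from (σ.s i).val (op V)) ∈ N.obj V.left := by
    intro i V
    refine Modules.SectionSet.subset_locSpan _ ⟨V.hom.le, _, ⟨i, rfl⟩, ?_⟩
    exact (PresheafOfModules.sections_property (σ.s i)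
      (Over.homMk V.hom : V ⟶ Over.mk (𝟙 U)).op).symm
  let τ (i : σ.I) : (SheafOfModules.over (R := X.ringCatSheaf) N.toModules U).sections :=
    PresheafOfModules.sectionsMk
      (M := (SheafOfModules.over (R := X.ringCatSheaf) N.toModules U).val)
      (fun V => N.mkSec (U := V.unop.left) _ (hmem i V.unop))
      (fun V V' f => N.ι_injective (U := V'.unop.left)
        (PresheafOfModules.sections_property (σ.s i) f))
  have hτ : (SheafOfModules.freeHomEquiv _).symm τ ≫
      SheafOfModules.Hom.over (R := X.ringCatSheaf) N.ι U = σ.π := by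
    rw [SheafOfModules.freeHomEquiv_symm_comp]
    rfl
  have : Epi σ.π := σ.epi
  have : Epi (SheafOfModules.Hom.over (R := X.ringCatSheaf) N.ι U) :=
    epi_of_epi_fac hτ
  exact N.mem_of_epi_over h s

theorem Modules.IsCoherent.isLocallyFinite {M : X.Modules} (hM : M.IsCoherent) :
    M.IsLocallyFinite := by
  obtain ⟨σ, hσ⟩ := SheafOfModules.IsFinitePresentation.exists_quasicoherentData (self := hM)
  intro x
  obtain ⟨W, g, ⟨i, ⟨f⟩⟩, hxW⟩ := σ.coversTop ⊤ x trivial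
  have := (hσ.isFinite_presentation i).isFiniteType_generators.finite
  exact ⟨σ.X i, f.le hxW, _, Set.finite_range _, fun W hW s =>
    Modules.mem_locSpan_of_generatingSections (σ.presentation i).generators hW s⟩

theorem Modules.IsCoherent.qc {M : X.Modules} (hM : M.IsCoherent) : QC M.pval := by
  obtain ⟨σ, hσ⟩ := SheafOfModules.IsFinitePresentation.exists_quasicoherentData (self := hM)
  have : SheafOfModules.IsQuasicoherent (R := X.ringCatSheaf) M :=
    SheafOfModules.IsQuasicoherent.mk (R := X.ringCatSheaf) (M := M) ⟨σ⟩
  exact isQCOn_of_isQuasicoherent M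

theorem Modules.IsCoherent.finite {M : X.Modules} (hM : M.IsCoherent) {U : X.Opens}
    (hU : IsAffineOpen U) : Module.Finite Γ(X, U) (sec M.pval U) :=
  hM.isLocallyFinite.finite hU (hM.qc U hU)

end FiniteType

end AlgebraicGeometry.Scheme

namespace AlgebraicGeometry.Scheme

/-! ### Functoriality and finiteness of tensor products and symmetric powers -/

section Functoriality

variable {X : Scheme.{u}} {P P' Q Q' : PMod X}

/-- The tensor product of two morphisms of presheaves of modules. -/
def tmodMap (φ : P ⟶ P') (χ : Q ⟶ Q') : tmod P Q ⟶ tmod P' Q' :=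
  PresheafOfModules.Monoidal.tensorHom (R := X.presheaf) φ χ

theorem secMap_tmodMap (φ : P ⟶ P') (χ : Q ⟶ Q') {U : X.Opens} (p : sec P U) (q : sec Q U) :
    secMap (tmodMap φ χ) U (tmul p q) = tmul (secMap φ U p) (secMap χ U q) := rfl

/-- The symmetric power of a morphism of presheaves of modules. -/
def smodMap (n : ℕ) (φ : P ⟶ P') : smod n P ⟶ smod n P' where
  app U := ModuleCat.ofHom (X := (smod n P).obj U) (Y := (smod n P').obj U)
    (SymmetricPower.mapₛₗ (R := X.presheaf.obj U) (RingHom.id (X.presheaf.obj U)) (ULift.{u} (Fin n)) (φ.app U).hom)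
  naturality {U V} f := by
    refine ModuleCat.hom_ext (LinearMap.ext fun x => ?_)
    exact (SymmetricPower.mapₛₗ_comp (X.presheaf.map f).hom _ (RingHom.id (X.presheaf.obj V))
      (X.presheaf.map f).hom (fun _ => rfl) (PresheafOfModules.symPowerResAux P f) (φ.app V).hom
      ((φ.app V).hom.comp (PresheafOfModules.symPowerResAux P f)) (fun _ => rfl) x).symm.trans
      (SymmetricPower.mapₛₗ_comp (RingHom.id (X.presheaf.obj U)) _ (X.presheaf.map f).hom
        (X.presheaf.map f).hom (fun _ => rfl) (φ.app U).hom (PresheafOfModules.symPowerResAux P' f)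
        ((φ.app V).hom.comp (PresheafOfModules.symPowerResAux P f))
        (fun m => PresheafOfModules.naturality_apply φ f m) x)

theorem secMap_smodMap (n : ℕ) (φ : P ⟶ P') {U : X.Opens} (e : ULift.{u} (Fin n) → sec P U) :
    secMap (smodMap n φ) U (stprod e) = stprod fun i => secMap φ U (e i) :=
  SymmetricPower.mapₛₗ_tprod _ _ _ e

theorem secMap_tmodMap_surjective {φ : P ⟶ P'} {χ : Q ⟶ Q'} {U : X.Opens}
    (hφ : Function.Surjective (secMap φ U)) (hχ : Function.Surjective (secMap χ U)) :
    Function.Surjective (secMap (tmodMap φ χ) U) := by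
  intro s
  induction s using tmul_induction with
  | h0 => exact ⟨0, map_zero _⟩
  | ht a b =>
    obtain ⟨a, rfl⟩ := hφ a
    obtain ⟨b, rfl⟩ := hχ b
    exact ⟨tmul a b, rfl⟩
  | ha s t hs ht =>
    obtain ⟨s, rfl⟩ := hs
    obtain ⟨t, rfl⟩ := ht
    exact ⟨s + t, map_add _ _ _⟩

theorem secMap_smodMap_surjective (n : ℕ) {φ : P ⟶ P'} {U : X.Opens}
    (hφ : Function.Surjective (secMap φ U)) :
    Function.Surjective (secMap (smodMap n φ) U) := by
  rw [← LinearMap.range_eq_top, eq_top_iff, ← span_range_stprod, Submodule.span_le]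
  rintro _ ⟨e, rfl⟩
  choose e' he' using fun i => hφ (e i)
  exact ⟨stprod e', by rw [secMap_smodMap]; simp only [he']⟩

theorem finite_tmod {U : X.Opens} (hP : Module.Finite Γ(X, U) (sec P U))
    (hQ : Module.Finite Γ(X, U) (sec Q U)) : Module.Finite Γ(X, U) (sec (tmod P Q) U) :=
  inferInstanceAs (Module.Finite Γ(X, U) (TensorProduct Γ(X, U) (sec P U) (sec Q U)))

theorem finite_smod (n : ℕ) {U : X.Opens} (hP : Module.Finite Γ(X, U) (sec P U)) :
    Module.Finite Γ(X, U) (sec (smod n P) U) :=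
  Module.Finite.of_surjective
    (SymmetricPower.mk Γ(X, U) (ULift.{u} (Fin n)) (sec P U))
    (AddCon.mk'_surjective (c := addConGen (SymmetricPower.Rel Γ(X, U) (ULift.{u} (Fin n)) (sec P U))))

theorem finite_shf (hP : QC P) {U : X.Opens} (hU : IsAffineOpen U)
    (h : Module.Finite Γ(X, U) (sec P U)) : Module.Finite Γ(X, U) (sec (shf P).pval U) :=
  Module.Finite.of_surjective (toShf P U) (toShf_surjective hP hU)

theorem secMap_shfMap_surjective {φ : P ⟶ Q} {U : X.Opens} (hQ : QC Q) (hU : IsAffineOpen U)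
    (hφ : Function.Surjective (secMap φ U)) :
    Function.Surjective (secMap (Modules.pmap (shfMap φ)) U) := by
  intro s
  obtain ⟨s, rfl⟩ := toShf_surjective hQ hU s
  obtain ⟨s, rfl⟩ := hφ s
  exact ⟨toShf P U s, shfMap_toShf _ _ _⟩

end Functoriality

/-! ### Twisting a coherent sheaf down along the zeros of a function -/

section Twist

variable {X : Scheme.{u}}

/-- Divisibility by h is membership in the submodule of multiples of h, which on an affine open
subset can be tested locally. -/
theorem IsQCOn.exists_eq_smul {P : PMod X} {U : X.Opens} (hU : IsAffineOpen U) (hP : IsQCOn P U)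
    (h : Γ(X, U)) (s : sec P U) (hs : ∀ x ∈ U, ∃ (W : X.Opens) (hW : W ≤ U), x ∈ W ∧
      ∃ r : sec P W, res P hW s = rres hW h • r) : ∃ r : sec P U, s = h • r := by
  have : s ∈ LinearMap.range (LinearMap.lsmul Γ(X, U) (sec P U) h) := by
    refine mem_of_locally_mem_span hU hP _ s fun x hx => ?_
    obtain ⟨W, hW, hxW, r, hr⟩ := hs x hx
    obtain ⟨f, hf, hxf⟩ := hU.exists_basicOpen_subset hx hxW
    refine ⟨X.basicOpen f, X.basicOpen_le f, hxf, ?_⟩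
    obtain ⟨n, r', hr'⟩ := hP.extend f (res P hf r)
    have hu := (isUnit_rres_basicOpen f (X.basicOpen_le f) le_rfl).pow n
    rw [← Submodule.smul_mem_iff_of_isUnit _ hu]
    refine Submodule.subset_span ⟨h • r', ⟨r', rfl⟩, ?_⟩
    rw [res_smul, hr', ← res_res P hW hf, hr, res_smul, rres_rres, smul_comm]
  obtain ⟨r, hr⟩ := this
  exact ⟨r, hr.symm⟩

/-- The subsheaf of sections that are locally divisible by `t` on `V`. -/
def Modules.divisibleBy (F : X.Modules) (V : X.Opens) (t : Γ(X, V)) : F.LocalSubmodule where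
  obj W :=
    { carrier := {s | ∀ x ∈ W, x ∈ V → ∃ (W' : X.Opens) (h : W' ≤ W) (h' : W' ≤ V), x ∈ W' ∧
        ∃ r, res F.pval h s = rres h' t • r}
      zero_mem' := fun x hx hxV => ⟨W ⊓ V, inf_le_left, inf_le_right, ⟨hx, hxV⟩, 0, by
        rw [map_zero, smul_zero]⟩
      add_mem' := by
        intro s s' hs hs' x hx hxV
        obtain ⟨A, hA, hA', hxA, r, hr⟩ := hs x hx hxV
        obtain ⟨B, hB, hB', hxB, r', hr'⟩ := hs' x hx hxV
        refine ⟨A ⊓ B, inf_le_left.trans hA, inf_le_left.trans hA', ⟨hxA, hxB⟩,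
          res F.pval inf_le_left r + res F.pval inf_le_right r', ?_⟩
        rw [map_add, smul_add, ← res_res F.pval hA inf_le_left, hr,
          ← res_res F.pval hB inf_le_right, hr', res_smul, res_smul, rres_rres, rres_rres]
      smul_mem' := by
        intro c s hs x hx hxV
        obtain ⟨A, hA, hA', hxA, r, hr⟩ := hs x hx hxV
        exact ⟨A, hA, hA', hxA, rres hA c • r, by rw [res_smul, hr, smul_comm]⟩ }
  res_mem := by
    intro W W' h s hs x hx hxV
    obtain ⟨A, hA, hA', hxA, r, hr⟩ := hs x (h hx) hxV
    refine ⟨A ⊓ W', inf_le_right, inf_le_left.trans hA', ⟨hxA, hx⟩, res F.pval inf_le_left r, ?_⟩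
    rw [res_res, ← res_res F.pval hA inf_le_left, hr, res_smul, rres_rres]
  mem_of_locally := by
    intro W s h x hx hxV
    obtain ⟨W', hW', hxW', hs⟩ := h x hx
    obtain ⟨A, hA, hA', hxA, r, hr⟩ := hs x hxW' hxV
    exact ⟨A, hA.trans hW', hA', hxA, r, by rw [← hr, res_res]⟩

variable {F : X.Modules} {U V : X.Opens} {t : Γ(X, V)}

theorem Modules.mem_divisibleBy {W : X.Opens} (h : V ⊓ W ≤ X.basicOpen t) (s : sec F.pval W) :
    s ∈ (F.divisibleBy V t).obj W := by
  intro x hx hxV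
  obtain ⟨v, hv⟩ := (isUnit_rres_basicOpen t (V := V ⊓ W) inf_le_left h).exists_right_inv
  exact ⟨V ⊓ W, inf_le_right, inf_le_left, ⟨hxV, hx⟩, v • res F.pval inf_le_right s, by
    rw [smul_smul, hv, one_smul]⟩

theorem Modules.smul_mem_divisibleBy {W : X.Opens} (h : W ≤ V) (r : sec F.pval W) :
    rres h t • r ∈ (F.divisibleBy V t).obj W := by
  intro x hx hxV
  exact ⟨W, le_rfl, h, hx, r, by rw [res_self]⟩

theorem Modules.exists_eq_smul_of_mem_divisibleBy (hF : QC F.pval) {W : X.Opens} (h : W ≤ V)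
    (hW : IsAffineOpen W) {s : sec F.pval W} (hs : s ∈ (F.divisibleBy V t).obj W) :
    ∃ r, s = rres h t • r := by
  refine (hF W hW).exists_eq_smul hW _ s fun x hx => ?_
  obtain ⟨A, hA, hA', hxA, r, hr⟩ := hs x hx (h hx)
  exact ⟨A, hA, hxA, r, by rw [hr, rres_rres]⟩

/-- The subsheaf coincides with F on U, where the divisibility condition is automatic, and its
sections over affine open subsets of V are the multiples of t. Both descriptions inherit
quasi-coherence from F, and finiteness holds because submodules over noetherian rings are finitely
generated. -/
theorem Modules.IsCoherent.divisibleBy [IsLocallyNoetherian X] (hF : F.IsCoherent)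
    (hU : IsAffineOpen U) (hV : IsAffineOpen V) (hUV : U ⊔ V = ⊤)
    (ht : V ⊓ U ≤ X.basicOpen t) : (F.divisibleBy V t).toModules.IsCoherent := by
  set N := F.divisibleBy V t with hN
  have fin : ∀ W : X.Opens, IsAffineOpen W → Module.Finite Γ(X, W) (sec N.toModules.pval W) := by
    intro W hW
    have := IsLocallyNoetherian.component_noetherian ⟨W, hW⟩
    have := hF.finite hW
    exact Module.Finite.of_injective (secMap (Modules.pmap N.ι) W) N.ι_injective
  have zero : ∀ (W : X.Opens) (_ : IsAffineOpen W) (f : Γ(X, W)) (s : sec N.toModules.pval W),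
      res N.toModules.pval (X.basicOpen_le f) s = 0 → ∃ n : ℕ, f ^ n • s = 0 := by
    intro W hW f s hs
    obtain ⟨n, hn⟩ := (hF.qc W hW).eq_zero f (secMap (Modules.pmap N.ι) W s) (by
      rw [res_secMap, hs, map_zero])
    exact ⟨n, N.ι_injective (by rw [LinearMap.map_smul, hn, map_zero])⟩
  refine isCoherent_of_isQCOn (fun b : ULift.{u} Bool => cond b.down U V) ?_ ?_ ?_ ?_ ?_
  · refine IsOpenCover.mk ?_
    rw [eq_top_iff, ← hUV]
    exact sup_le (le_iSup_of_le ⟨true⟩ le_rfl) (le_iSup_of_le ⟨false⟩ le_rfl)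
  · rintro ⟨_ | _⟩
    exacts [hV, hU]
  · rintro ⟨_ | _⟩
    exacts [IsLocallyNoetherian.component_noetherian ⟨V, hV⟩,
      IsLocallyNoetherian.component_noetherian ⟨U, hU⟩]
  · rintro ⟨_ | _⟩
    · refine ⟨zero V hV, fun f s => ?_⟩
      obtain ⟨r, hr⟩ := Modules.exists_eq_smul_of_mem_divisibleBy hF.qc (X.basicOpen_le f)
        (hV.basicOpen f) (N.ι_mem s)
      obtain ⟨n, r', hr'⟩ := (hF.qc V hV).extend f r
      refine ⟨n, N.mkSec (t • r') ?_, N.ι_injective ?_⟩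
      · have := Modules.smul_mem_divisibleBy (F := F) (t := t) le_rfl r'
        rwa [rres_self] at this
      · rw [← res_secMap, N.ι_mkSec, res_smul, hr', LinearMap.map_smul, hr, smul_comm]
    · refine ⟨zero U hU, fun f s => ?_⟩
      obtain ⟨n, r, hr⟩ := (hF.qc U hU).extend f (secMap (Modules.pmap N.ι) _ s)
      refine ⟨n, N.mkSec r (Modules.mem_divisibleBy ht r), N.ι_injective ?_⟩
      rw [← res_secMap, N.ι_mkSec, hr, LinearMap.map_smul]
  · rintro ⟨_ | _⟩
    exacts [fin V hV, fin U hU]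

end Twist

end AlgebraicGeometry.Scheme

namespace AlgebraicGeometry.Scheme

/-! ### A criterion for global generation on two affine charts -/

section Criterion

variable {X : Scheme.{u}}

theorem Modules.IsGloballyGenerated.span_eq_top {M : X.Modules} (h : M.IsGloballyGenerated)
    {U : X.Opens} (hU : IsAffineOpen U) (hM : IsQCOn M.pval U) :
    Submodule.span Γ(X, U) (Set.range (res M.pval (le_top : U ≤ ⊤))) = ⊤ := by
  refine eq_top_iff.2 fun s _ => mem_of_locally_mem_span hU hM _ s fun x hx => ?_
  obtain ⟨W, hW, hxW, hs⟩ := Modules.mem_locSpan_of_isGloballyGenerated h s x hx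
  refine ⟨W, hW, hxW, Submodule.span_mono ?_ hs⟩
  rintro _ ⟨t, -, rfl⟩
  exact ⟨_, Submodule.subset_span ⟨t, rfl⟩, res_res M.pval le_top hW t⟩

variable {U V : X.Opens} {f : Γ(X, U)} {g : Γ(X, V)} {n : ℕ} {A B : X.Modules}

/-- Write b as a combination of global sections of B and split each coefficient c = a + fⁿ d; the
terms with a extend to U, those with d to V. -/
theorem exists_eq_add_of_isGloballyGenerated
    (hn : ∀ c : Γ(X, U ⊓ V), ∃ a b,
      c = rres inf_le_left a + rres inf_le_left f ^ n * rres inf_le_right b)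
    (hB : Submodule.span Γ(X, U ⊓ V) (Set.range (res B.pval (le_top : U ⊓ V ≤ ⊤))) = ⊤)
    (b : sec B.pval (U ⊓ V)) : ∃ (p : sec B.pval U) (q : sec B.pval V),
      b = res B.pval inf_le_left p + rres (inf_le_left : U ⊓ V ≤ U) f ^ n • res B.pval inf_le_right q := by
  have hb : b ∈ Submodule.span Γ(X, U ⊓ V) (Set.range (res B.pval (le_top : U ⊓ V ≤ ⊤))) := by
    rw [hB]; trivial
  induction hb using Submodule.closure_induction with
  | zero => exact ⟨0, 0, by simp⟩
  | add b b' _ _ h h' =>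
    obtain ⟨p, q, rfl⟩ := h
    obtain ⟨p', q', rfl⟩ := h'
    exact ⟨p + p', q + q', by rw [map_add, map_add, smul_add]; abel⟩
  | smul_mem c b hb =>
    obtain ⟨s, rfl⟩ := hb
    obtain ⟨a, d, rfl⟩ := hn c
    refine ⟨a • res B.pval le_top s, d • res B.pval le_top s, ?_⟩
    rw [add_smul, mul_smul, res_smul, res_smul, res_res, res_res]

/-- On U ∩ V, t = Φ(p) + fⁿ Φ(q) with Φ(q) = gⁿ⁺¹ r. Since fⁿ gⁿ⁺¹ = g, the sections Φ(p) on U and t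
− g r on V agree there and glue. The exponent n + 1 instead of n leaves the one factor g needed for
Nakayama's lemma. -/
theorem exists_global_section (hUV : U ⊔ V = ⊤)
    (hfg : rres (inf_le_left : U ⊓ V ≤ U) f * rres (inf_le_right : U ⊓ V ≤ V) g = 1)
    (hn : ∀ c : Γ(X, U ⊓ V), ∃ a b,
      c = rres inf_le_left a + rres inf_le_left f ^ n * rres inf_le_right b)
    (hB : Submodule.span Γ(X, U ⊓ V) (Set.range (res B.pval (le_top : U ⊓ V ≤ ⊤))) = ⊤)
    (Φ : B ⟶ A) (hΦ : Function.Surjective (secMap (Modules.pmap Φ) (U ⊓ V)))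
    (hdiv : ∀ q, ∃ r, secMap (Modules.pmap Φ) V q = g ^ (n + 1) • r) (t : sec A.pval V) :
    ∃ (s : sec A.pval ⊤) (r : sec A.pval V), res A.pval le_top s = t - g • r := by
  obtain ⟨b, hb⟩ := hΦ (res A.pval inf_le_right t)
  obtain ⟨p, q, rfl⟩ := exists_eq_add_of_isGloballyGenerated hn hB b
  obtain ⟨r, hr⟩ := hdiv q
  obtain ⟨s, -, hs⟩ := A.sec_glue_two hUV (secMap (Modules.pmap Φ) U p) (t - g • r) (by
    rw [map_sub, ← hb, map_add, LinearMap.map_smul, ← res_secMap, ← res_secMap, hr, res_smul,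
      res_smul, smul_smul, map_pow, pow_succ, ← mul_assoc, ← mul_pow, hfg, one_pow, one_mul,
      add_sub_cancel_right])
  exact ⟨s, r, hs⟩

/-- On U, images of global sections of B generate, since Φ is surjective there. At the other points
g vanishes, and generation modulo g suffices by Nakayama's lemma. -/
theorem isGloballyGenerated_of_hom (hU : IsAffineOpen U) (hV : IsAffineOpen V) (hUV : U ⊔ V = ⊤)
    (hf : U ⊓ V = X.basicOpen f) (hg : U ⊓ V = X.basicOpen g)
    (hfg : rres (inf_le_left : U ⊓ V ≤ U) f * rres (inf_le_right : U ⊓ V ≤ V) g = 1)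
    (hn : ∀ c : Γ(X, U ⊓ V), ∃ a b,
      c = rres inf_le_left a + rres inf_le_left f ^ n * rres inf_le_right b)
    (hA : QC A.pval) (hB : QC B.pval) (hfin : Module.Finite Γ(X, V) (sec A.pval V))
    (hgen : B.IsGloballyGenerated) (Φ : B ⟶ A)
    (hΦ : ∀ W ≤ U, IsAffineOpen W → Function.Surjective (secMap (Modules.pmap Φ) W))
    (hdiv : ∀ q, ∃ r, secMap (Modules.pmap Φ) V q = g ^ (n + 1) • r) :
    A.IsGloballyGenerated := by
  have hO : IsAffineOpen (U ⊓ V) := hf ▸ hU.basicOpen f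
  have key := exists_global_section hUV hfg hn (hgen.span_eq_top hO (hB _ hO)) Φ
    (hΦ _ inf_le_left hO) hdiv
  -- Nakayama's lemma in its global form: there is h ≡ 1 modulo g such that h A(V) is contained in
  -- the span of the global sections.
  obtain ⟨h, hh, hle⟩ := Submodule.exists_sub_one_mem_and_smul_le_of_fg_of_le_sup
    (I := Ideal.span {g}) (N' := (⊤ : Submodule Γ(X, V) (sec A.pval V)))
    (N := Submodule.span Γ(X, V) (Set.range (res A.pval (le_top : V ≤ ⊤))))
    (P := (⊤ : Submodule Γ(X, V) (sec A.pval V)))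
    Module.Finite.fg_top le_top (by
      intro t _
      obtain ⟨s, r, hs⟩ := key t
      rw [← sub_add_cancel t (g • r), ← hs]
      exact Submodule.add_mem_sup (Submodule.subset_span ⟨s, rfl⟩)
        (Submodule.smul_mem_smul (Ideal.mem_span_singleton_self g) trivial))
  refine Modules.isGloballyGenerated_of_locSpan fun W s x hx => ?_
  have hxUV : x ∈ U ∨ x ∈ V := by
    have : x ∈ U ⊔ V := hUV ▸ trivial
    exact this
  by_cases hxU : x ∈ U
  · obtain ⟨φ, hφ, hxφ⟩ := hU.exists_basicOpen_subset hxU hx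
    obtain ⟨b, hb⟩ := hΦ _ (X.basicOpen_le φ) (hU.basicOpen φ) (res A.pval hφ s)
    obtain ⟨W', hW', hxW', hs⟩ := Modules.mem_locSpan_of_isGloballyGenerated hgen b x hxφ
    refine ⟨W', hW'.trans hφ, hxW', ?_⟩
    rw [← res_res A.pval hφ hW', ← hb, res_secMap]
    have := Submodule.mem_map_of_mem (f := secMap (Modules.pmap Φ) W') hs
    rw [Submodule.map_span] at this
    refine Submodule.span_mono ?_ this
    rintro _ ⟨_, ⟨t, -, rfl⟩, rfl⟩
    exact ⟨secMap (Modules.pmap Φ) ⊤ t, trivial, res_secMap _ _ _⟩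
  · have hxV := hxUV.resolve_left hxU
    -- Outside U the function g is not invertible, so h, which is congruent to 1 modulo g, is a unit
    -- at x.
    have hxh : x ∈ X.basicOpen h := by
      obtain ⟨e, he⟩ := Ideal.mem_span_singleton'.1 hh
      rw [X.mem_basicOpen _ _ hxV]
      by_contra hu
      have hxg : ¬ IsUnit (X.presheaf.germ V x hxV g) := by
        rw [← X.mem_basicOpen _ _ hxV, ← hg]
        exact fun h => hxU h.1
      have h1 : IsUnit (X.presheaf.germ V x hxV h + X.presheaf.germ V x hxV (-(e * g))) := by
        rw [← map_add, he, neg_sub, add_sub_cancel, map_one]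
        exact isUnit_one
      rcases IsLocalRing.isUnit_or_isUnit_of_isUnit_add h1 with h2 | h2
      · exact hu h2
      · rw [map_neg, map_mul, IsUnit.neg_iff] at h2
        exact hxg (isUnit_of_mul_isUnit_right h2)
    obtain ⟨φ, hφ, hxφ⟩ := hV.exists_basicOpen_subset hxV (W := W ⊓ X.basicOpen h) ⟨hx, hxh⟩
    refine ⟨X.basicOpen φ, hφ.trans inf_le_left, hxφ, ?_⟩
    obtain ⟨m, t, ht⟩ := (hA V hV).extend φ (res A.pval (hφ.trans inf_le_left) s)
    have hu := (isUnit_rres_basicOpen φ (X.basicOpen_le φ) le_rfl).pow m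
    have hu' := isUnit_rres_basicOpen h (X.basicOpen_le φ) (hφ.trans inf_le_right)
    rw [← Submodule.smul_mem_iff_of_isUnit _ hu, ← ht, ← Submodule.smul_mem_iff_of_isUnit _ hu',
      ← res_smul]
    refine res_mem_span (X.basicOpen_le φ) ?_ (hle (Submodule.smul_mem_pointwise_smul t h ⊤ trivial))
    rintro _ ⟨s, rfl⟩
    exact Submodule.subset_span ⟨s, trivial, (res_res A.pval _ _ _).symm⟩

end Criterion

end AlgebraicGeometry.Scheme

namespace AlgebraicGeometry.Scheme

/-! ### Ampleness along generically surjective morphisms -/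

section Ample

variable {X Y : Scheme.{u}}

theorem Modules.IsCoherent.qc_pullback (γ : Y ⟶ X) {M : X.Modules} (hM : M.IsCoherent) :
    QC ((Modules.pullback γ).obj M).pval := by
  obtain ⟨σ, hσ⟩ := SheafOfModules.IsFinitePresentation.exists_quasicoherentData (self := hM)
  have : SheafOfModules.IsQuasicoherent (R := X.ringCatSheaf) M :=
    SheafOfModules.IsQuasicoherent.mk (R := X.ringCatSheaf) (M := M) ⟨σ⟩
  have := isQuasicoherent_pullback γ M
  exact isQCOn_of_isQuasicoherent _

theorem Modules.IsCoherent.finite_pullback (γ : Y ⟶ X) {M : X.Modules} (hM : M.IsCoherent)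
    {U : Y.Opens} (hU : IsAffineOpen U) :
    Module.Finite Γ(Y, U) (sec ((Modules.pullback γ).obj M).pval U) :=
  (isLocallyFinite_pullback γ hM.qc fun _ h => hM.finite h).finite hU (hM.qc_pullback γ U hU)

/-- The morphism `F ⊗ Symᵐ E ⟶ F' ⊗ Symᵐ E'` induced by `F ⟶ F'` and `E ⟶ E'`. -/
def tensorSymMap {F F' E E' : X.Modules} (φ : F ⟶ F') (ψ : E ⟶ E') (m : ℕ) :
    F.tensor (Modules.symPower m E) ⟶ F'.tensor (Modules.symPower m E') :=
  shfMap (tmodMap (Modules.pmap φ) (Modules.pmap (shfMap (smodMap m (Modules.pmap ψ)))))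

theorem tensorSymMap_surjective {F F' E E' : X.Modules} {φ : F ⟶ F'} {ψ : E ⟶ E'} (m : ℕ)
    (hF' : QC F'.pval) (hE' : QC E'.pval) {W : X.Opens} (hW : IsAffineOpen W)
    (hφ : Function.Surjective (secMap (Modules.pmap φ) W))
    (hψ : Function.Surjective (secMap (Modules.pmap ψ) W)) :
    Function.Surjective (secMap (Modules.pmap (tensorSymMap φ ψ m)) W) :=
  secMap_shfMap_surjective (hF'.tmod (hE'.smod m).shf) hW (secMap_tmodMap_surjective hφ
    (secMap_shfMap_surjective (hE'.smod m) hW (secMap_smodMap_surjective m hψ)))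

theorem exists_secMap_shfMap_tmodMap_eq_smul {P P' Q Q' : PMod X} (φ : P ⟶ P') (χ : Q ⟶ Q')
    {V : X.Opens} (hV : IsAffineOpen V) (hP : QC P) (hQ : QC Q) {t : Γ(X, V)}
    (h : ∀ a, ∃ r, secMap φ V a = t • r) (q : sec (shf (tmod P Q)).pval V) :
    ∃ r, secMap (Modules.pmap (shfMap (tmodMap φ χ))) V q = t • r := by
  obtain ⟨q, rfl⟩ := toShf_surjective (hP.tmod hQ) hV q
  suffices H : ∃ r, secMap (tmodMap φ χ) V q = t • r by
    obtain ⟨r, hr⟩ := H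
    exact ⟨toShf _ V r, by rw [shfMap_toShf, hr, LinearMap.map_smul]⟩
  induction q using tmul_induction with
  | h0 => exact ⟨0, by rw [map_zero, smul_zero]⟩
  | ht a b =>
    obtain ⟨r, hr⟩ := h a
    refine ⟨tmul r (secMap χ V b), ?_⟩
    have := smul_tmul_smul t 1 r (secMap χ V b)
    rw [one_smul, mul_one] at this
    rw [secMap_tmodMap, hr, this]
  | ha s s' hs hs' =>
    obtain ⟨r, hr⟩ := hs
    obtain ⟨r', hr'⟩ := hs'
    exact ⟨r + r', by rw [map_add, hr, hr', smul_add]⟩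

/-- Ampleness of E is applied to the subsheaf N of F of sections divisible by gⁿ⁺¹ on V, and the m₀
for N and E serves for F and E'. Replacing F by N makes the image over V divisible by gⁿ⁺¹, as the
criterion requires. -/
theorem isAmple_of_hom [IsLocallyNoetherian X] {U V : X.Opens} {f : Γ(X, U)} {g : Γ(X, V)} {n : ℕ}
    (hU : IsAffineOpen U) (hV : IsAffineOpen V) (hUV : U ⊔ V = ⊤)
    (hf : U ⊓ V = X.basicOpen f) (hg : U ⊓ V = X.basicOpen g)
    (hfg : rres (inf_le_left : U ⊓ V ≤ U) f * rres (inf_le_right : U ⊓ V ≤ V) g = 1)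
    (hn : ∀ c : Γ(X, U ⊓ V), ∃ a b,
      c = rres inf_le_left a + rres inf_le_left f ^ n * rres inf_le_right b)
    {E E' : X.Modules} (hE : QC E.pval) (hE' : QC E'.pval)
    (hfin : Module.Finite Γ(X, V) (sec E'.pval V)) (ψ : E ⟶ E')
    (hψ : ∀ W ≤ U, IsAffineOpen W → Function.Surjective (secMap (Modules.pmap ψ) W))
    (h : Modules.IsAmple E) : Modules.IsAmple E' := by
  intro F hF
  have hgn : V ⊓ U ≤ X.basicOpen (g ^ (n + 1)) := by
    rw [X.basicOpen_pow _ n.succ_pos, inf_comm, hg]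
  have hN := hF.divisibleBy hU hV hUV hgn
  obtain ⟨m₀, hm₀, hm⟩ := h _ hN
  refine ⟨m₀, hm₀, fun m hmm => ?_⟩
  have hQ := hF.qc.tmod (hE'.smod m).shf
  refine isGloballyGenerated_of_hom hU hV hUV hf hg hfg hn hQ.shf
    (hN.qc.tmod (hE.smod m).shf).shf
    (finite_shf hQ hV (finite_tmod (hF.finite hV)
      (finite_shf (hE'.smod m) hV (finite_smod m hfin)))) (hm m hmm)
    (tensorSymMap (F.divisibleBy V (g ^ (n + 1))).ι ψ m) (fun W hW hWA => ?_)
    (exists_secMap_shfMap_tmodMap_eq_smul _ _ hV hN.qc (hE.smod m).shf fun a => ?_)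
  · exact tensorSymMap_surjective m hF.qc hE' hWA (fun s => ⟨Modules.LocalSubmodule.mkSec _ s
    (Modules.mem_divisibleBy ((inf_le_inf_left V hW).trans hgn) s), rfl⟩) (hψ W hW hWA)
  · obtain ⟨r, hr⟩ := Modules.exists_eq_smul_of_mem_divisibleBy hF.qc le_rfl hV
      ((F.divisibleBy V (g ^ (n + 1))).ι_mem a)
    exact ⟨r, by rwa [rres_self] at hr⟩

end Ample

/-! ### Comparing logarithmic forms along two divisors -/

section Divisor

theorem EffectiveDivisor.compl_le {X : Scheme.{u}} {D D' : EffectiveDivisor X}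
    (h : D'.support ⊆ D.support) : D.compl ≤ D'.compl :=
  Set.compl_subset_compl.2 (Set.biUnion_subset_biUnion_left h)

variable {X : Scheme.{u}} [IsIntegral X] {D D' : EffectiveDivisor X}

theorem EffectiveDivisor.reducedIdeal_le (h : D'.support ⊆ D.support) (x : X) :
    D.reducedIdeal x ≤ D'.reducedIdeal x := fun _ hr =>
  D'.mem_reducedIdeal.2 fun P hP => D.mem_reducedIdeal.1 hr P (h hP)

theorem EffectiveDivisor.reducedIdeal_eq_top {x : X} (hx : x ∈ D.compl) : D.reducedIdeal x = ⊤ := by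
  refine (Ideal.eq_top_iff_one _).2 (D.mem_reducedIdeal.2 fun P hP hPx => (hx ?_).elim)
  exact Set.mem_biUnion hP hPx.mem_closure

variable (k : Type u) [Field k] [X.Over (Spec (.of k))]

/-- Enlarging a divisor enlarges the sheaf of logarithmic forms. -/
def logCotangentIncl (h : D'.support ⊆ D.support) :
    logCotangentSheaf k D' ⟶ logCotangentSheaf k D :=
  latIncl fun x => KaehlerDifferential.logForms_antitone (EffectiveDivisor.reducedIdeal_le h x)

/-- Away from D both reduced ideals are the unit ideal, so both lattices coincide. -/
theorem logCotangentIncl_surjective (h : D'.support ⊆ D.support) {U : X.Opens} (hU : U ≤ D.compl) :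
    Function.Surjective (secMap (Modules.pmap (logCotangentIncl k h)) U) := by
  refine latIncl_surjective _ fun x hx => ?_
  refine KaehlerDifferential.logForms_antitone ?_
  rw [EffectiveDivisor.reducedIdeal_eq_top (hU hx),
    EffectiveDivisor.reducedIdeal_eq_top (EffectiveDivisor.compl_le h (hU hx))]

theorem isQuasiAmpleWrt_logCotangentSheaf [IsAlgClosed k] [LocallyOfFiniteType (X ↘ Spec (.of k))]
    (hD : D'.support ⊆ D.support)
    (h : Modules.IsQuasiAmpleWrt k (logCotangentSheaf k D') D'.compl) :
    Modules.IsQuasiAmpleWrt k (logCotangentSheaf k D) D.compl := by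
  intro C _ _ _ _ γ _ hγ ⟨c₀, hc₀⟩
  have hE := h C γ hγ ⟨c₀, EffectiveDivisor.compl_le hD hc₀⟩
  -- A curve consisting only of its generic point would make γ constant.
  have hc₁ : ∃ c₁ : C, c₁ ≠ genericPoint C := by
    by_contra! hc
    exact hγ ⟨γ (genericPoint C), fun c => by rw [hc c]⟩
  obtain ⟨c₁, hc₁⟩ := hc₁
  obtain ⟨U, V, f, g, hU, hV, hUV, hUD, hf, hg, hfg, n, hn⟩ :=
    exists_affine_cover k (V₀ := γ ⁻¹ᵁ D.compl) hc₀ hc₁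
  have := isLocallyNoetherian_of_over k (C := C)
  have hM := isCoherent_logCotangentSheaf (k := k) D
  have hM' := isCoherent_logCotangentSheaf (k := k) D'
  refine isAmple_of_hom hU hV hUV hf hg hfg hn (hM'.qc_pullback γ) (hM.qc_pullback γ)
    (hM.finite_pullback γ hV) ((Modules.pullback γ).map (logCotangentIncl k hD))
    (fun W hW hWA => ?_) hE
  exact Modules.secMap_surjective_of_locRange _ hWA (hM'.qc_pullback γ W hWA)
    (hM.qc_pullback γ W hWA) (mem_locRange_pullback_map γ _
      (fun _ hV => logCotangentIncl_surjective k hD hV) (hW.trans hUD))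

end Divisor

end AlgebraicGeometry.Scheme

end

theorem mainTheorem9 (k : Type u) [Field k] [IsAlgClosed k]
    (X : Scheme.{u}) [X.Over (Spec (.of k))] [IsIntegral X]
    [IsSeparated (X ↘ Spec (.of k))] [QuasiCompact (X ↘ Spec (.of k))]
    [Smooth (X ↘ Spec (.of k))]
    (D D₁ D₂ : Scheme.EffectiveDivisor X) (hD : D = D₁ + D₂) (hnc : D.IsNormalCrossing)
    (h : Scheme.Modules.IsQuasiAmpleWrt k (Scheme.logCotangentSheaf k D₂) D₂.compl) :
    Scheme.Modules.IsQuasiAmpleWrt k (Scheme.logCotangentSheaf k D) D.compl := by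
  -- Coefficients are natural numbers, so nothing cancels in D₁ + D₂ and components of D₂ remain
  -- components of D.
  refine Scheme.isQuasiAmpleWrt_logCotangentSheaf k (fun P hP => ?_) h
  rw [Finsupp.mem_support_iff] at hP ⊢
  rw [hD, Finsupp.add_apply]
  omega
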